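/- Let $(n_m)_{m\ge 1}$ and $(N_m)_{m\ge 1}$ be sequences of natural numbers with $n_m\to\infty$, $N_m\to\infty$ and $n_m/N_m\to\lambda\in(0,\infty)$. For each $m$ let $f_1,\dots,f_N$ (where $n=n_m$, $N=N_m$, and the $f_j=f_j^{(m)}$ may depend on $m$) be independent random vectors in $\mathbb{C}^n$ on a probability space. Let $(x,y)$ and $\|\cdot\|$ denote the Euclidean inner product and norm on $\mathbb{C}^n$ (and $\|T\|$ the operator norm of $T$), let $S^{n-1}$ be the unit sphere of $\mathbb{C}^n$, let $x\otimes x$ be the operator $z\mapsto (z,x)\,x$, and let $\mathrm{tr}=\frac1n\mathrm{Tr}$ be the normalized trace. Suppose that there are constants $L>0$, $L_k>0$, $C_k>0$, $a_k\in\mathbb{C}$ ($k=1,2,3,\dots$) and $\epsilon_0>0$, all independent of $m$, such that for all $m$: $$\sup_{x\in S^{n-1}}\mathbb{E}|(f_j,x)|^4\le \frac{L}{n^2}\quad\text{and}\quad \mathbb{E}\|f_j\|^k\le L_k\qquad\text{for all } 1\le j\le N,\ k\ge 1,$$ $$\Bigl\|\sum_{j=1}^N\mathbb{E}\bigl[\|f_j\|^{2(k-1)}f_j\otimes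 f_j\bigr]-a_kI\Bigr\|\le C_k\,n^{-\epsilon_0}\qquad\text{for all } k\ge 1.$$ Then, for every integer $p\ge 0$, the random variables $\mathrm{tr}\bigl(f_1\otimes f_1+\dots+f_N\otimes f_N\bigr)^p$ are integrable and, as $m\to\infty$, $$\mathbb{E}\,\mathrm{tr}\bigl(f_1\otimes f_1+\dots+f_N\otimes f_N\bigr)^p\ \longrightarrow\ \sum_{\pi\in NC(p)}\ \prod_{B\in\pi}a_{|B|},$$ where $NC(p)$ is the set of noncrossing partitions of $\{1,\dots,p\}$, i.e. the partitions for which there are no $i<j<k<l$ with $i,k$ in one block and $j,l$ in a different block. (For $p=0$ the right-hand side is $1$.) -/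

import Mathlib

open MeasureTheory ProbabilityTheory Filter Topology

noncomputable section

namespace SampleCov

/-- A partition `π` of the linearly ordered set `Fin p` is noncrossing if there are no
`i < j < k < l` such that `i, k` lie in one block and `j, l` lie in a different block. -/
def IsNoncrossing {p : ℕ} (π : Finpartition (Finset.univ : Finset (Fin p))) : Prop :=
  ∀ B ∈ π.parts, ∀ B' ∈ π.parts, ∀ i j k l : Fin p, i < j → j < k → k < l →
    i ∈ B → k ∈ B → j ∈ B' → l ∈ B' → B = B'

open scoped Classical in
/-- The finite set of all noncrossing partitions of a linearly ordered set with `p` elements. -/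
def NC (p : ℕ) : Finset (Finpartition (Finset.univ : Finset (Fin p))) :=
  Finset.univ.filter IsNoncrossing

/-- The rank-one operator `x ⊗ x` on `ℂⁿ`, that is, `z ↦ ⟨z, x⟩ x` with the inner product linear
in `z`; its matrix is `x x^*`. -/
def selfTensor {n : ℕ} (x : EuclideanSpace ℂ (Fin n)) :
    EuclideanSpace ℂ (Fin n) →L[ℂ] EuclideanSpace ℂ (Fin n) :=
  InnerProductSpace.rankOne ℂ x x

/-- The normalized trace `n⁻¹ Tr` of an operator on `ℂⁿ`. -/
def normTrace {n : ℕ} (T : EuclideanSpace ℂ (Fin n) →L[ℂ] EuclideanSpace ℂ (Fin n)) : ℂ :=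
  (n : ℂ)⁻¹ * LinearMap.trace ℂ (EuclideanSpace ℂ (Fin n)) T.toLinearMap

end SampleCov

end

/-! Write M for the sum of the f_j ⊗ f_j and M_j for the same sum without its j-th term. The
assertion proved is stronger than convergence of traces: E Mᵖ x is close to c_p x, uniformly over x
in the unit ball, where c_p is the sum over noncrossing partitions. The normalized trace only
averages this over an orthonormal basis.

Telescoping Mᵖ about M_j gives ⟨f_j, Mᵖ x⟩ = ⟨f_j, M_jᵖ x⟩ + ∑_{i<p} ⟨f_j, M_jⁱ f_j⟩ ⟨f_j, M^{p-1-i}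
x⟩. Since M_j is independent of f_j, in mean M_jᵖ x may be replaced by c_p x; and since quadratic
forms of M_jⁱ concentrate, ⟨f_j, M_jⁱ f_j⟩ may be replaced by c_i ‖f_j‖². Multiplying by ‖f_j‖²ᵏ ⟨y,
f_j⟩, taking expectations and summing over j, the limits d(p,k) ⟨y, x⟩ of these cross moments obey
d(p,k) = a_{k+1} c_p + ∑_{i<p} c_i d(p-1-i, k+1), and c_{p+1} = d(p,0) because M is the sum of the
f_j ⊗ f_j (`IsSample.crossMoment_eq`, `dLim_step`, `uMean_and_dLim`).

Noncrossing partitions obey the same recursion (`exists_ncRecursion`). Here d(p,k) sums over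
partitions of p+1 points in which the block of the first point counts k extra elements. Either that
point is alone in its block, or the next point of its block encloses i points with it, which are
partitioned on their own, and the two points can be merged into one at the price of one more extra
element.

Concentration comes from the Efron-Stein inequality (`IsSample.efron_stein`): passing from M to M_j
changes ⟨x, Mᵖ x⟩ by products of inner products with f_j, the square of the change has mean o(1/n),
and there are O(n) indices. This rests on bounds uniform in n: E Tr Mᵖ = O(n), the moments of ⟨f_j,
Mⁱ f_j⟩ are O(1), and E ⟨x, Mᵖ x⟩ = O(1) for unit x (`IsSample.integral_quad_odd_le`). The last is
the delicate one, because only four marginal moments of f_j are controlled. Odd powers are sums of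
the squares |⟨f_j, Mᵃ x⟩|², and the even order that their expansion produces is absorbed by
interpolation between its odd neighbours. -/

noncomputable section

namespace SampleCov

set_option linter.unusedSectionVars false

/-! ### Noncrossing partitions of intervals and their recursion -/

/-- `P` is the set of blocks of a noncrossing partition of the finite set `s` of integers. -/
structure IsNCBlocks (s : Finset ℕ) (P : Finset (Finset ℕ)) : Prop where
  nonempty : ∀ B ∈ P, B.Nonempty
  subset : ∀ B ∈ P, B ⊆ s
  cover : ∀ x ∈ s, ∃ B ∈ P, x ∈ B
  eq_of_mem : ∀ B ∈ P, ∀ B' ∈ P, ∀ x, x ∈ B → x ∈ B' → B = B'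
  noncross : ∀ B ∈ P, ∀ B' ∈ P, ∀ i j k l : ℕ, i < j → j < k → k < l →
    i ∈ B → k ∈ B → j ∈ B' → l ∈ B' → B = B'

open scoped Classical in
/-- The finite set of noncrossing partitions of `s`, given by their sets of blocks. -/
def ncBlocks (s : Finset ℕ) : Finset (Finset (Finset ℕ)) :=
  s.powerset.powerset.filter (IsNCBlocks s)

lemma mem_ncBlocks {s : Finset ℕ} {P : Finset (Finset ℕ)} : P ∈ ncBlocks s ↔ IsNCBlocks s P := by
  simp only [ncBlocks, Finset.mem_filter, Finset.mem_powerset, and_iff_right_iff_imp]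
  intro h B hB
  exact Finset.mem_powerset.2 (h.subset B hB)

/-- The sum of the products of block weights over the noncrossing partitions of an interval. -/
def ncSum (a : ℕ → ℂ) (u p : ℕ) : ℂ :=
  ∑ P ∈ ncBlocks (Finset.Ico u (u + p)), ∏ B ∈ P, a B.card

/-- As `ncSum`, for an interval of `p + 1` integers, where `k` virtual elements are added to the
block of the smallest element. -/
def ncSumShift (a : ℕ → ℂ) (u p k : ℕ) : ℂ :=
  ∑ P ∈ ncBlocks (Finset.Ico u (u + (p + 1))), ∏ B ∈ P, a (B.card + if u ∈ B then k else 0)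

lemma ncSum_zero (a : ℕ → ℂ) (u : ℕ) : ncSum a u 0 = 1 := by
  have : ncBlocks (Finset.Ico u (u + 0)) = {∅} := by
    ext P
    rw [mem_ncBlocks, Finset.mem_singleton]
    constructor
    · intro h
      rw [Finset.eq_empty_iff_forall_notMem]
      intro B hB
      obtain ⟨x, hx⟩ := h.nonempty B hB
      simpa using h.subset B hB hx
    · rintro rfl
      constructor <;> simp
  rw [ncSum, this]
  simp

lemma ncSum_succ (a : ℕ → ℂ) (u p : ℕ) : ncSum a u (p + 1) = ncSumShift a u p 0 := by
  simp [ncSum, ncSumShift]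

/-- A singleton block at the left end constrains no other block, so deleting it is a bijection onto
the noncrossing partitions of the remaining interval; its weight is that of one real and `k` virtual
elements. -/
lemma sum_ncBlocks_singleton (a : ℕ → ℂ) (u p k : ℕ) :
    ∑ P ∈ (ncBlocks (Finset.Ico u (u + (p + 1)))).filter (fun P => {u} ∈ P),
      ∏ B ∈ P, a (B.card + if u ∈ B then k else 0) = a (k + 1) * ncSum a (u + 1) p := by
  rw [ncSum, Finset.mul_sum]
  refine Finset.sum_nbij' (fun P => P.erase {u}) (fun P => insert {u} P) ?_ ?_ ?_ ?_ ?_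
  · intro P hP
    rw [Finset.mem_filter, mem_ncBlocks] at hP
    obtain ⟨h, hu⟩ := hP
    rw [mem_ncBlocks]
    refine ⟨fun B hB => h.nonempty B (Finset.mem_of_mem_erase hB), ?_, ?_, ?_, ?_⟩
    · intro B hB x hx
      have h1 := h.subset B (Finset.mem_of_mem_erase hB) hx
      have h2 : x ≠ u := by
        rintro rfl
        exact Finset.ne_of_mem_erase hB
          (h.eq_of_mem B (Finset.mem_of_mem_erase hB) _ hu x hx (by simp))
      simp only [Finset.mem_Ico] at h1 ⊢
      omega
    · intro x hx
      simp only [Finset.mem_Ico] at hx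
      obtain ⟨B, hB, hxB⟩ := h.cover x (by simp only [Finset.mem_Ico]; omega)
      refine ⟨B, Finset.mem_erase.2 ⟨?_, hB⟩, hxB⟩
      rintro rfl
      simp at hxB
      omega
    · intro B hB B' hB'
      exact h.eq_of_mem B (Finset.mem_of_mem_erase hB) B' (Finset.mem_of_mem_erase hB')
    · intro B hB B' hB'
      exact h.noncross B (Finset.mem_of_mem_erase hB) B' (Finset.mem_of_mem_erase hB')
  · intro P hP
    rw [mem_ncBlocks] at hP
    have hnot : ∀ B ∈ P, u ∉ B := fun B hB hu => by
      have := hP.subset B hB hu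
      simp at this
    rw [Finset.mem_filter, mem_ncBlocks]
    refine ⟨⟨?_, ?_, ?_, ?_, ?_⟩, by simp⟩
    · intro B hB
      rcases Finset.mem_insert.1 hB with rfl | hB
      · simp
      · exact hP.nonempty B hB
    · intro B hB x hx
      rcases Finset.mem_insert.1 hB with rfl | hB
      · simp at hx ⊢
        omega
      · have := hP.subset B hB hx
        simp at this ⊢
        omega
    · intro x hx
      by_cases hxu : x = u
      · exact ⟨{u}, by simp, by simp [hxu]⟩
      · obtain ⟨B, hB, hxB⟩ := hP.cover x (by simp at hx ⊢; omega)
        exact ⟨B, by simp [hB], hxB⟩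
    · intro B hB B' hB' x hx hx'
      rw [Finset.mem_insert] at hB hB'
      rcases hB with rfl | hB <;> rcases hB' with rfl | hB'
      · rfl
      · simp at hx
        subst hx
        exact absurd hx' (hnot _ hB')
      · simp at hx'
        subst hx'
        exact absurd hx (hnot _ hB)
      · exact hP.eq_of_mem B hB B' hB' x hx hx'
    · intro B hB B' hB' i j k l hij hjk hkl hi hk hj hl
      rw [Finset.mem_insert] at hB hB'
      rcases hB with rfl | hB <;> rcases hB' with rfl | hB'
      · rfl
      · simp at hi hk
        omega
      · simp at hj hl
        omega
      · exact hP.noncross B hB B' hB' i j k l hij hjk hkl hi hk hj hl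
  · intro P hP
    rw [Finset.mem_filter] at hP
    exact Finset.insert_erase hP.2
  · intro P hP
    rw [mem_ncBlocks] at hP
    refine Finset.erase_insert fun hu => ?_
    have := hP.subset _ hu (Finset.mem_singleton_self u)
    simp at this
  · intro P hP
    rw [Finset.mem_filter, mem_ncBlocks] at hP
    obtain ⟨h, hu⟩ := hP
    rw [← Finset.mul_prod_erase P _ hu]
    congr 1
    · simp [add_comm]
    · refine Finset.prod_congr rfl fun B hB => ?_
      have : u ∉ B := fun hx => Finset.ne_of_mem_erase hB
        (h.eq_of_mem B (Finset.mem_of_mem_erase hB) _ hu u hx (by simp))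
      simp [this]

/-- `v` is the successor of the smallest element `u` in its block. -/
def IsNext (u v : ℕ) (P : Finset (Finset ℕ)) : Prop :=
  ∃ B ∈ P, u ∈ B ∧ v ∈ B ∧ u < v ∧ ∀ w ∈ B, u < w → v ≤ w

/-- A block not containing `u` with points on both sides of `v` would cross the pair `u`, `v`. Hence
this pair separates the other blocks into those strictly between and those beyond. -/
lemma IsNCBlocks.block_cases {u v e : ℕ} {P : Finset (Finset ℕ)}
    (h : IsNCBlocks (Finset.Ico u e) P) (hv : IsNext u v P) (B : Finset ℕ) (hB : B ∈ P) :
    (u ∉ B ∧ v ∉ B ∧ B ⊆ Finset.Ico (u + 1) v) ∨ (u ∉ B ∧ v ∉ B ∧ B ⊆ Finset.Ico v e) ∨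
      (u ∈ B ∧ v ∈ B ∧ B.erase u ⊆ Finset.Ico v e) := by
  obtain ⟨B₀, hB₀, hu₀, hv₀, huv, hmin⟩ := hv
  by_cases hBB : B = B₀
  · subst hBB
    refine Or.inr (Or.inr ⟨hu₀, hv₀, fun x hx => ?_⟩)
    obtain ⟨hxu, hx⟩ := Finset.mem_erase.1 hx
    have h1 := Finset.mem_Ico.1 (h.subset B hB hx)
    have h2 := hmin x hx (by omega)
    simp only [Finset.mem_Ico]
    omega
  · have hu : u ∉ B := fun hx => hBB (h.eq_of_mem B hB B₀ hB₀ u hx hu₀)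
    have hv : v ∉ B := fun hx => hBB (h.eq_of_mem B hB B₀ hB₀ v hx hv₀)
    by_cases hlow : ∃ b ∈ B, b < v
    · left
      refine ⟨hu, hv, fun x hx => ?_⟩
      obtain ⟨b, hb, hbv⟩ := hlow
      have hb1 := Finset.mem_Ico.1 (h.subset B hB hb)
      have hx1 := Finset.mem_Ico.1 (h.subset B hB hx)
      have hbu : b ≠ u := fun hh => hu (hh ▸ hb)
      have hxu : x ≠ u := fun hh => hu (hh ▸ hx)
      have hxv : x ≠ v := fun hh => hv (hh ▸ hx)
      simp only [Finset.mem_Ico]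
      refine ⟨by omega, ?_⟩
      by_contra hxv'
      exact hBB (h.noncross B₀ hB₀ B hB u b v x (by omega) hbv (by omega) hu₀ hv₀ hb hx).symm
    · right; left
      refine ⟨hu, hv, fun x hx => ?_⟩
      have hx1 := Finset.mem_Ico.1 (h.subset B hB hx)
      push Not at hlow
      have := hlow x hx
      simp only [Finset.mem_Ico]
      omega

/-- Adjoin `u` to the block of `v`. -/
def addTo (u v : ℕ) (B : Finset ℕ) : Finset ℕ := if v ∈ B then insert u B else B

lemma mem_addTo {u v x : ℕ} {B : Finset ℕ} : x ∈ addTo u v B ↔ x ∈ B ∨ (x = u ∧ v ∈ B) := by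
  unfold addTo
  split_ifs with h <;> simp [h, or_comm]

lemma isNCBlocks_low {u v e : ℕ} {P : Finset (Finset ℕ)}
    (h : IsNCBlocks (Finset.Ico u e) P) (hve : v ≤ e) (hv : IsNext u v P) :
    IsNCBlocks (Finset.Ico (u + 1) v) (P.filter (· ⊆ Finset.Ico (u + 1) v)) := by
  refine ⟨fun B hB => h.nonempty B (Finset.mem_of_mem_filter B hB),
    fun B hB => (Finset.mem_filter.1 hB).2, fun x hx => ?_,
    fun B hB B' hB' => h.eq_of_mem B (Finset.mem_of_mem_filter B hB) B'
      (Finset.mem_of_mem_filter B' hB'),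
    fun B hB B' hB' => h.noncross B (Finset.mem_of_mem_filter B hB) B'
      (Finset.mem_of_mem_filter B' hB')⟩
  rw [Finset.mem_Ico] at hx
  obtain ⟨B, hB, hxB⟩ := h.cover x (by simp only [Finset.mem_Ico]; omega)
  refine ⟨B, Finset.mem_filter.2 ⟨hB, ?_⟩, hxB⟩
  rcases h.block_cases hv B hB with h1 | h1 | h1
  · exact h1.2.2
  · have := Finset.mem_Ico.1 (h1.2.2 hxB)
    omega
  · have := Finset.mem_Ico.1 (h1.2.2 (Finset.mem_erase.2 ⟨by omega, hxB⟩))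
    omega

lemma IsNCBlocks.high_cases {u v e : ℕ} {P : Finset (Finset ℕ)}
    (h : IsNCBlocks (Finset.Ico u e) P) (hv : IsNext u v P) {B : Finset ℕ}
    (hB : B ∈ P.filter (¬ · ⊆ Finset.Ico (u + 1) v)) :
    B ∈ P ∧ B.erase u ⊆ Finset.Ico v e ∧ (u ∈ B ↔ v ∈ B) := by
  obtain ⟨hB, hn⟩ := Finset.mem_filter.1 hB
  rcases h.block_cases hv B hB with h1 | h1 | h1
  · exact absurd h1.2.2 hn
  · exact ⟨hB, (Finset.erase_subset _ _).trans h1.2.2, by simp [h1.1, h1.2.1]⟩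
  · exact ⟨hB, h1.2.2, by simp [h1.1, h1.2.1]⟩

lemma isNCBlocks_high {u v e : ℕ} {P : Finset (Finset ℕ)}
    (h : IsNCBlocks (Finset.Ico u e) P) (huv : u < v) (hv : IsNext u v P) :
    IsNCBlocks (Finset.Ico v e)
      ((P.filter (¬ · ⊆ Finset.Ico (u + 1) v)).image (Finset.erase · u)) := by
  refine ⟨?_, ?_, ?_, ?_, ?_⟩
  · intro B hB
    rw [Finset.mem_image] at hB
    obtain ⟨B, hB, rfl⟩ := hB
    obtain ⟨hBP, hsub, hiff⟩ := h.high_cases hv hB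
    obtain ⟨x, hx⟩ := h.nonempty B hBP
    by_cases hvB : v ∈ B
    · exact ⟨v, Finset.mem_erase.2 ⟨by omega, hvB⟩⟩
    · refine ⟨x, Finset.mem_erase.2 ⟨?_, hx⟩⟩
      rintro rfl
      exact hvB (hiff.1 hx)
  · intro B hB
    rw [Finset.mem_image] at hB
    obtain ⟨B, hB, rfl⟩ := hB
    exact (h.high_cases hv hB).2.1
  · intro x hx
    rw [Finset.mem_Ico] at hx
    obtain ⟨B, hB, hxB⟩ := h.cover x (by simp only [Finset.mem_Ico]; omega)
    refine ⟨B.erase u, Finset.mem_image.2 ⟨B, Finset.mem_filter.2 ⟨hB, fun hs => ?_⟩, rfl⟩,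
      Finset.mem_erase.2 ⟨by omega, hxB⟩⟩
    have := Finset.mem_Ico.1 (hs hxB)
    omega
  · intro B hB B' hB' x hx hx'
    rw [Finset.mem_image] at hB
    obtain ⟨B, hB, rfl⟩ := hB
    rw [Finset.mem_image] at hB'
    obtain ⟨B', hB', rfl⟩ := hB'
    rw [h.eq_of_mem B (h.high_cases hv hB).1 B' (h.high_cases hv hB').1 x
      (Finset.mem_of_mem_erase hx) (Finset.mem_of_mem_erase hx')]
  · intro B hB B' hB' i j k l hij hjk hkl hi hk hj hl
    rw [Finset.mem_image] at hB
    obtain ⟨B, hB, rfl⟩ := hB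
    rw [Finset.mem_image] at hB'
    obtain ⟨B', hB', rfl⟩ := hB'
    rw [h.noncross B (h.high_cases hv hB).1 B' (h.high_cases hv hB').1 i j k l hij hjk hkl
      (Finset.mem_of_mem_erase hi) (Finset.mem_of_mem_erase hk) (Finset.mem_of_mem_erase hj)
      (Finset.mem_of_mem_erase hl)]

lemma isNCBlocks_join {u v e : ℕ} {P₁ P₂ : Finset (Finset ℕ)} (huv : u < v) (hve : v < e)
    (h₁ : IsNCBlocks (Finset.Ico (u + 1) v) P₁) (h₂ : IsNCBlocks (Finset.Ico v e) P₂) :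
    IsNCBlocks (Finset.Ico u e) (P₁ ∪ P₂.image (addTo u v)) := by
  have b₁ : ∀ B ∈ P₁, ∀ x ∈ B, u + 1 ≤ x ∧ x < v := fun B hB x hx =>
    Finset.mem_Ico.1 (h₁.subset B hB hx)
  have b₂ : ∀ B ∈ P₂, ∀ x ∈ B, v ≤ x ∧ x < e := fun B hB x hx =>
    Finset.mem_Ico.1 (h₂.subset B hB hx)
  have b₃ : ∀ B ∈ P₂, ∀ x ∈ addTo u v B, (x = u ∧ v ∈ B) ∨ (x ∈ B ∧ v ≤ x ∧ x < e) := by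
    intro B hB x hx
    rcases mem_addTo.1 hx with h | h
    · exact Or.inr ⟨h, b₂ B hB x h⟩
    · exact Or.inl h
  refine ⟨?_, ?_, ?_, ?_, ?_⟩
  · intro B hB
    rw [Finset.mem_union] at hB
    rcases hB with hB | hB
    · exact h₁.nonempty B hB
    · rw [Finset.mem_image] at hB
      obtain ⟨B, hB, rfl⟩ := hB
      obtain ⟨x, hx⟩ := h₂.nonempty B hB
      exact ⟨x, mem_addTo.2 (Or.inl hx)⟩
  · intro B hB x hx
    rw [Finset.mem_Ico]
    rw [Finset.mem_union] at hB
    rcases hB with hB | hB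
    · have := b₁ B hB x hx
      omega
    · rw [Finset.mem_image] at hB
      obtain ⟨B, hB, rfl⟩ := hB
      have := b₃ B hB x hx
      omega
  · intro x hx
    rw [Finset.mem_Ico] at hx
    by_cases hxu : x = u
    · obtain ⟨B, hB, hvB⟩ := h₂.cover v (by simp [hve])
      exact ⟨addTo u v B, Finset.mem_union_right _ (Finset.mem_image_of_mem _ hB),
        mem_addTo.2 (Or.inr ⟨hxu, hvB⟩)⟩
    · by_cases hxv : x < v
      · obtain ⟨B, hB, hxB⟩ := h₁.cover x (by simp only [Finset.mem_Ico]; omega)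
        exact ⟨B, Finset.mem_union_left _ hB, hxB⟩
      · obtain ⟨B, hB, hxB⟩ := h₂.cover x (by simp only [Finset.mem_Ico]; omega)
        exact ⟨addTo u v B, Finset.mem_union_right _ (Finset.mem_image_of_mem _ hB),
          mem_addTo.2 (Or.inl hxB)⟩
  · intro B hB B' hB' x hx hx'
    rw [Finset.mem_union] at hB hB'
    rcases hB with hB | hB <;> rcases hB' with hB' | hB'
    · exact h₁.eq_of_mem B hB B' hB' x hx hx'
    · rw [Finset.mem_image] at hB'
      obtain ⟨B', hB', rfl⟩ := hB'
      have := b₁ B hB x hx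
      have := b₃ B' hB' x hx'
      omega
    · rw [Finset.mem_image] at hB
      obtain ⟨B, hB, rfl⟩ := hB
      have := b₁ B' hB' x hx'
      have := b₃ B hB x hx
      omega
    · rw [Finset.mem_image] at hB
      obtain ⟨B, hB, rfl⟩ := hB
      rw [Finset.mem_image] at hB'
      obtain ⟨B', hB', rfl⟩ := hB'
      congr 1
      rcases b₃ B hB x hx with h | h <;> rcases b₃ B' hB' x hx' with h' | h'
      · exact h₂.eq_of_mem B hB B' hB' v h.2 h'.2
      · omega
      · omega
      · exact h₂.eq_of_mem B hB B' hB' x h.1 h'.1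
  · intro B hB B' hB' i j k l hij hjk hkl hi hk hj hl
    rw [Finset.mem_union] at hB hB'
    rcases hB with hB | hB <;> rcases hB' with hB' | hB'
    · exact h₁.noncross B hB B' hB' i j k l hij hjk hkl hi hk hj hl
    · rw [Finset.mem_image] at hB'
      obtain ⟨B', hB', rfl⟩ := hB'
      have := b₁ B hB i hi
      have := b₁ B hB k hk
      have := b₃ B' hB' j hj
      omega
    · rw [Finset.mem_image] at hB
      obtain ⟨B, hB, rfl⟩ := hB
      have := b₁ B' hB' j hj
      have := b₁ B' hB' l hl
      have := b₃ B hB i hi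
      have := b₃ B hB k hk
      omega
    · rw [Finset.mem_image] at hB
      obtain ⟨B, hB, rfl⟩ := hB
      rw [Finset.mem_image] at hB'
      obtain ⟨B', hB', rfl⟩ := hB'
      congr 1
      have hk' : k ∈ B ∧ v ≤ k := by have := b₃ B hB k hk; have := b₃ B' hB' j hj; grind
      have hl' : l ∈ B' := by have := b₃ B' hB' l hl; grind
      have hj' : j ∈ B' ∧ v ≤ j := by have := b₃ B' hB' j hj; have := b₃ B hB i hi; grind
      -- A crossing that starts at `u` is moved so as to start at `v`, which lies in the same block;
      -- if `j = v`, the two blocks already share a point.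
      rcases b₃ B hB i hi with h | h
      · by_cases hjv : j = v
        · exact h₂.eq_of_mem B hB B' hB' v h.2 (hjv ▸ hj'.1)
        · exact h₂.noncross B hB B' hB' v j k l (by omega) hjk hkl h.2 hk'.1 hj'.1 hl'
      · exact h₂.noncross B hB B' hB' i j k l hij hjk hkl h.1 hk'.1 hj'.1 hl'

open scoped Classical in
-- The points strictly between `u` and `v` carry an arbitrary noncrossing partition of their own.
-- The remaining data are a noncrossing partition from `v` on, where `u` survives only as one more
-- virtual element in the block of `v`.
lemma sum_ncBlocks_isNext (a : ℕ → ℂ) (u v e k : ℕ) (huv : u < v) (hve : v < e) :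
    ∑ P ∈ (ncBlocks (Finset.Ico u e)).filter (IsNext u v),
      ∏ B ∈ P, a (B.card + if u ∈ B then k else 0) =
    (∑ P ∈ ncBlocks (Finset.Ico (u + 1) v), ∏ B ∈ P, a B.card) *
      ∑ P ∈ ncBlocks (Finset.Ico v e), ∏ B ∈ P, a (B.card + if v ∈ B then k + 1 else 0) := by
  rw [Finset.sum_mul_sum, ← Finset.sum_product']
  symm
  refine Finset.sum_nbij' (fun Q => Q.1 ∪ Q.2.image (addTo u v))
    (fun P => (P.filter (· ⊆ Finset.Ico (u + 1) v),
      (P.filter (¬ · ⊆ Finset.Ico (u + 1) v)).image (Finset.erase · u))) ?_ ?_ ?_ ?_ ?_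
  · rintro ⟨P₁, P₂⟩ hQ
    simp only [Finset.mem_product, mem_ncBlocks] at hQ
    obtain ⟨h₁, h₂⟩ := hQ
    rw [Finset.mem_filter, mem_ncBlocks]
    refine ⟨isNCBlocks_join huv hve h₁ h₂, ?_⟩
    obtain ⟨B, hB, hvB⟩ := h₂.cover v (by simp [hve])
    refine ⟨addTo u v B, Finset.mem_union_right _ (Finset.mem_image_of_mem _ hB),
      mem_addTo.2 (Or.inr ⟨rfl, hvB⟩), mem_addTo.2 (Or.inl hvB), huv, fun w hw huw => ?_⟩
    rcases mem_addTo.1 hw with hw | hw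
    · exact (Finset.mem_Ico.1 (h₂.subset B hB hw)).1
    · omega
  · intro P hP
    rw [Finset.mem_filter, mem_ncBlocks] at hP
    simp only [Finset.mem_product, mem_ncBlocks]
    exact ⟨isNCBlocks_low hP.1 hve.le hP.2, isNCBlocks_high hP.1 huv hP.2⟩
  · rintro ⟨P₁, P₂⟩ hQ
    simp only [Finset.mem_product, mem_ncBlocks] at hQ
    obtain ⟨h₁, h₂⟩ := hQ
    have k₂ : ∀ B ∈ P₂, ¬ addTo u v B ⊆ Finset.Ico (u + 1) v := by
      intro B hB hs
      obtain ⟨x, hx⟩ := h₂.nonempty B hB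
      have := Finset.mem_Ico.1 (h₂.subset B hB hx)
      have := Finset.mem_Ico.1 (hs (mem_addTo.2 (Or.inl hx)))
      omega
    have e₂ : ∀ B ∈ P₂, (addTo u v B).erase u = B := by
      intro B hB
      have : u ∉ B := fun hu => by
        have := Finset.mem_Ico.1 (h₂.subset B hB hu)
        omega
      unfold addTo
      split_ifs
      · exact Finset.erase_insert this
      · exact Finset.erase_eq_of_notMem this
    refine Prod.ext ?_ ?_
    · ext B
      simp only [Finset.mem_filter, Finset.mem_union, Finset.mem_image]
      constructor
      · rintro ⟨h | ⟨B, hB, rfl⟩, hs⟩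
        · exact h
        · exact absurd hs (k₂ B hB)
      · exact fun h => ⟨Or.inl h, h₁.subset B h⟩
    · ext B
      simp only [Finset.mem_filter, Finset.mem_union, Finset.mem_image]
      constructor
      · rintro ⟨B, ⟨h | ⟨B, hB, rfl⟩, hs⟩, rfl⟩
        · exact absurd (h₁.subset _ h) hs
        · rwa [e₂ B hB]
      · exact fun h => ⟨addTo u v B, ⟨Or.inr ⟨B, h, rfl⟩, k₂ B h⟩, e₂ B h⟩
  · intro P hP
    rw [Finset.mem_filter, mem_ncBlocks] at hP
    obtain ⟨h, hv⟩ := hP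
    have e₁ : ∀ B ∈ P.filter (¬ · ⊆ Finset.Ico (u + 1) v), addTo u v (B.erase u) = B := by
      intro B hB
      obtain ⟨hBP, -, hiff⟩ := h.high_cases hv hB
      unfold addTo
      by_cases hvB : v ∈ B
      · rw [if_pos (Finset.mem_erase.2 ⟨by omega, hvB⟩), Finset.insert_erase (hiff.2 hvB)]
      · rw [if_neg (fun hh => hvB (Finset.mem_of_mem_erase hh)),
          Finset.erase_eq_of_notMem (fun hh => hvB (hiff.1 hh))]
    simp only
    rw [Finset.image_image, Finset.image_congr (g := id), Finset.image_id,
      Finset.filter_union_filter_not_eq]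
    intro B hB
    exact e₁ B hB
  · rintro ⟨P₁, P₂⟩ hQ
    simp only [Finset.mem_product, mem_ncBlocks] at hQ
    obtain ⟨h₁, h₂⟩ := hQ
    have hu₁ : ∀ B ∈ P₁, u ∉ B := fun B hB hu => by
      have := Finset.mem_Ico.1 (h₁.subset B hB hu)
      omega
    have hu₂ : ∀ B ∈ P₂, u ∉ B := fun B hB hu => by
      have := Finset.mem_Ico.1 (h₂.subset B hB hu)
      omega
    simp only
    rw [Finset.prod_union, Finset.prod_image]
    · congr 1
      · refine Finset.prod_congr rfl fun B hB => ?_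
        simp [hu₁ B hB]
      · refine Finset.prod_congr rfl fun B hB => ?_
        unfold addTo
        split_ifs with h h' h'
        · rw [Finset.card_insert_of_notMem (hu₂ B hB)]
          congr 1
          ring
        · exact absurd (Finset.mem_insert_self u B) h'
        · exact absurd h' (hu₂ B hB)
        · rfl
    · intro B hB B' hB' hBB
      obtain ⟨x, hx⟩ := h₂.nonempty B hB
      have h1 : x ∈ addTo u v B' := hBB ▸ mem_addTo.2 (Or.inl hx)
      rcases mem_addTo.1 h1 with h1 | h1
      · exact h₂.eq_of_mem B hB B' hB' x hx h1
      · exact absurd (h1.1 ▸ hx) (hu₂ B hB)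
    · rw [Finset.disjoint_left]
      intro B hB hB'
      rw [Finset.mem_image] at hB'
      obtain ⟨B', hB', rfl⟩ := hB'
      obtain ⟨x, hx⟩ := h₂.nonempty B' hB'
      have := Finset.mem_Ico.1 (h₂.subset B' hB' hx)
      have := Finset.mem_Ico.1 (h₁.subset _ hB (mem_addTo.2 (Or.inl hx)))
      omega

lemma ncSumShift_eq (a : ℕ → ℂ) (u p k : ℕ) :
    ncSumShift a u p k = a (k + 1) * ncSum a (u + 1) p +
      ∑ i ∈ Finset.range p, ncSum a (u + 1) i * ncSumShift a (u + 1 + i) (p - 1 - i) (k + 1) := by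
  classical
  rw [ncSumShift, ← Finset.sum_filter_add_sum_filter_not _ (fun P => {u} ∈ P),
    sum_ncBlocks_singleton]
  congr 1
  set e := u + (p + 1) with he
  -- If `u` is not alone, the partitions are classified by the successor of `u` in its block; `i` is
  -- the number of points enclosed by the two.
  have hdec : (ncBlocks (Finset.Ico u e)).filter (fun P => {u} ∉ P) =
      (Finset.range p).biUnion
        (fun i => (ncBlocks (Finset.Ico u e)).filter (IsNext u (u + 1 + i))) := by
    ext P
    simp only [Finset.mem_filter, mem_ncBlocks, Finset.mem_biUnion, Finset.mem_range]
    constructor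
    · rintro ⟨h, hP⟩
      obtain ⟨B, hB, huB⟩ := h.cover u (by simp [he])
      have hne : (B.erase u).Nonempty := by
        rw [Finset.nonempty_iff_ne_empty]
        intro h0
        rw [Finset.erase_eq_empty_iff] at h0
        rcases h0 with h0 | h0
        · exact absurd huB (by simp [h0])
        · exact hP (h0 ▸ hB)
      set v := (B.erase u).min' hne with hvdef
      have hv : v ∈ B.erase u := Finset.min'_mem _ _
      have hvB := Finset.mem_of_mem_erase hv
      have hvu := Finset.ne_of_mem_erase hv
      have hv1 := Finset.mem_Ico.1 (h.subset B hB hvB)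
      refine ⟨v - (u + 1), by omega, h, B, hB, huB, ?_, by omega, fun w hw huw => ?_⟩
      · rwa [show u + 1 + (v - (u + 1)) = v by omega]
      · have : v ≤ w := Finset.min'_le _ _ (Finset.mem_erase.2 ⟨by omega, hw⟩)
        omega
    · rintro ⟨i, hi, h, B, hB, huB, hvB, huv, hmin⟩
      refine ⟨h, fun hs => ?_⟩
      have := h.eq_of_mem _ hs B hB u (by simp) huB
      rw [← this, Finset.mem_singleton] at hvB
      omega
  rw [hdec, Finset.sum_biUnion]
  · refine Finset.sum_congr rfl fun i hi => ?_
    rw [Finset.mem_range] at hi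
    rw [sum_ncBlocks_isNext a u (u + 1 + i) e k (by omega) (by omega), ncSum, ncSumShift,
      show u + 1 + i + (p - 1 - i + 1) = e by omega]
  · intro i _ i' _ hii
    rw [Function.onFun, Finset.disjoint_left]
    intro P hP hP'
    simp only [Finset.mem_filter, mem_ncBlocks] at hP hP'
    obtain ⟨h, B, hB, huB, hvB, huv, hmin⟩ := hP
    obtain ⟨-, B', hB', huB', hvB', huv', hmin'⟩ := hP'
    have := h.eq_of_mem B hB B' hB' u huB huB'
    subst this
    have := hmin _ hvB' huv'
    have := hmin' _ hvB huv
    omega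

/-- Translation invariance is read off from the recursion, which determines both sums from smaller
ones, so that no bijection is needed. -/
lemma ncSum_eq_zero_left (a : ℕ → ℂ) (p : ℕ) :
    (∀ u, ncSum a u p = ncSum a 0 p) ∧ ∀ u k, ncSumShift a u p k = ncSumShift a 0 p k := by
  induction p using Nat.strong_induction_on with
  | _ p ih =>
    have h1 : ∀ u, ncSum a u p = ncSum a 0 p := by
      intro u
      cases p with
      | zero => simp [ncSum_zero]
      | succ p => rw [ncSum_succ, ncSum_succ, (ih p (by omega)).2 u]
    refine ⟨h1, fun u k => ?_⟩
    rw [ncSumShift_eq, ncSumShift_eq, h1 (u + 1), h1 (0 + 1)]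
    congr 1
    refine Finset.sum_congr rfl fun i hi => ?_
    rw [Finset.mem_range] at hi
    rw [(ih i hi).1 (u + 1), (ih i hi).1 (0 + 1), (ih (p - 1 - i) (by omega)).2 (u + 1 + i),
      (ih (p - 1 - i) (by omega)).2 (0 + 1 + i)]

/-- The recursion cuts intervals at varying points, which is why it is run on blocks of natural
numbers; here the result is carried back to partitions of `Fin p`. -/
lemma sum_NC_eq_ncSum (a : ℕ → ℂ) (p : ℕ) :
    ∑ π ∈ NC p, ∏ B ∈ π.parts, a B.card = ncSum a 0 p := by
  classical
  rw [ncSum, zero_add]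
  let φ : Finset (Fin p) ↪ Finset ℕ := Finset.mapEmbedding Fin.valEmbedding |>.toEmbedding
  have hφ : ∀ B, φ B = B.map Fin.valEmbedding := fun B => rfl
  have hmem : ∀ (B : Finset (Fin p)) (i : Fin p), (i : ℕ) ∈ φ B ↔ i ∈ B := by
    intro B i
    rw [hφ]
    simp [← Fin.ext_iff]
  have hlt : ∀ (B : Finset (Fin p)) (x : ℕ), x ∈ φ B → x < p := by
    intro B x hx
    rw [hφ, Finset.mem_map] at hx
    obtain ⟨i, -, rfl⟩ := hx
    exact i.2
  refine Finset.sum_bij (fun π _ => π.parts.map φ) ?_ ?_ ?_ ?_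
  · intro π hπ
    have hπ : IsNoncrossing π := by simpa [NC] using hπ
    rw [mem_ncBlocks]
    refine ⟨?_, ?_, ?_, ?_, ?_⟩
    · intro B hB
      rw [Finset.mem_map] at hB
      obtain ⟨B, hB, rfl⟩ := hB
      obtain ⟨i, hi⟩ := π.nonempty_of_mem_parts hB
      exact ⟨i, (hmem B i).2 hi⟩
    · intro B hB x hx
      rw [Finset.mem_map] at hB
      obtain ⟨B, hB, rfl⟩ := hB
      simpa using hlt B x hx
    · intro x hx
      have hx : x < p := by simpa using hx
      obtain ⟨B, hB, hxB⟩ := π.exists_mem (Finset.mem_univ (⟨x, hx⟩ : Fin p))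
      exact ⟨φ B, Finset.mem_map_of_mem _ hB, (hmem B ⟨x, hx⟩).2 hxB⟩
    · intro B hB B' hB' x hx hx'
      rw [Finset.mem_map] at hB
      obtain ⟨B, hB, rfl⟩ := hB
      rw [Finset.mem_map] at hB'
      obtain ⟨B', hB', rfl⟩ := hB'
      have hxp := hlt B x hx
      rw [π.eq_of_mem_parts hB hB' ((hmem B ⟨x, hxp⟩).1 hx) ((hmem B' ⟨x, hxp⟩).1 hx')]
    · intro B hB B' hB' i j k l hij hjk hkl hi hk hj hl
      rw [Finset.mem_map] at hB
      obtain ⟨B, hB, rfl⟩ := hB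
      rw [Finset.mem_map] at hB'
      obtain ⟨B', hB', rfl⟩ := hB'
      rw [hπ B hB B' hB' ⟨i, hlt B i hi⟩ ⟨j, hlt B' j hj⟩ ⟨k, hlt B k hk⟩ ⟨l, hlt B' l hl⟩ hij hjk
        hkl ((hmem B ⟨i, _⟩).1 hi) ((hmem B ⟨k, _⟩).1 hk) ((hmem B' ⟨j, _⟩).1 hj)
        ((hmem B' ⟨l, _⟩).1 hl)]
  · intro π _ π' _ h
    exact Finpartition.ext (Finset.map_injective φ h)
  · intro P hP
    rw [mem_ncBlocks] at hP
    have hran : ∀ B ∈ P, ∃ B' : Finset (Fin p), φ B' = B := by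
      intro B hB
      refine ⟨Finset.univ.filter (fun i : Fin p => (i : ℕ) ∈ B), ?_⟩
      ext x
      rw [hφ]
      simp only [Finset.mem_map, Finset.mem_filter, Finset.mem_univ, true_and]
      constructor
      · rintro ⟨i, hi, rfl⟩
        exact hi
      · intro hx
        exact ⟨⟨x, by simpa using hP.subset B hB hx⟩, hx, rfl⟩
    let Q : Finset (Finset (Fin p)) := Finset.univ.filter (fun B => φ B ∈ P)
    have hQ : ∀ B, B ∈ Q ↔ φ B ∈ P := by simp [Q]
    let π : Finpartition (Finset.univ : Finset (Fin p)) :=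
      Finpartition.ofExistsUnique Q (fun _ _ => Finset.subset_univ _)
        (by
          intro i _
          obtain ⟨B, hB, hiB⟩ := hP.cover (i : ℕ) (by simp)
          obtain ⟨B, rfl⟩ := hran B hB
          refine ⟨B, ⟨(hQ B).2 hB, (hmem B i).1 hiB⟩, ?_⟩
          rintro B' ⟨hB', hiB'⟩
          exact φ.injective (hP.eq_of_mem _ ((hQ B').1 hB') _ hB i ((hmem B' i).2 hiB') hiB))
        (by
          intro h
          obtain ⟨x, hx⟩ := hP.nonempty _ ((hQ ∅).1 h)
          rw [hφ] at hx
          simp at hx)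
    have hπ : π.parts = Q := rfl
    refine ⟨π, ?_, ?_⟩
    · simp only [NC, Finset.mem_filter, Finset.mem_univ, true_and]
      intro B hB B' hB' i j k l hij hjk hkl hi hk hj hl
      exact φ.injective (hP.noncross _ ((hQ B).1 hB) _ ((hQ B').1 hB') i j k l hij hjk hkl
        ((hmem _ _).2 hi) ((hmem _ _).2 hk) ((hmem _ _).2 hj) ((hmem _ _).2 hl))
    · rw [hπ]
      ext B
      simp only [Finset.mem_map]
      constructor
      · rintro ⟨B, hB, rfl⟩
        exact (hQ B).1 hB
      · intro hB
        obtain ⟨B', rfl⟩ := hran B hB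
        exact ⟨B', (hQ B').2 hB, rfl⟩
  · intro π _
    rw [Finset.prod_map]
    simp [hφ]

/-- The moments `c` of the limit law, with an auxiliary array `d`, satisfy the recursion that
splits off the successor of the smallest element in its block. -/
lemma exists_ncRecursion (a : ℕ → ℂ) : ∃ (c : ℕ → ℂ) (d : ℕ → ℕ → ℂ),
    (∀ p, ∑ π ∈ NC p, ∏ B ∈ π.parts, a B.card = c p) ∧ c 0 = 1 ∧ (∀ p, c (p + 1) = d p 0) ∧
    ∀ p k, d p k = a (k + 1) * c p + ∑ i ∈ Finset.range p, c i * d (p - 1 - i) (k + 1) := by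
  refine ⟨ncSum a 0, ncSumShift a 0, sum_NC_eq_ncSum a, ncSum_zero a 0, ncSum_succ a 0,
    fun p k => ?_⟩
  rw [ncSumShift_eq, (ncSum_eq_zero_left a p).1 (0 + 1)]
  congr 1
  refine Finset.sum_congr rfl fun i _ => ?_
  rw [(ncSum_eq_zero_left a i).1 (0 + 1), (ncSum_eq_zero_left a (p - 1 - i)).2 (0 + 1 + i)]

/-! ### Moments of a positive operator at a vector -/

/-- The space `ℂⁿ` with its Euclidean norm. -/
abbrev Vec (n : ℕ) := EuclideanSpace ℂ (Fin n)

/-- The linear operators on `ℂⁿ`. -/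
abbrev Op (n : ℕ) := Vec n →L[ℂ] Vec n

variable {n : ℕ}

/-- The `i`-th moment `⟨x, Tⁱ x⟩` of the operator `T` at the vector `x`. -/
def quad (T : Op n) (i : ℕ) (x : Vec n) : ℝ := RCLike.re (inner ℂ x ((T ^ i) x))

lemma inner_pow_apply {T : Op n} (hT : T.IsPositive) (i : ℕ) (x y : Vec n) :
    inner ℂ ((T ^ i) x) y = inner ℂ x ((T ^ i) y) := by
  induction i generalizing x y with
  | zero => simp
  | succ i ih =>
    have h : ∀ z, (T ^ (i + 1)) z = (T ^ i) (T z) := fun z => by rw [pow_succ]; rfl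
    have h' : ∀ z, (T ^ (i + 1)) z = T ((T ^ i) z) := fun z => by rw [pow_succ']; rfl
    rw [h, ih, h']
    exact hT.isSymmetric _ _

lemma pow_add_apply (T : Op n) (i j : ℕ) (x : Vec n) : (T ^ (i + j)) x = (T ^ i) ((T ^ j) x) := by
  rw [pow_add]; rfl

lemma norm_pow_apply_sq {T : Op n} (hT : T.IsPositive) (i : ℕ) (x : Vec n) :
    ‖(T ^ i) x‖ ^ 2 = quad T (2 * i) x := by
  rw [quad, two_mul, pow_add_apply, ← inner_pow_apply hT, ← norm_sq_eq_re_inner]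

lemma exists_spectral {T : Op n} (hT : T.IsPositive) :
    ∃ (b : OrthonormalBasis (Fin n) ℂ (Vec n)) (t : Fin n → ℝ), (∀ k, 0 ≤ t k) ∧
      (∀ i x, inner ℂ x ((T ^ i) x) = ((∑ k, t k ^ i * ‖inner ℂ (b k) x‖ ^ 2 : ℝ) : ℂ)) := by
  have hn : Module.finrank ℂ (Vec n) = n := finrank_euclideanSpace_fin
  have hs : (T : Vec n →ₗ[ℂ] Vec n).IsSymmetric := hT.isSymmetric
  refine ⟨hs.eigenvectorBasis hn, hs.eigenvalues hn, fun k => ?_, fun i x => ?_⟩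
  · have h := hT.re_inner_nonneg_right (hs.eigenvectorBasis hn k)
    have h2 : T (hs.eigenvectorBasis hn k) = (hs.eigenvalues hn k : ℂ) • hs.eigenvectorBasis hn k :=
      hs.apply_eigenvectorBasis hn k
    rw [h2, inner_smul_right] at h
    simpa using h
  · have hb : ∀ k, (T ^ i) (hs.eigenvectorBasis hn k) =
        ((hs.eigenvalues hn k : ℂ) ^ i) • hs.eigenvectorBasis hn k := by
      intro k
      induction i with
      | zero => simp
      | succ i ih =>
        rw [pow_succ', mul_apply_eq_comp, ih, map_smul]
        have h2 : T (hs.eigenvectorBasis hn k) =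
          (hs.eigenvalues hn k : ℂ) • hs.eigenvectorBasis hn k := hs.apply_eigenvectorBasis hn k
        rw [h2, smul_smul, pow_succ]
    rw [← (hs.eigenvectorBasis hn).sum_inner_mul_inner]
    simp only [Complex.ofReal_sum, Complex.ofReal_mul, Complex.ofReal_pow]
    refine Finset.sum_congr rfl fun k _ => ?_
    rw [← inner_pow_apply hT, hb, inner_smul_left, ← inner_conj_symm]
    simp only [map_pow, Complex.conj_ofReal]
    rw [mul_left_comm, Complex.conj_mul']

/-- By diagonalisation the forms are the moments of one positive measure on [0, ∞) with mass ‖x‖².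
Inequalities between them thus reduce to scalar inequalities. -/
lemma exists_quad_eq_sum {T : Op n} (hT : T.IsPositive) (x : Vec n) :
    ∃ (t w : Fin n → ℝ), (∀ k, 0 ≤ t k) ∧ (∀ k, 0 ≤ w k) ∧ (∑ k, w k = ‖x‖ ^ 2) ∧
      ∀ i, quad T i x = ∑ k, w k * t k ^ i := by
  obtain ⟨b, t, ht, h⟩ := exists_spectral hT
  refine ⟨t, fun k => ‖inner ℂ (b k) x‖ ^ 2, ht, fun k => by positivity, ?_, fun i => ?_⟩
  · exact b.sum_sq_norm_inner_right x
  · rw [quad, h]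
    simp only [RCLike.re_to_complex, Complex.ofReal_re]
    exact Finset.sum_congr rfl fun k _ => mul_comm _ _

lemma inner_pow_eq_quad {T : Op n} (hT : T.IsPositive) (i : ℕ) (x : Vec n) :
    inner ℂ x ((T ^ i) x) = (quad T i x : ℂ) := by
  obtain ⟨b, t, -, h⟩ := exists_spectral hT
  rw [quad, h]
  exact congrArg _ (Complex.ofReal_re _).symm

lemma quad_nonneg {T : Op n} (hT : T.IsPositive) (i : ℕ) (x : Vec n) : 0 ≤ quad T i x := by
  obtain ⟨t, w, ht, hw, -, h⟩ := exists_quad_eq_sum hT x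
  rw [h]
  exact Finset.sum_nonneg fun k _ => mul_nonneg (hw k) (pow_nonneg (ht k) i)

lemma quad_zero (T : Op n) (x : Vec n) : quad T 0 x = ‖x‖ ^ 2 := by
  rw [quad, norm_sq_eq_re_inner (𝕜 := ℂ)]
  simp

lemma pow_mul_pow_le_add {s t : ℝ} (hs : 0 ≤ s) (ht : 0 ≤ t) (i j : ℕ) :
    s ^ i * t ^ j ≤ s ^ (i + j) + t ^ (i + j) := by
  rcases le_total s t with h | h
  · calc s ^ i * t ^ j ≤ t ^ i * t ^ j := by gcongr
      _ = t ^ (i + j) := (pow_add _ _ _).symm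
      _ ≤ _ := le_add_of_nonneg_left (by positivity)
  · calc s ^ i * t ^ j ≤ s ^ i * s ^ j := by gcongr
      _ = s ^ (i + j) := (pow_add _ _ _).symm
      _ ≤ _ := le_add_of_nonneg_right (by positivity)

/-- Chebyshev's sum inequality: after symmetrising over two points s, t of the spectral measure it
says (sⁱ - tⁱ)(sʲ - tʲ) ≥ 0. -/
lemma quad_mul_quad_le {T : Op n} (hT : T.IsPositive) (i j : ℕ) (x : Vec n) :
    quad T i x * quad T j x ≤ ‖x‖ ^ 2 * quad T (i + j) x := by
  obtain ⟨t, w, ht, hw, h0, h⟩ := exists_quad_eq_sum hT x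
  have key : ∀ k l, t k ^ i * t l ^ j + t l ^ i * t k ^ j ≤ t k ^ (i + j) + t l ^ (i + j) := by
    intro k l
    rw [pow_add, pow_add]
    rcases le_total (t k) (t l) with hkl | hkl
    · have h1 := pow_le_pow_left₀ (ht k) hkl i
      have h2 := pow_le_pow_left₀ (ht k) hkl j
      nlinarith
    · have h1 := pow_le_pow_left₀ (ht l) hkl i
      have h2 := pow_le_pow_left₀ (ht l) hkl j
      nlinarith
  have e1 : quad T i x * quad T j x = ∑ k, ∑ l, w k * w l * (t k ^ i * t l ^ j) := by
    rw [h, h, Finset.sum_mul_sum]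
    exact Finset.sum_congr rfl fun k _ => Finset.sum_congr rfl fun l _ => by ring
  have e1' : quad T i x * quad T j x = ∑ k, ∑ l, w k * w l * (t l ^ i * t k ^ j) := by
    rw [e1, Finset.sum_comm]
    exact Finset.sum_congr rfl fun k _ => Finset.sum_congr rfl fun l _ => by ring
  have e2 : ‖x‖ ^ 2 * quad T (i + j) x = ∑ k, ∑ l, w k * w l * t l ^ (i + j) := by
    rw [h, ← h0, Finset.sum_mul_sum]
    exact Finset.sum_congr rfl fun k _ => Finset.sum_congr rfl fun l _ => by ring
  have e2' : ‖x‖ ^ 2 * quad T (i + j) x = ∑ k, ∑ l, w k * w l * t k ^ (i + j) := by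
    rw [e2, Finset.sum_comm]
    exact Finset.sum_congr rfl fun k _ => Finset.sum_congr rfl fun l _ => by ring
  have : quad T i x * quad T j x + quad T i x * quad T j x ≤
      ‖x‖ ^ 2 * quad T (i + j) x + ‖x‖ ^ 2 * quad T (i + j) x := by
    nth_rewrite 1 [e1]
    nth_rewrite 1 [e1']
    nth_rewrite 1 [e2']
    nth_rewrite 1 [e2]
    simp only [← Finset.sum_add_distrib, ← mul_add]
    refine Finset.sum_le_sum fun k _ => Finset.sum_le_sum fun l _ => ?_
    exact mul_le_mul_of_nonneg_left (key k l) (mul_nonneg (hw k) (hw l))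
  linarith

/-- Iterating the preceding inequality gives Jensen's inequality for the spectral measure. -/
lemma quad_pow_le {T : Op n} (hT : T.IsPositive) (i q : ℕ) (x : Vec n) :
    quad T i x ^ (q + 1) ≤ ‖x‖ ^ (2 * q) * quad T (i * (q + 1)) x := by
  induction q with
  | zero => simp
  | succ q ih =>
    calc quad T i x ^ (q + 1 + 1) = quad T i x ^ (q + 1) * quad T i x := pow_succ _ _
      _ ≤ ‖x‖ ^ (2 * q) * quad T (i * (q + 1)) x * quad T i x := by
        exact mul_le_mul_of_nonneg_right ih (quad_nonneg hT _ _)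
      _ = ‖x‖ ^ (2 * q) * (quad T (i * (q + 1)) x * quad T i x) := by ring
      _ ≤ ‖x‖ ^ (2 * q) * (‖x‖ ^ 2 * quad T (i * (q + 1) + i) x) := by
        exact mul_le_mul_of_nonneg_left (quad_mul_quad_le hT _ _ _) (by positivity)
      _ = _ := by
        rw [show i * (q + 1) + i = i * (q + 1 + 1) by ring]
        ring

lemma quad_le_of_scalar {T : Op n} (hT : T.IsPositive) (x : Vec n) {i j : ℕ} {α β γ : ℝ}
    (h : ∀ t : ℝ, 0 ≤ t → α * t ^ i ≤ β * t ^ j + γ) :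
    α * quad T i x ≤ β * quad T j x + γ * ‖x‖ ^ 2 := by
  obtain ⟨t, w, ht, hw, h0, hq⟩ := exists_quad_eq_sum hT x
  rw [hq, hq, ← h0, Finset.mul_sum, Finset.mul_sum, Finset.mul_sum, ← Finset.sum_add_distrib]
  refine Finset.sum_le_sum fun k _ => ?_
  nlinarith [mul_le_mul_of_nonneg_left (h (t k) (ht k)) (hw k)]

/-- The scalar bound t ≤ ε t² + ε⁻¹ is integrated against tⁱ. It later trades a moment of even order
for its two odd neighbours, with a small factor on the higher one. -/
lemma mul_quad_succ_le {T : Op n} (hT : T.IsPositive) (x : Vec n) (i : ℕ) {ε : ℝ} (hε : 0 < ε) :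
    quad T (i + 1) x ≤ ε * quad T (i + 2) x + ε⁻¹ * quad T i x := by
  obtain ⟨t, w, ht, hw, h0, hq⟩ := exists_quad_eq_sum hT x
  rw [hq, hq, hq, Finset.mul_sum, Finset.mul_sum, ← Finset.sum_add_distrib]
  refine Finset.sum_le_sum fun k _ => ?_
  have h1 : t k ≤ ε * t k ^ 2 + ε⁻¹ := by
    have : 0 ≤ ε⁻¹ * (ε * t k - 1) ^ 2 + t k := by
      have := ht k
      positivity
    have e : ε⁻¹ * (ε * t k - 1) ^ 2 = ε * t k ^ 2 - 2 * t k + ε⁻¹ := by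
      field_simp
      ring
    rw [e] at this
    linarith
  have h2 : 0 ≤ w k * t k ^ i := mul_nonneg (hw k) (pow_nonneg (ht k) i)
  calc w k * t k ^ (i + 1) = w k * t k ^ i * t k := by ring
    _ ≤ w k * t k ^ i * (ε * t k ^ 2 + ε⁻¹) := by gcongr
    _ = _ := by ring

lemma quad_mul_pow_le {T : Op n} (hT : T.IsPositive) (x : Vec n) (i j : ℕ) {r : ℝ} (hr : 0 ≤ r) :
    quad T i x * r ^ j ≤ quad T (i + j) x + ‖x‖ ^ 2 * r ^ (i + j) := by
  have := quad_le_of_scalar hT x (i := i) (j := i + j) (α := r ^ j) (β := 1) (γ := r ^ (i + j))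
    (fun t ht => by
      have := pow_mul_pow_le_add ht hr i j
      linarith)
  linarith

/-- If z is the largest of t, h and 1, then h² t²ⁱ ≤ z²ⁱ⁺² ≤ z²ᵃ; the strict inequality `i < a`
makes room for the factor h². -/
lemma quad_mul_sq_le {T : Op n} (hT : T.IsPositive) (x : Vec n) {i a : ℕ} (hia : i < a) {h : ℝ}
    (hh : 0 ≤ h) : quad T (2 * i) x * h ^ 2 ≤ quad T (2 * a) x + (h ^ (2 * a) + 1) * ‖x‖ ^ 2 := by
  have := quad_le_of_scalar hT x (i := 2 * i) (j := 2 * a) (α := h ^ 2) (β := 1)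
    (γ := h ^ (2 * a) + 1)
    (fun t ht => by
      have key : ∀ z : ℝ, t ≤ z → h ≤ z → 1 ≤ z → h ^ 2 * t ^ (2 * i) ≤ z ^ (2 * a) := by
        intro z h1 h2 h3
        calc h ^ 2 * t ^ (2 * i) ≤ z ^ 2 * z ^ (2 * i) := by gcongr
          _ = z ^ (2 + 2 * i) := by rw [pow_add]
          _ ≤ z ^ (2 * a) := pow_le_pow_right₀ h3 (by omega)
      have a1 : 0 ≤ t ^ (2 * a) := by positivity
      have a2 : 0 ≤ h ^ (2 * a) := by positivity
      rcases le_total t h with hth | hth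
      · rcases le_total 1 h with h1 | h1
        · have := key h hth le_rfl h1
          linarith
        · have := key 1 (hth.trans h1) h1 le_rfl
          rw [one_pow] at this
          linarith
      · rcases le_total 1 t with h1 | h1
        · have := key t le_rfl hth h1
          linarith
        · have := key 1 h1 (hth.trans h1) le_rfl
          rw [one_pow] at this
          linarith)
  linarith

/-! ### Powers under a rank-one perturbation -/

section Telescoping

lemma pow_sub_pow_eq_sum {R : Type*} [Ring R] (A B : R) (a : ℕ) :
    A ^ a - B ^ a = ∑ i ∈ Finset.range a, B ^ i * (A - B) * A ^ (a - 1 - i) := by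
  induction a with
  | zero => simp
  | succ a ih =>
    rw [Finset.sum_range_succ, pow_succ, pow_succ]
    have : A ^ a * A - B ^ a * B = (A ^ a - B ^ a) * A + B ^ a * (A - B) := by
      noncomm_ring
    rw [this, ih, Finset.sum_mul]
    congr 1
    · refine Finset.sum_congr rfl fun i hi => ?_
      rw [Finset.mem_range] at hi
      rw [mul_assoc, ← pow_succ]
      congr 2
      omega
    · simp

lemma pow_sub_pow_eq_sum' {R : Type*} [Ring R] (A B : R) (a : ℕ) :
    A ^ a - B ^ a = ∑ i ∈ Finset.range a, A ^ i * (A - B) * B ^ (a - 1 - i) := by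
  rw [← neg_sub, pow_sub_pow_eq_sum B A, ← Finset.sum_neg_distrib]
  refine Finset.sum_congr rfl fun i _ => ?_
  rw [← neg_mul, ← mul_neg, neg_sub]

lemma selfTensor_apply (f x : Vec n) : selfTensor f x = inner ℂ f x • f := by
  simp [selfTensor]

lemma isPositive_selfTensor (f : Vec n) : (selfTensor f).IsPositive :=
  InnerProductSpace.isPositive_rankOne_self f

/-- Of the two telescopings, this one (with y = f) brings out forms of `T` at `f`, which concentrate
when `T` is independent of `f`. The primed one leaves `f` paired with powers of `T` at `x`, so that
marginal moments of `f` can be applied. -/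
lemma pow_apply_rankOne_update (T : Op n) (f x y : Vec n) (a : ℕ) :
    inner ℂ y (((T + selfTensor f) ^ a) x) = inner ℂ y ((T ^ a) x) +
      ∑ i ∈ Finset.range a, inner ℂ y ((T ^ i) f) *
        inner ℂ f (((T + selfTensor f) ^ (a - 1 - i)) x) := by
  have h := pow_sub_pow_eq_sum (T + selfTensor f) T a
  rw [sub_eq_iff_eq_add'] at h
  rw [h, add_apply, inner_add_right, sum_apply, inner_sum]
  congr 1
  refine Finset.sum_congr rfl fun i _ => ?_
  rw [add_sub_cancel_left, mul_apply_eq_comp, mul_apply_eq_comp,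
    selfTensor_apply, map_smul, inner_smul_right, mul_comm]

lemma pow_apply_rankOne_update' (T : Op n) (f x y : Vec n) (a : ℕ) :
    inner ℂ y (((T + selfTensor f) ^ a) x) = inner ℂ y ((T ^ a) x) +
      ∑ i ∈ Finset.range a, inner ℂ y (((T + selfTensor f) ^ i) f) *
        inner ℂ f ((T ^ (a - 1 - i)) x) := by
  have h := pow_sub_pow_eq_sum' (T + selfTensor f) T a
  rw [sub_eq_iff_eq_add'] at h
  rw [h, add_apply, inner_add_right, sum_apply, inner_sum]
  congr 1
  refine Finset.sum_congr rfl fun i _ => ?_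
  rw [add_sub_cancel_left, mul_apply_eq_comp, mul_apply_eq_comp,
    selfTensor_apply, map_smul, inner_smul_right, mul_comm]

lemma quad_rankOne_update {T : Op n} (hT : T.IsPositive) (f : Vec n) (a : ℕ) :
    quad (T + selfTensor f) a f = quad T a f +
      ∑ i ∈ Finset.range a, quad T i f * quad (T + selfTensor f) (a - 1 - i) f := by
  have h := pow_apply_rankOne_update T f f f a
  have hM : (T + selfTensor f).IsPositive := hT.add (isPositive_selfTensor f)
  simp only [inner_pow_eq_quad hT, inner_pow_eq_quad hM] at h
  exact_mod_cast h

/-- Let Y be the bracket on the right. By induction and the moment inequalities the i-th product in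
the expansion is at most 2 · 3^{a-1-i} Y, and 1 + 2 (1 + 3 + ... + 3^{a-1}) = 3ᵃ. -/
lemma quad_rankOne_update_le {T : Op n} (hT : T.IsPositive) (f : Vec n) (a : ℕ) :
    quad (T + selfTensor f) a f ≤ 3 ^ a * (quad T a f + ‖f‖ ^ (2 * (a + 1))) := by
  have hM : (T + selfTensor f).IsPositive := hT.add (isPositive_selfTensor f)
  induction a using Nat.strong_induction_on with
  | _ a ih =>
    set Y := quad T a f + ‖f‖ ^ (2 * (a + 1)) with hY
    have hr : (0 : ℝ) ≤ ‖f‖ ^ 2 := by positivity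
    have hterm : ∀ i ∈ Finset.range a,
        quad T i f * quad (T + selfTensor f) (a - 1 - i) f ≤ 3 ^ (a - 1 - i) * (2 * Y) := by
      intro i hi
      rw [Finset.mem_range] at hi
      have h1 := ih (a - 1 - i) (by omega)
      have h2 : quad T i f * quad T (a - 1 - i) f ≤ Y := by
        refine (quad_mul_quad_le hT i (a - 1 - i) f).trans ?_
        have h3 := quad_mul_pow_le hT f (i + (a - 1 - i)) 1 hr
        rw [pow_one, show i + (a - 1 - i) + 1 = a by omega] at h3
        rw [mul_comm, hY]
        refine h3.trans (le_of_eq ?_)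
        ring
      have h4 : quad T i f * ‖f‖ ^ (2 * (a - 1 - i + 1)) ≤ Y := by
        have h3 := quad_mul_pow_le hT f i (a - 1 - i + 1) hr
        rw [show i + (a - 1 - i + 1) = a by omega, ← pow_mul] at h3
        refine h3.trans (le_of_eq ?_)
        rw [hY]
        ring
      calc quad T i f * quad (T + selfTensor f) (a - 1 - i) f
          ≤ quad T i f * (3 ^ (a - 1 - i) *
              (quad T (a - 1 - i) f + ‖f‖ ^ (2 * (a - 1 - i + 1)))) :=
            mul_le_mul_of_nonneg_left h1 (quad_nonneg hT i f)
        _ = 3 ^ (a - 1 - i) * (quad T i f * quad T (a - 1 - i) f +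
              quad T i f * ‖f‖ ^ (2 * (a - 1 - i + 1))) := by ring
        _ ≤ 3 ^ (a - 1 - i) * (2 * Y) := by
          gcongr
          linarith
    rw [quad_rankOne_update hT]
    have hYa : quad T a f ≤ Y := le_add_of_nonneg_right (by positivity)
    have hsum : ∑ i ∈ Finset.range a, (3 : ℝ) ^ (a - 1 - i) = (3 ^ a - 1) / 2 := by
      rw [Finset.sum_range_reflect (fun i => (3 : ℝ) ^ i), geom_sum_eq (by norm_num)]
      norm_num
    calc _ ≤ Y + ∑ i ∈ Finset.range a, 3 ^ (a - 1 - i) * (2 * Y) :=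
          add_le_add hYa (Finset.sum_le_sum hterm)
      _ = 3 ^ a * Y := by
        rw [← Finset.sum_mul, hsum]
        ring

end Telescoping

/-! ### Sums of rank-one operators and their traces -/

section Covariance

variable {ι : Type*}

/-- The sum of the rank-one operators `v j ⊗ v j` over `j ∈ S`. -/
def covOp (S : Finset ι) (v : ι → Vec n) : Op n := ∑ j ∈ S, selfTensor (v j)

lemma isPositive_covOp (S : Finset ι) (v : ι → Vec n) : (covOp S v).IsPositive := by
  classical
  unfold covOp
  induction S using Finset.induction_on with
  | empty => simp
  | insert j S hj ih =>
    rw [Finset.sum_insert hj]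
    exact (isPositive_selfTensor _).add ih

lemma covOp_eq_erase_add [DecidableEq ι] {S : Finset ι} {j : ι} (hj : j ∈ S) (v : ι → Vec n) :
    covOp S v = covOp (S.erase j) v + selfTensor (v j) :=
  (Finset.sum_erase_add S _ hj).symm

lemma covOp_insert [DecidableEq ι] {S : Finset ι} {j : ι} (hj : j ∉ S) (v : ι → Vec n) :
    covOp (insert j S) v = covOp S v + selfTensor (v j) := by
  rw [covOp, Finset.sum_insert hj, add_comm, covOp]

lemma norm_covOp_le (S : Finset ι) (v : ι → Vec n) : ‖covOp S v‖ ≤ ∑ j ∈ S, ‖v j‖ ^ 2 := by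
  refine (norm_sum_le _ _).trans (Finset.sum_le_sum fun j _ => ?_)
  rw [selfTensor, InnerProductSpace.norm_rankOne, sq]

lemma inner_covOp (S : Finset ι) (v : ι → Vec n) (x y : Vec n) :
    inner ℂ y (covOp S v x) = ∑ j ∈ S, inner ℂ (v j) x * inner ℂ y (v j) := by
  rw [covOp, sum_apply, inner_sum]
  refine Finset.sum_congr rfl fun j _ => ?_
  rw [selfTensor_apply, inner_smul_right]

lemma inner_covOp_pow_succ (S : Finset ι) (v : ι → Vec n) (x y : Vec n) (p : ℕ) :
    inner ℂ y ((covOp S v ^ (p + 1)) x) =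
      ∑ j ∈ S, inner ℂ (v j) ((covOp S v ^ p) x) * inner ℂ y (v j) := by
  rw [pow_succ', mul_apply_eq_comp, inner_covOp]

/-- The middle one of the 2a + 1 factors is expanded into its rank-one terms, and the a factors on
either side are moved onto `x`. -/
lemma quad_covOp_odd (S : Finset ι) (v : ι → Vec n) (x : Vec n) (a : ℕ) :
    quad (covOp S v) (2 * a + 1) x = ∑ j ∈ S, ‖inner ℂ (v j) ((covOp S v ^ a) x)‖ ^ 2 := by
  have h : inner ℂ x ((covOp S v ^ (2 * a + 1)) x) =
      ((∑ j ∈ S, ‖inner ℂ (v j) ((covOp S v ^ a) x)‖ ^ 2 : ℝ) : ℂ) := by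
    rw [show 2 * a + 1 = a + (a + 1) by ring, pow_add_apply,
      ← inner_pow_apply (isPositive_covOp S v), inner_covOp_pow_succ]
    simp only [Complex.ofReal_sum, Complex.ofReal_pow]
    refine Finset.sum_congr rfl fun j _ => ?_
    rw [← inner_conj_symm ((covOp S v ^ a) x), Complex.mul_conj']
  rw [quad, h]
  exact Complex.ofReal_re _

/-- The trace `Tr Tᵃ`. -/
def trPow (T : Op n) (a : ℕ) : ℝ :=
  RCLike.re (LinearMap.trace ℂ (Vec n) (T ^ a).toLinearMap)

lemma trace_eq_sum_basis (T : Op n) (b : OrthonormalBasis (Fin n) ℂ (Vec n)) :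
    LinearMap.trace ℂ (Vec n) T.toLinearMap = ∑ k, inner ℂ (b k) (T (b k)) :=
  LinearMap.trace_eq_sum_inner _ b

lemma exists_spectral_trPow {T : Op n} (hT : T.IsPositive) :
    ∃ (b : OrthonormalBasis (Fin n) ℂ (Vec n)) (t : Fin n → ℝ), (∀ k, 0 ≤ t k) ∧
      (∀ i x, quad T i x = ∑ k, t k ^ i * ‖inner ℂ (b k) x‖ ^ 2) ∧
      ∀ i, trPow T i = ∑ k, t k ^ i := by
  obtain ⟨b, t, ht, h⟩ := exists_spectral hT
  refine ⟨b, t, ht, fun i x => ?_, fun i => ?_⟩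
  · rw [quad, h]
    exact Complex.ofReal_re _
  · rw [trPow, trace_eq_sum_basis _ b, map_sum]
    refine Finset.sum_congr rfl fun k _ => ?_
    rw [h]
    simp only [RCLike.re_to_complex, Complex.ofReal_re]
    rw [Finset.sum_eq_single k]
    · simp
    · intro l _ hl
      simp [b.inner_eq_zero hl]
    · simp

lemma trPow_zero (T : Op n) : trPow T 0 = n := by
  rw [trPow, pow_zero]
  have : LinearMap.trace ℂ (Vec n) (1 : Op n).toLinearMap = n := by
    have := LinearMap.trace_one ℂ (Vec n)
    rw [finrank_euclideanSpace_fin] at this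
    exact this
  rw [this]
  simp

lemma trPow_covOp_succ (S : Finset ι) (v : ι → Vec n) (p : ℕ) :
    trPow (covOp S v) (p + 1) = ∑ j ∈ S, quad (covOp S v) p (v j) := by
  rw [trPow, trace_eq_sum_basis _ (EuclideanSpace.basisFun (Fin n) ℂ)]
  simp only [inner_covOp_pow_succ]
  rw [Finset.sum_comm, map_sum]
  refine Finset.sum_congr rfl fun j _ => ?_
  rw [quad, ← inner_pow_apply (isPositive_covOp S v)]
  congr 1
  rw [← (EuclideanSpace.basisFun (Fin n) ℂ).sum_inner_mul_inner]
  refine Finset.sum_congr rfl fun k _ => ?_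
  rw [← inner_pow_apply (isPositive_covOp S v)]

end Covariance

/-! ### Random variables with moments of all orders -/

section Moments

variable {Ω : Type*} [MeasurableSpace Ω] {P : Measure Ω} [IsProbabilityMeasure P]
variable {F : Type*} [NormedAddCommGroup F]

/-- `X` is measurable and has finite absolute moments of all orders. -/
def HasMoments (P : Measure Ω) (X : Ω → F) : Prop :=
  AEStronglyMeasurable X P ∧ ∀ q : ℕ, Integrable (fun ω => ‖X ω‖ ^ q) P

lemma HasMoments.integrable {X : Ω → F} (h : HasMoments P X) : Integrable X P := by
  have := h.2 1
  simp only [pow_one] at this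
  exact (integrable_norm_iff h.1).1 this

lemma HasMoments.mono {G : Type*} [NormedAddCommGroup G] {X : Ω → F} {Y : Ω → G}
    (hY : HasMoments P Y) (hX : AEStronglyMeasurable X P) (hXY : ∀ ω, ‖X ω‖ ≤ ‖Y ω‖) :
    HasMoments P X := by
  refine ⟨hX, fun q => (hY.2 q).mono' (hX.norm.pow q) (ae_of_all _ fun ω => ?_)⟩
  rw [norm_pow, norm_norm]
  exact pow_le_pow_left₀ (norm_nonneg _) (hXY ω) q

lemma hasMoments_const (c : F) : HasMoments P (fun _ => c) :=
  ⟨aestronglyMeasurable_const, fun _ => integrable_const _⟩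

lemma HasMoments.norm {X : Ω → F} (h : HasMoments P X) : HasMoments P (fun ω => ‖X ω‖) :=
  h.mono h.1.norm fun ω => by simp

lemma HasMoments.neg {X : Ω → F} (h : HasMoments P X) : HasMoments P (fun ω => -X ω) :=
  h.mono h.1.neg fun ω => by simp

lemma HasMoments.add {X Y : Ω → F} (hX : HasMoments P X) (hY : HasMoments P Y) :
    HasMoments P (fun ω => X ω + Y ω) := by
  refine ⟨hX.1.add hY.1, fun q => ?_⟩
  refine (((hX.2 q).add (hY.2 q)).const_mul (2 ^ (q - 1) : ℝ)).mono' ((hX.1.add hY.1).norm.pow q)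
    (ae_of_all _ fun ω => ?_)
  rw [norm_pow, norm_norm]
  exact (pow_le_pow_left₀ (norm_nonneg _) (norm_add_le _ _) q).trans
    (add_pow_le (norm_nonneg _) (norm_nonneg _) q)

lemma HasMoments.sub {X Y : Ω → F} (hX : HasMoments P X) (hY : HasMoments P Y) :
    HasMoments P (fun ω => X ω - Y ω) := by
  simpa only [sub_eq_add_neg] using hX.add hY.neg

lemma HasMoments.sum {ι : Type*} {s : Finset ι} {X : ι → Ω → F} (h : ∀ i ∈ s, HasMoments P (X i)) :
    HasMoments P (fun ω => ∑ i ∈ s, X i ω) := by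
  classical
  induction s using Finset.induction_on with
  | empty => simpa using hasMoments_const (0 : F)
  | insert i s hi ih =>
    simp only [Finset.sum_insert hi]
    exact (h i (Finset.mem_insert_self i s)).add
      (ih fun j hj => h j (Finset.mem_insert_of_mem hj))

lemma pow_mul_le_add {a b : ℝ} (q : ℕ) : (a * b) ^ q ≤ a ^ (2 * q) + b ^ (2 * q) := by
  rw [mul_pow, pow_mul', pow_mul']
  nlinarith [sq_nonneg (a ^ q - b ^ q), sq_nonneg (a ^ q), sq_nonneg (b ^ q)]

lemma HasMoments.mul {R : Type*} [NormedRing R] {X Y : Ω → R} (hX : HasMoments P X)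
    (hY : HasMoments P Y) : HasMoments P (fun ω => X ω * Y ω) := by
  refine ⟨hX.1.mul hY.1, fun q => ?_⟩
  refine ((hX.2 (2 * q)).add (hY.2 (2 * q))).mono' ((hX.1.mul hY.1).norm.pow q)
    (ae_of_all _ fun ω => ?_)
  rw [norm_pow, norm_norm]
  exact (pow_le_pow_left₀ (norm_nonneg _) (norm_mul_le _ _) q).trans (pow_mul_le_add q)

lemma HasMoments.pow {X : Ω → ℝ} (hX : HasMoments P X) (k : ℕ) :
    HasMoments P (fun ω => X ω ^ k) := by
  induction k with
  | zero => simpa using hasMoments_const (1 : ℝ)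
  | succ k ih => simpa only [pow_succ] using ih.mul hX

lemma integral_sub_const_sq {g : Ω → ℝ} (hg : Integrable g P) (h2 : Integrable (fun ω => g ω ^ 2) P)
    (c : ℝ) : ∫ ω, (g ω - c) ^ 2 ∂P = ∫ ω, g ω ^ 2 ∂P - 2 * c * ∫ ω, g ω ∂P + c ^ 2 := by
  have e : ∀ ω, (g ω - c) ^ 2 = g ω ^ 2 - 2 * c * g ω + c ^ 2 := fun ω => by ring
  have h1 : Integrable (fun ω => 2 * c * g ω) P := hg.const_mul _
  have h3 : Integrable (fun ω => g ω ^ 2 - 2 * c * g ω) P := h2.sub h1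
  simp only [e]
  rw [integral_add h3 (integrable_const _), integral_sub h2 h1, integral_const_mul]
  simp

lemma sq_integral_le {g : Ω → ℝ} (hg : HasMoments P g) : (∫ ω, g ω ∂P) ^ 2 ≤ ∫ ω, g ω ^ 2 ∂P := by
  set c := ∫ ω, g ω ∂P with hc
  have h0 : 0 ≤ ∫ ω, (g ω - c) ^ 2 ∂P := integral_nonneg fun ω => sq_nonneg _
  have h2 : Integrable (fun ω => g ω ^ 2) P := (hg.pow 2).integrable
  rw [integral_sub_const_sq hg.integrable h2, ← hc] at h0
  linarith

end Moments

/-! ### Conditioning on an independent variable -/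

section Decoupling

variable {Ω : Type*} [MeasurableSpace Ω] {P : Measure Ω} [IsProbabilityMeasure P]
variable {α β : Type*} [MeasurableSpace α] [MeasurableSpace β]
variable {G : Type*} [NormedAddCommGroup G] [NormedSpace ℝ G]
variable {X : Ω → α} {Y : Ω → β} {F : α → β → G}

lemma integrable_map_prod (hXY : IndepFun X Y P) (hX : Measurable X) (hY : Measurable Y)
    (hF : StronglyMeasurable (Function.uncurry F)) (hi : Integrable (fun ω => F (X ω) (Y ω)) P) :
    Integrable (Function.uncurry F) ((P.map X).prod (P.map Y)) := by
  rw [← (indepFun_iff_map_prod_eq_prod_map_map hX.aemeasurable hY.aemeasurable).1 hXY,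
    integrable_map_measure hF.aestronglyMeasurable (hX.prodMk hY).aemeasurable]
  exact hi

lemma integrable_integral_right (hXY : IndepFun X Y P) (hX : Measurable X) (hY : Measurable Y)
    (hF : StronglyMeasurable (Function.uncurry F)) (hi : Integrable (fun ω => F (X ω) (Y ω)) P) :
    Integrable (fun ω => ∫ ω', F (X ω) (Y ω') ∂P) P := by
  have hp : IsProbabilityMeasure (P.map X) := Measure.isProbabilityMeasure_map hX.aemeasurable
  have hq : IsProbabilityMeasure (P.map Y) := Measure.isProbabilityMeasure_map hY.aemeasurable
  have h := (integrable_map_prod hXY hX hY hF hi).integral_prod_left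
  rw [integrable_map_measure h.aestronglyMeasurable hX.aemeasurable] at h
  refine h.congr (ae_of_all _ fun ω => ?_)
  simp only [Function.comp]
  exact integral_map hY.aemeasurable
    (hF.comp_measurable measurable_prodMk_left).aestronglyMeasurable

lemma integral_eq_integral_integral (hXY : IndepFun X Y P) (hX : Measurable X) (hY : Measurable Y)
    (hF : StronglyMeasurable (Function.uncurry F)) (hi : Integrable (fun ω => F (X ω) (Y ω)) P) :
    ∫ ω, F (X ω) (Y ω) ∂P = ∫ ω, ∫ ω', F (X ω) (Y ω') ∂P ∂P := by
  have hp : IsProbabilityMeasure (P.map X) := Measure.isProbabilityMeasure_map hX.aemeasurable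
  have hq : IsProbabilityMeasure (P.map Y) := Measure.isProbabilityMeasure_map hY.aemeasurable
  have h := integrable_map_prod hXY hX hY hF hi
  calc ∫ ω, F (X ω) (Y ω) ∂P
      = ∫ z, Function.uncurry F z ∂(P.map (fun ω => (X ω, Y ω))) := by
        rw [integral_map (hX.prodMk hY).aemeasurable hF.aestronglyMeasurable]
        rfl
    _ = ∫ x, ∫ y, F x y ∂(P.map Y) ∂(P.map X) := by
        rw [(indepFun_iff_map_prod_eq_prod_map_map hX.aemeasurable hY.aemeasurable).1 hXY,
          integral_prod _ h]
        rfl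
    _ = ∫ ω, ∫ y, F (X ω) y ∂(P.map Y) ∂P := by
        rw [integral_map hX.aemeasurable]
        exact h.integral_prod_left.aestronglyMeasurable
    _ = _ := by
        refine integral_congr_ae (ae_of_all _ fun ω => ?_)
        exact integral_map hY.aemeasurable
          (hF.comp_measurable measurable_prodMk_left).aestronglyMeasurable

lemma integral_le_of_forall_integral_le {F : α → β → ℝ} (hXY : IndepFun X Y P) (hX : Measurable X)
    (hY : Measurable Y) (hF : Measurable (Function.uncurry F))
    (hi : Integrable (fun ω => F (X ω) (Y ω)) P) {H : α → ℝ}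
    (hH : Integrable (fun ω => H (X ω)) P) (hle : ∀ x, ∫ ω, F x (Y ω) ∂P ≤ H x) :
    ∫ ω, F (X ω) (Y ω) ∂P ≤ ∫ ω, H (X ω) ∂P := by
  rw [integral_eq_integral_integral hXY hX hY hF.stronglyMeasurable hi]
  exact integral_mono (integrable_integral_right hXY hX hY hF.stronglyMeasurable hi) hH
    fun ω => hle (X ω)

/-- The variance is the mean of the conditional variance given X plus the variance of the
conditional mean. The mean of b(Y) does not depend on X, so by Jensen the second part is at most E
(Ψ - b(Y))². -/
lemma variance_le_of_indep {Ψ : α → β → ℝ} {b : β → ℝ} (hXY : IndepFun X Y P) (hX : Measurable X)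
    (hY : Measurable Y) (hΨ : Measurable (Function.uncurry Ψ)) (hb : Measurable b)
    (hi : HasMoments P (fun ω => Ψ (X ω) (Y ω))) (hi' : ∀ x, HasMoments P (fun ω => Ψ x (Y ω)))
    (hbi : HasMoments P (fun ω => b (Y ω))) :
    ∫ ω, Ψ (X ω) (Y ω) ^ 2 ∂P - (∫ ω, Ψ (X ω) (Y ω) ∂P) ^ 2 ≤
      ∫ ω, (∫ ω', Ψ (X ω) (Y ω') ^ 2 ∂P - (∫ ω', Ψ (X ω) (Y ω') ∂P) ^ 2) ∂P +
      ∫ ω, (Ψ (X ω) (Y ω) - b (Y ω)) ^ 2 ∂P := by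
  have mQ : Measurable (Function.uncurry fun x y => Ψ x y ^ 2) := hΨ.pow_const 2
  have mR : Measurable (Function.uncurry fun x y => (Ψ x y - b y) ^ 2) :=
    (hΨ.sub (hb.comp measurable_snd)).pow_const 2
  have iQ : Integrable (fun ω => Ψ (X ω) (Y ω) ^ 2) P := (hi.pow 2).integrable
  have iR : Integrable (fun ω => (Ψ (X ω) (Y ω) - b (Y ω)) ^ 2) P := ((hi.sub hbi).pow 2).integrable
  have iA' := integrable_integral_right hXY hX hY hΨ.stronglyMeasurable hi.integrable
  have iQ' := integrable_integral_right hXY hX hY mQ.stronglyMeasurable iQ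
  have iR' := integrable_integral_right hXY hX hY mR.stronglyMeasurable iR
  rw [integral_eq_integral_integral hXY hX hY mQ.stronglyMeasurable iQ,
    integral_eq_integral_integral hXY hX hY mR.stronglyMeasurable iR,
    integral_eq_integral_integral hXY hX hY hΨ.stronglyMeasurable hi.integrable]
  set A : Ω → ℝ := fun ω => ∫ ω', Ψ (X ω) (Y ω') ∂P with hA
  have iA2 : Integrable (fun ω => A ω ^ 2) P := by
    refine iQ'.mono' (iA'.aestronglyMeasurable.pow 2) (ae_of_all _ fun ω => ?_)
    rw [Real.norm_of_nonneg (sq_nonneg _)]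
    exact sq_integral_le (hi' (X ω))
  set c := ∫ ω, b (Y ω) ∂P with hc
  have h1 : ∫ ω, (∫ ω', Ψ (X ω) (Y ω') ^ 2 ∂P - A ω ^ 2) ∂P =
      ∫ ω, ∫ ω', Ψ (X ω) (Y ω') ^ 2 ∂P ∂P - ∫ ω, A ω ^ 2 ∂P := integral_sub iQ' iA2
  have h2 : ∫ ω, (A ω - c) ^ 2 ∂P = ∫ ω, A ω ^ 2 ∂P - 2 * c * ∫ ω, A ω ∂P + c ^ 2 :=
    integral_sub_const_sq iA' iA2 c
  have h3 : ∫ ω, (A ω - c) ^ 2 ∂P ≤ ∫ ω, ∫ ω', (Ψ (X ω) (Y ω') - b (Y ω')) ^ 2 ∂P ∂P := by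
    refine integral_mono_of_nonneg (ae_of_all _ fun ω => sq_nonneg _) iR'
      (ae_of_all _ fun ω => ?_)
    have : A ω - c = ∫ ω', (Ψ (X ω) (Y ω') - b (Y ω')) ∂P :=
      (integral_sub (hi' (X ω)).integrable hbi.integrable).symm
    simp only [this]
    exact sq_integral_le ((hi' (X ω)).sub hbi)
  have h4 := sq_nonneg (∫ ω, A ω ∂P - c)
  have h5 : ∫ ω, (∫ ω', Ψ (X ω) (Y ω') ^ 2 ∂P - (∫ ω', Ψ (X ω) (Y ω') ∂P) ^ 2) ∂P =
    ∫ ω, (∫ ω', Ψ (X ω) (Y ω') ^ 2 ∂P - A ω ^ 2) ∂P := rfl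
  rw [h5, h1]
  nlinarith

end Decoupling

/-! ### Samples of independent vectors and the Efron-Stein inequality -/

/-- Independent random vectors `f j`, `j < N`, in `ℂⁿ` with `N ≤ κ n`, with marginal fourth moments
at most `L / n²` and with the moments of their norms bounded by `Lk`. -/
structure IsSample (L κ : ℝ) (Lk : ℕ → ℝ) {Ω : Type*} [MeasurableSpace Ω] (P : Measure Ω) {n N : ℕ}
    (f : Fin N → Ω → Vec n) : Prop where
  measurable : ∀ j, Measurable (f j)
  indep : iIndepFun f P
  nonneg : 0 ≤ L
  four : ∀ j x, ∫ ω, ‖inner ℂ (f j ω) x‖ ^ 4 ∂P ≤ L / (n : ℝ) ^ 2 * ‖x‖ ^ 4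
  integrable : ∀ j k, Integrable (fun ω => ‖f j ω‖ ^ k) P
  moment_nonneg : ∀ k, 0 ≤ Lk k
  moment : ∀ j k, ∫ ω, ‖f j ω‖ ^ k ∂P ≤ Lk k
  pos : 0 < n
  card_le : (N : ℝ) ≤ κ * n

/-- The sum of the rank-one operators `f j ⊗ f j` over `j ∈ S`. -/
abbrev randCov {Ω : Type*} {n N : ℕ} (f : Fin N → Ω → Vec n) (S : Finset (Fin N)) (ω : Ω) : Op n :=
  covOp S (fun j => f j ω)

section Sample

lemma continuous_selfTensor {n : ℕ} : Continuous (selfTensor (n := n)) := by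
  have h : selfTensor (n := n) =
      fun x => ContinuousLinearMap.smulRightL ℂ (Vec n) (Vec n) (innerSL ℂ x) x := rfl
  rw [h]
  have h1 : Continuous fun x : Vec n => innerSL ℂ x := (innerSL ℂ).continuous
  exact ((ContinuousLinearMap.smulRightL ℂ (Vec n) (Vec n)).continuous.comp h1).clm_apply
    continuous_id

lemma continuous_covOp {n : ℕ} {ι : Type*} (S : Finset ι) : Continuous (covOp (n := n) S) := by
  unfold covOp
  exact continuous_finsetSum _ fun j _ => continuous_selfTensor.comp (continuous_apply j)

variable {L κ : ℝ} {Lk : ℕ → ℝ} {Ω : Type*} [MeasurableSpace Ω] {P : Measure Ω}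
  [IsProbabilityMeasure P] {n N : ℕ} {f : Fin N → Ω → Vec n}

lemma IsSample.measurable_randCov (h : IsSample L κ Lk P f) (S : Finset (Fin N)) :
    Measurable (randCov f S) :=
  (continuous_covOp S).measurable.comp (measurable_pi_lambda _ h.measurable)

lemma IsSample.indepFun (h : IsSample L κ Lk P f) {S : Finset (Fin N)} {j : Fin N} (hj : j ∉ S)
    {γ : Type*} [MeasurableSpace γ] {g : (S → Vec n) → γ} (hg : Measurable g) :
    IndepFun (f j) (fun ω => g (fun i : S => f i ω)) P := by
  have h1 := h.indep.indepFun_finset {j} S (by simpa using hj) h.measurable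
  exact h1.comp (φ := fun v : ({j} : Finset (Fin N)) → Vec n => v ⟨j, Finset.mem_singleton_self j⟩) (ψ := g)
    (measurable_pi_apply _) hg

lemma randCov_eq_covOp_subtype {S S' : Finset (Fin N)} (hS : S' ⊆ S) (ω : Ω) :
    randCov f S' ω = covOp (S'.subtype (· ∈ S)) (fun i : S => f i ω) := by
  unfold randCov covOp
  exact (Finset.sum_subtype_of_mem (fun i => selfTensor (f i ω)) hS).symm

lemma IsSample.indepFun_randCov (h : IsSample L κ Lk P f) {S : Finset (Fin N)} {j : Fin N}
    (hj : j ∉ S) : IndepFun (f j) (randCov f S) P := by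
  have := h.indepFun hj (continuous_covOp (n := n) (S.subtype (· ∈ S))).measurable
  have e : randCov f S = fun ω => covOp (S.subtype (· ∈ S)) (fun i : S => f i ω) :=
    funext fun ω => randCov_eq_covOp_subtype (Finset.Subset.refl S) ω
  rwa [e]

lemma IsSample.indepFun_randCov_pair (h : IsSample L κ Lk P f) {S S' : Finset (Fin N)}
    (hS : S' ⊆ S) {j : Fin N} (hj : j ∉ S) :
    IndepFun (f j) (fun ω => (randCov f S ω, randCov f S' ω)) P := by
  have := h.indepFun hj ((continuous_covOp (n := n) (S.subtype (· ∈ S))).measurable.prodMk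
    (continuous_covOp (n := n) (S'.subtype (· ∈ S))).measurable)
  simpa only [← randCov_eq_covOp_subtype (Finset.Subset.refl S), ← randCov_eq_covOp_subtype hS]
    using this

lemma IsSample.hasMoments (h : IsSample L κ Lk P f) (j : Fin N) : HasMoments P (f j) :=
  ⟨(h.measurable j).aestronglyMeasurable, h.integrable j⟩

lemma IsSample.hasMoments_randCov (h : IsSample L κ Lk P f) (S : Finset (Fin N)) :
    HasMoments P (randCov f S) := by
  have h1 : HasMoments P (fun ω => ∑ j ∈ S, ‖f j ω‖ ^ 2) :=
    HasMoments.sum fun j _ => (h.hasMoments j).norm.pow 2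
  refine h1.mono (h.measurable_randCov S).aestronglyMeasurable fun ω => ?_
  refine (norm_covOp_le S _).trans ?_
  exact le_abs_self _

lemma IsSample.hasMoments_comp_randCov (h : IsSample L κ Lk P f) (S : Finset (Fin N))
    {φ : Op n → ℝ} (hφ : Measurable φ) {C : ℝ} {k : ℕ} (hb : ∀ T, |φ T| ≤ C * (1 + ‖T‖) ^ k) :
    HasMoments P (fun ω => φ (randCov f S ω)) := by
  have h1 : HasMoments P (fun ω => C * (1 + ‖randCov f S ω‖) ^ k) :=
    (hasMoments_const C).mul (((hasMoments_const (1 : ℝ)).add (h.hasMoments_randCov S).norm).pow k)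
  exact h1.mono (hφ.comp (h.measurable_randCov S)).aestronglyMeasurable fun ω =>
    (hb _).trans (le_abs_self _)

/-- The Efron-Stein inequality for functions of `∑ j ∈ S, f j ⊗ f j`. -/
lemma IsSample.efron_stein (h : IsSample L κ Lk P f) (S : Finset (Fin N)) {φ : Op n → ℝ}
    (hφ : Continuous φ) {C : ℝ} {k : ℕ} (hb : ∀ T, |φ T| ≤ C * (1 + ‖T‖) ^ k) :
    ∫ ω, φ (randCov f S ω) ^ 2 ∂P - (∫ ω, φ (randCov f S ω) ∂P) ^ 2 ≤
      ∑ j ∈ S, ∫ ω, (φ (randCov f S ω) - φ (randCov f (S.erase j) ω)) ^ 2 ∂P := by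
  -- Given the value v of `f j`, the inductive hypothesis is applied to T ↦ φ(T + v ⊗ v). This
  -- function has polynomial growth of the same degree but with another constant, so `φ` and `C`
  -- must vary.
  induction S using Finset.induction_on generalizing φ C with
  | empty => simp [randCov, covOp]
  | insert j S hj ih =>
    have hC : 0 ≤ C := by
      have := (abs_nonneg _).trans (hb 0)
      simpa using this
    have hb' : ∀ v : Vec n, ∀ T : Op n,
        |φ (T + selfTensor v)| ≤ C * (1 + ‖v‖ ^ 2) ^ k * (1 + ‖T‖) ^ k := by
      intro v T
      refine (hb _).trans ?_
      rw [mul_assoc, ← mul_pow]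
      gcongr
      have h1 : ‖T + selfTensor v‖ ≤ ‖T‖ + ‖v‖ ^ 2 := by
        refine (norm_add_le _ _).trans ?_
        rw [selfTensor, InnerProductSpace.norm_rankOne, sq]
      nlinarith [norm_nonneg T, sq_nonneg ‖v‖, mul_nonneg (norm_nonneg T) (sq_nonneg ‖v‖)]
    have hins : ∀ S' : Finset (Fin N), j ∉ S' → ∀ ω, randCov f (insert j S') ω =
        randCov f S' ω + selfTensor (f j ω) := fun S' hS' ω => covOp_insert hS' _
    have cΨ : Continuous (Function.uncurry fun (v : Vec n) (T : Op n) => φ (T + selfTensor v)) :=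
      hφ.comp (continuous_snd.add (continuous_selfTensor.comp continuous_fst))
    have hcv : ∀ v, Continuous fun T : Op n => φ (T + selfTensor v) := fun v =>
      hφ.comp (continuous_id.add continuous_const)
    have hm : ∀ S', HasMoments P (fun ω => φ (randCov f S' ω)) := fun S' =>
      h.hasMoments_comp_randCov S' hφ.measurable hb
    -- Taking φ at the sum without `f j` as the comparison function produces exactly the summand of
    -- the new index.
    have key := variance_le_of_indep (P := P) (X := f j) (Y := randCov f S)
      (Ψ := fun v T => φ (T + selfTensor v)) (b := φ) (h.indepFun_randCov hj) (h.measurable j)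
      (h.measurable_randCov S) cΨ.measurable hφ.measurable
      (by simpa only [← hins S hj] using hm (insert j S))
      (fun v => h.hasMoments_comp_randCov S (hcv v).measurable (hb' v)) (hm S)
    simp only [← hins S hj] at key
    rw [Finset.sum_insert hj, Finset.erase_insert hj, add_comm]
    refine key.trans (add_le_add_left ?_ _)
    have hterm : ∀ i ∈ S, Integrable (fun ω => ∫ ω', (φ (randCov f S ω' + selfTensor (f j ω)) -
          φ (randCov f (S.erase i) ω' + selfTensor (f j ω))) ^ 2 ∂P) P ∧
        ∫ ω, ∫ ω', (φ (randCov f S ω' + selfTensor (f j ω)) -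
          φ (randCov f (S.erase i) ω' + selfTensor (f j ω))) ^ 2 ∂P ∂P =
        ∫ ω, (φ (randCov f (insert j S) ω) - φ (randCov f ((insert j S).erase i) ω)) ^ 2 ∂P := by
      intro i hi
      have hij : i ≠ j := fun hh => hj (hh ▸ hi)
      have hind := h.indepFun_randCov_pair (Finset.erase_subset i S) hj
      have cF : Continuous (Function.uncurry fun (v : Vec n) (T : Op n × Op n) =>
          (φ (T.1 + selfTensor v) - φ (T.2 + selfTensor v)) ^ 2) := by
        have := continuous_selfTensor (n := n)
        simp only [Function.uncurry_def]
        fun_prop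
      have hi1 : Integrable (fun ω => (φ (randCov f S ω + selfTensor (f j ω)) -
          φ (randCov f (S.erase i) ω + selfTensor (f j ω))) ^ 2) P := by
        simp only [← hins S hj, ← hins _ (fun hh => hj (Finset.mem_of_mem_erase hh))]
        exact (((hm _).sub (hm _)).pow 2).integrable
      have mp : Measurable fun ω => (randCov f S ω, randCov f (S.erase i) ω) :=
        (h.measurable_randCov S).prodMk (h.measurable_randCov (S.erase i))
      have i1 := integrable_integral_right hind (h.measurable j) mp
        cF.measurable.stronglyMeasurable hi1
      have i2 := integral_eq_integral_integral hind (h.measurable j) mp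
        cF.measurable.stronglyMeasurable hi1
      refine ⟨i1, i2.symm.trans ?_⟩
      rw [Finset.erase_insert_of_ne hij.symm]
      simp only [← hins S hj, ← hins _ (fun hh => hj (Finset.mem_of_mem_erase hh))]
    calc _ ≤ ∫ ω, ∑ i ∈ S, ∫ ω', (φ (randCov f S ω' + selfTensor (f j ω)) -
          φ (randCov f (S.erase i) ω' + selfTensor (f j ω))) ^ 2 ∂P ∂P := by
          refine integral_mono_of_nonneg (ae_of_all _ fun ω => ?_)
            (integrable_finsetSum _ fun i hi => (hterm i hi).1) (ae_of_all _ fun ω => ?_)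
          · exact sub_nonneg.2 (sq_integral_le
              (h.hasMoments_comp_randCov S (hcv (f j ω)).measurable (hb' (f j ω))))
          · exact ih (hcv (f j ω)) (hb' (f j ω))
      _ = _ := by
          rw [integral_finsetSum _ fun i hi => (hterm i hi).1]
          exact Finset.sum_congr rfl fun i hi => (hterm i hi).2

end Sample

/-! ### Bounds for traces and for forms at the sample vectors -/

section Bounds

lemma norm_pow_apply_le {n : ℕ} (T : Op n) (p : ℕ) (x : Vec n) : ‖(T ^ p) x‖ ≤ ‖T‖ ^ p * ‖x‖ := by
  induction p with
  | zero => simp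
  | succ p ih =>
    rw [pow_succ', mul_apply_eq_comp, pow_succ', mul_assoc]
    exact (T.le_opNorm _).trans (mul_le_mul_of_nonneg_left ih (norm_nonneg _))

lemma continuous_pow_apply {n : ℕ} (p : ℕ) :
    Continuous (fun z : Op n × Vec n => (z.1 ^ p) z.2) :=
  (continuous_fst.pow p).clm_apply continuous_snd

lemma continuous_quad {X : Type*} [TopologicalSpace X] {n : ℕ} {T : X → Op n} {u : X → Vec n}
    (hT : Continuous T) (hu : Continuous u) (p : ℕ) : Continuous (fun z => quad (T z) p (u z)) := by
  have h1 : Continuous fun z => (T z ^ p) (u z) := (hT.pow p).clm_apply hu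
  exact RCLike.continuous_re.comp (hu.inner h1)

/-- The vector `x / ‖x‖`. -/
def normalize {n : ℕ} (x : Vec n) : Vec n := ((‖x‖ : ℂ)⁻¹) • x

lemma norm_normalize_le {n : ℕ} (x : Vec n) : ‖normalize x‖ ≤ 1 := by
  rw [normalize, norm_smul, norm_inv, Complex.norm_real, norm_norm]
  exact inv_mul_le_one

lemma measurable_normalize {n : ℕ} : Measurable (normalize (n := n)) := by
  unfold normalize
  have h : Measurable fun x : Vec n => ((‖x‖ : ℂ)⁻¹) :=
    (Complex.measurable_ofReal.comp measurable_norm).inv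
  exact h.smul measurable_id

lemma norm_inner_sq_eq {n : ℕ} (x y : Vec n) :
    ‖inner ℂ y x‖ ^ 2 = ‖inner ℂ y (normalize x)‖ ^ 2 * ‖x‖ ^ 2 := by
  by_cases hx : x = 0
  · simp [hx]
  · have hx' : ‖x‖ ≠ 0 := norm_ne_zero_iff.2 hx
    rw [normalize, inner_smul_right, norm_mul, norm_inv, Complex.norm_real, norm_norm]
    field_simp

variable {L κ : ℝ} {Lk : ℕ → ℝ} {Ω : Type*} [MeasurableSpace Ω] {P : Measure Ω}
  [IsProbabilityMeasure P] {n N : ℕ} {f : Fin N → Ω → Vec n}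

lemma HasMoments.inner {X Y : Ω → Vec n} (hX : HasMoments P X) (hY : HasMoments P Y) :
    HasMoments P (fun ω => inner ℂ (X ω) (Y ω)) := by
  refine (hX.norm.mul hY.norm).mono (hX.1.inner hY.1) fun ω => ?_
  exact (norm_inner_le_norm _ _).trans (le_abs_self _)

lemma IsSample.hasMoments_pow_apply (h : IsSample L κ Lk P f) (S : Finset (Fin N)) (p : ℕ)
    {X : Ω → Vec n} (hX : HasMoments P X) : HasMoments P (fun ω => (randCov f S ω ^ p) (X ω)) := by
  have h1 : HasMoments P (fun ω => ‖randCov f S ω‖ ^ p * ‖X ω‖) :=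
    ((h.hasMoments_randCov S).norm.pow p).mul hX.norm
  refine h1.mono ?_ fun ω => (norm_pow_apply_le _ _ _).trans (le_abs_self _)
  exact (continuous_pow_apply p).comp_aestronglyMeasurable
    ((h.hasMoments_randCov S).1.prodMk hX.1)

lemma IsSample.hasMoments_quad (h : IsSample L κ Lk P f) (S : Finset (Fin N)) (p : ℕ)
    {X : Ω → Vec n} (hX : HasMoments P X) : HasMoments P (fun ω => quad (randCov f S ω) p (X ω)) := by
  have h1 := hX.inner (h.hasMoments_pow_apply S p hX)
  refine h1.mono ?_ fun ω => ?_
  · exact RCLike.continuous_re.comp_aestronglyMeasurable h1.1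
  · exact RCLike.norm_re_le_norm _

lemma trPow_eq_sum_quad (T : Op n) (a : ℕ) :
    trPow T a = ∑ k, quad T a (EuclideanSpace.basisFun (Fin n) ℂ k) := by
  rw [trPow, trace_eq_sum_basis _ (EuclideanSpace.basisFun (Fin n) ℂ), map_sum]
  rfl

lemma IsSample.hasMoments_trPow (h : IsSample L κ Lk P f) (S : Finset (Fin N)) (p : ℕ) :
    HasMoments P (fun ω => trPow (randCov f S ω) p) := by
  simp only [trPow_eq_sum_quad]
  exact HasMoments.sum fun k _ => h.hasMoments_quad S p (hasMoments_const _)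

lemma IsSample.kappa_nonneg (h : IsSample L κ Lk P f) : 0 ≤ κ := by
  have h1 : (0 : ℝ) < n := by exact_mod_cast h.pos
  have h2 : (0 : ℝ) ≤ κ * n := (Nat.cast_nonneg N).trans h.card_le
  exact nonneg_of_mul_nonneg_left h2 h1

lemma IsSample.sum_le (h : IsSample L κ Lk P f) (S : Finset (Fin N)) {g : Fin N → ℝ} {b : ℝ}
    (hb : 0 ≤ b) (hg : ∀ j ∈ S, g j ≤ b / n) : ∑ j ∈ S, g j ≤ κ * b := by
  have hn : (0 : ℝ) < n := by exact_mod_cast h.pos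
  have hS : (S.card : ℝ) ≤ κ * n := by
    refine le_trans ?_ h.card_le
    exact_mod_cast (Finset.card_le_univ S).trans (by simp)
  calc ∑ j ∈ S, g j ≤ S.card • (b / n) := Finset.sum_le_card_nsmul _ _ _ hg
    _ = S.card * (b / n) := nsmul_eq_mul _ _
    _ ≤ κ * n * (b / n) := by gcongr
    _ = κ * b := by field_simp

/-- A bound for `n E[|⟨f, x⟩|² ‖f‖ʳ]` with `‖x‖ ≤ 1`. -/
def secondBound (L : ℝ) (Lk : ℕ → ℝ) (r : ℕ) : ℝ := (L + Lk (2 * r)) / 2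

lemma IsSample.secondBound_nonneg (h : IsSample L κ Lk P f) (r : ℕ) : 0 ≤ secondBound L Lk r :=
  div_nonneg (add_nonneg h.nonneg (h.moment_nonneg _)) (by norm_num)

/-- Young's inequality with weight n: for unit `x` both n |⟨f, x⟩|⁴ and n⁻¹ ‖f‖²ʳ have mean O(1/n).
-/
lemma IsSample.integral_inner_sq_mul_le (h : IsSample L κ Lk P f) (j : Fin N) (r : ℕ)
    (x : Vec n) : ∫ ω, ‖inner ℂ (f j ω) x‖ ^ 2 * ‖f j ω‖ ^ r ∂P ≤
      secondBound L Lk r / n * ‖x‖ ^ 2 := by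
  have hn : (0 : ℝ) < n := by exact_mod_cast h.pos
  by_cases hx : x = 0
  · simp [hx]
  have hx' : 0 < ‖x‖ := norm_pos_iff.2 hx
  have hi := ((h.hasMoments j).inner (hasMoments_const x)).norm
  have i1 := ((hi.pow 4).integrable).const_mul (n / (2 * ‖x‖ ^ 2))
  have i2 := (((h.hasMoments j).norm.pow (2 * r)).integrable).const_mul (‖x‖ ^ 2 / (2 * n))
  calc ∫ ω, ‖inner ℂ (f j ω) x‖ ^ 2 * ‖f j ω‖ ^ r ∂P
      ≤ ∫ ω, (n / (2 * ‖x‖ ^ 2) * ‖inner ℂ (f j ω) x‖ ^ 4 +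
          ‖x‖ ^ 2 / (2 * n) * ‖f j ω‖ ^ (2 * r)) ∂P := by
        refine integral_mono ((hi.pow 2).mul ((h.hasMoments j).norm.pow r)).integrable
          (i1.add i2) fun ω => ?_
        simp only
        set A := ‖inner ℂ (f j ω) x‖ ^ 2
        set B := ‖f j ω‖ ^ r
        have e1 : ‖inner ℂ (f j ω) x‖ ^ 4 = A ^ 2 := by ring
        have e2 : ‖f j ω‖ ^ (2 * r) = B ^ 2 := by rw [mul_comm, pow_mul]
        rw [e1, e2]
        have : 0 ≤ (n * A - ‖x‖ ^ 2 * B) ^ 2 / (2 * ‖x‖ ^ 2 * n) := by positivity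
        have e3 : (n * A - ‖x‖ ^ 2 * B) ^ 2 / (2 * ‖x‖ ^ 2 * n) =
            n / (2 * ‖x‖ ^ 2) * A ^ 2 + ‖x‖ ^ 2 / (2 * n) * B ^ 2 - A * B := by
          field_simp
          ring
        linarith
    _ ≤ n / (2 * ‖x‖ ^ 2) * (L / n ^ 2 * ‖x‖ ^ 4) + ‖x‖ ^ 2 / (2 * n) * Lk (2 * r) := by
        rw [integral_add i1 i2, integral_const_mul, integral_const_mul]
        gcongr
        · exact h.four j x
        · exact h.moment j _
    _ = _ := by
        rw [secondBound]
        field_simp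

/-- In an eigenbasis of `T` the form splits into squared marginals of `f j`, each of mean O(1/n),
and the weights add up to the trace. -/
lemma IsSample.integral_quad_mul_le (h : IsSample L κ Lk P f) (j : Fin N) (r a : ℕ) {T : Op n}
    (hT : T.IsPositive) : ∫ ω, quad T a (f j ω) * ‖f j ω‖ ^ r ∂P ≤
      secondBound L Lk r / n * trPow T a := by
  obtain ⟨b, t, ht, hq, htr⟩ := exists_spectral_trPow hT
  have hi : ∀ k, Integrable (fun ω => t k ^ a * (‖inner ℂ (f j ω) (b k)‖ ^ 2 * ‖f j ω‖ ^ r)) P :=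
    fun k => (((((h.hasMoments j).inner (hasMoments_const (b k))).norm.pow 2).mul
      ((h.hasMoments j).norm.pow r)).integrable).const_mul _
  have e : ∀ ω, quad T a (f j ω) * ‖f j ω‖ ^ r =
      ∑ k, t k ^ a * (‖inner ℂ (f j ω) (b k)‖ ^ 2 * ‖f j ω‖ ^ r) := by
    intro ω
    rw [hq, Finset.sum_mul]
    refine Finset.sum_congr rfl fun k _ => ?_
    rw [norm_inner_symm, mul_assoc]
  simp only [e]
  rw [integral_finsetSum _ fun k _ => hi k, htr, Finset.mul_sum]
  refine Finset.sum_le_sum fun k _ => ?_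
  rw [integral_const_mul, mul_comm (secondBound L Lk r / n)]
  have := h.integral_inner_sq_mul_le j r (b k)
  rw [b.orthonormal.1 k, one_pow, mul_one] at this
  exact mul_le_mul_of_nonneg_left this (pow_nonneg (ht k) a)

lemma IsSample.integral_quad_randCov_mul_le (h : IsSample L κ Lk P f) {S : Finset (Fin N)}
    {j : Fin N} (hj : j ∉ S) (r a : ℕ) :
    ∫ ω, quad (randCov f S ω) a (f j ω) * ‖f j ω‖ ^ r ∂P ≤
      secondBound L Lk r / n * ∫ ω, trPow (randCov f S ω) a ∂P := by
  rw [← integral_const_mul]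
  have hF : Measurable (Function.uncurry fun (T : Op n) (v : Vec n) =>
      quad T a v * ‖v‖ ^ r) :=
    ((continuous_quad continuous_fst continuous_snd a).mul (continuous_snd.norm.pow r)).measurable
  have key := integral_eq_integral_integral (F := fun (T : Op n) (v : Vec n) => quad T a v * ‖v‖ ^ r)
    (h.indepFun_randCov hj).symm (h.measurable_randCov S) (h.measurable j) hF.stronglyMeasurable
    ((h.hasMoments_quad S a (h.hasMoments j)).mul ((h.hasMoments j).norm.pow r)).integrable
  rw [key]
  refine integral_mono (integrable_integral_right (h.indepFun_randCov hj).symm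
    (h.measurable_randCov S) (h.measurable j) hF.stronglyMeasurable
    ((h.hasMoments_quad S a (h.hasMoments j)).mul ((h.hasMoments j).norm.pow r)).integrable)
    ((h.hasMoments_trPow S a).integrable.const_mul _) fun ω => ?_
  exact h.integral_quad_mul_le j r a (isPositive_covOp _ _)

/-- A bound for `n⁻¹ E Tr Mᵖ`. -/
def traceBound (L κ : ℝ) (Lk : ℕ → ℝ) : ℕ → ℝ
  | 0 => 1
  | p + 1 => κ * (3 ^ p * (secondBound L Lk 0 * traceBound L κ Lk p + Lk (2 * (p + 1)))) 

/-- At the cost of a constant factor and a moment of the norm, `f j` is removed from the operator,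
after which independence applies. -/
lemma IsSample.integral_quad_self_mul_le (h : IsSample L κ Lk P f) {S : Finset (Fin N)}
    {j : Fin N} (hj : j ∈ S) (r a : ℕ) :
    ∫ ω, quad (randCov f S ω) a (f j ω) * ‖f j ω‖ ^ r ∂P ≤
      3 ^ a * (secondBound L Lk r / n * (∫ ω, trPow (randCov f (S.erase j) ω) a ∂P) +
        Lk (2 * (a + 1) + r)) := by
  have hm := h.hasMoments j
  have i1 : Integrable (fun ω => quad (randCov f (S.erase j) ω) a (f j ω) * ‖f j ω‖ ^ r) P :=
    ((h.hasMoments_quad _ a hm).mul (hm.norm.pow r)).integrable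
  have i2 : Integrable (fun ω => ‖f j ω‖ ^ (2 * (a + 1) + r)) P := (hm.norm.pow _).integrable
  calc ∫ ω, quad (randCov f S ω) a (f j ω) * ‖f j ω‖ ^ r ∂P
      ≤ ∫ ω, 3 ^ a * (quad (randCov f (S.erase j) ω) a (f j ω) * ‖f j ω‖ ^ r +
          ‖f j ω‖ ^ (2 * (a + 1) + r)) ∂P := by
        refine integral_mono ((h.hasMoments_quad _ a hm).mul (hm.norm.pow r)).integrable
          ((i1.add i2).const_mul _) fun ω => ?_
        simp only [randCov]
        rw [covOp_eq_erase_add hj, pow_add, ← add_mul, ← mul_assoc]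
        gcongr
        exact quad_rankOne_update_le (isPositive_covOp _ _) _ a
    _ ≤ _ := by
        rw [integral_const_mul, integral_add i1 i2]
        gcongr
        · exact h.integral_quad_randCov_mul_le (Finset.notMem_erase j S) r a
        · exact h.moment j _

lemma IsSample.traceBound_nonneg (h : IsSample L κ Lk P f) (p : ℕ) : 0 ≤ traceBound L κ Lk p := by
  induction p with
  | zero => exact zero_le_one
  | succ p ih =>
    have h1 := h.secondBound_nonneg 0
    have h2 := h.moment_nonneg (2 * (p + 1))
    have h3 := h.kappa_nonneg
    rw [traceBound]
    positivity

/-- The trace of M^{p+1} is the sum over j of the forms of Mᵖ at `f j`. There are O(n) of them, and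
each has bounded mean because the trace of order p of the reduced sum is O(n). -/
lemma IsSample.integral_trPow_le (h : IsSample L κ Lk P f) (S : Finset (Fin N)) (p : ℕ) :
    ∫ ω, trPow (randCov f S ω) p ∂P ≤ traceBound L κ Lk p * n := by
  have hn : (0 : ℝ) < n := by exact_mod_cast h.pos
  induction p generalizing S with
  | zero => simp [trPow_zero, traceBound]
  | succ p ih =>
    have h1 := h.secondBound_nonneg 0
    have h2 := h.moment_nonneg (2 * (p + 1))
    have h4 := h.traceBound_nonneg p
    simp only [randCov, trPow_covOp_succ]
    rw [integral_finsetSum _ fun j _ => (h.hasMoments_quad S p (h.hasMoments j)).integrable]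
    rw [traceBound, mul_assoc]
    refine h.sum_le S (by positivity) fun j hj => ?_
    have h5 := h.integral_quad_self_mul_le hj 0 p
    simp only [pow_zero, mul_one, add_zero] at h5
    refine h5.trans ?_
    rw [mul_div_assoc, div_self hn.ne', mul_one]
    refine mul_le_mul_of_nonneg_left (add_le_add ?_ le_rfl) (by positivity)
    calc _ ≤ secondBound L Lk 0 / n * (traceBound L κ Lk p * n) := by
          gcongr
          exact ih _
      _ = _ := by field_simp

/-- A bound for the moments of `⟨f, Mⁱ f⟩`. -/
def formBound (L κ : ℝ) (Lk : ℕ → ℝ) (i q : ℕ) : ℝ :=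
  1 + 3 ^ (i * q) * (secondBound L Lk (2 * (q - 1)) * traceBound L κ Lk (i * q) +
    Lk (2 * (i * q + 1) + 2 * (q - 1)))

lemma IsSample.formBound_nonneg (h : IsSample L κ Lk P f) (i q : ℕ) : 0 ≤ formBound L κ Lk i q := by
  have h1 := h.secondBound_nonneg (2 * (q - 1))
  have h2 := h.moment_nonneg (2 * (i * q + 1) + 2 * (q - 1))
  have h4 := h.traceBound_nonneg (i * q)
  rw [formBound]
  positivity

/-- By Jensen for the spectral measure, a power of the form is at most a form of higher order times
a power of the norm, and the trace bound controls the mean of that. -/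
lemma IsSample.integral_quad_pow_le (h : IsSample L κ Lk P f) {S : Finset (Fin N)} {j : Fin N}
    (hj : j ∈ S) (i q : ℕ) :
    ∫ ω, quad (randCov f S ω) i (f j ω) ^ q ∂P ≤ formBound L κ Lk i q := by
  have hn : (0 : ℝ) < n := by exact_mod_cast h.pos
  have h1 := h.secondBound_nonneg (2 * (q - 1))
  have h2 := h.moment_nonneg (2 * (i * q + 1) + 2 * (q - 1))
  have h4 := h.traceBound_nonneg (i * q)
  have hm := h.hasMoments j
  -- The summand `1` in `formBound` is there for the exponent zero.
  cases q with
  | zero =>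
    simp only [pow_zero, formBound]
    simp only [integral_const, probReal_univ, smul_eq_mul, one_mul]
    exact le_add_of_nonneg_right (by positivity)
  | succ q =>
    simp only [add_tsub_cancel_right] at h1 h2
    calc ∫ ω, quad (randCov f S ω) i (f j ω) ^ (q + 1) ∂P
        ≤ ∫ ω, quad (randCov f S ω) (i * (q + 1)) (f j ω) * ‖f j ω‖ ^ (2 * q) ∂P := by
          refine integral_mono ((h.hasMoments_quad S i hm).pow _).integrable
            ((h.hasMoments_quad S _ hm).mul (hm.norm.pow _)).integrable fun ω => ?_
          simp only
          rw [mul_comm]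
          exact quad_pow_le (isPositive_covOp _ _) _ _ _
      _ ≤ _ := h.integral_quad_self_mul_le hj (2 * q) (i * (q + 1))
      _ ≤ 3 ^ (i * (q + 1)) * (secondBound L Lk (2 * q) / n * (traceBound L κ Lk (i * (q + 1)) * n)
            + Lk (2 * (i * (q + 1) + 1) + 2 * q)) := by
          gcongr
          exact h.integral_trPow_le _ _
      _ ≤ _ := by
          rw [formBound, add_tsub_cancel_right, div_mul_eq_mul_div, mul_div_assoc,
            mul_div_cancel_right₀ _ hn.ne']
          linarith

lemma norm_add_sum_sq_le {E : Type*} [SeminormedAddCommGroup E] (a : ℕ) (z : E) (w : ℕ → E) :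
    ‖z + ∑ i ∈ Finset.range a, w i‖ ^ 2 ≤
      (a + 1) * (‖z‖ ^ 2 + ∑ i ∈ Finset.range a, ‖w i‖ ^ 2) := by
  have h1 : ‖z + ∑ i ∈ Finset.range a, w i‖ ≤
      ∑ i ∈ Finset.range (a + 1), (if i = a then ‖z‖ else ‖w i‖) := by
    rw [Finset.sum_range_succ, if_pos rfl, add_comm]
    refine (norm_add_le _ _).trans (add_le_add_left ?_ _)
    refine (norm_sum_le _ _).trans (le_of_eq (Finset.sum_congr rfl fun i hi => ?_))
    rw [if_neg (Finset.mem_range.1 hi).ne]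
  have h2 := sq_sum_le_card_mul_sum_sq (s := Finset.range (a + 1))
    (f := fun i => if i = a then ‖z‖ else ‖w i‖)
  refine (pow_le_pow_left₀ (norm_nonneg _) h1 2).trans (h2.trans (le_of_eq ?_))
  rw [Finset.sum_range_succ, if_pos rfl, add_comm (‖z‖ ^ 2), Finset.card_range]
  push_cast
  congr 2
  exact Finset.sum_congr rfl fun i hi => by rw [if_neg (Finset.mem_range.1 hi).ne]

/-- Cauchy-Schwarz in the primed telescoping. The coefficients are forms with bounded moments, and
the vectors paired with `v j` no longer involve `v j`. -/
lemma norm_inner_covOp_pow_sq_le {ι : Type*} [DecidableEq ι] {S : Finset ι} {j : ι} (hj : j ∈ S)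
    (v : ι → Vec n) (x : Vec n) (a : ℕ) :
    ‖inner ℂ (v j) ((covOp S v ^ a) x)‖ ^ 2 ≤
      (a + 1) * (‖inner ℂ (v j) ((covOp (S.erase j) v ^ a) x)‖ ^ 2 +
        ∑ i ∈ Finset.range a, quad (covOp S v) i (v j) ^ 2 *
          ‖inner ℂ (v j) ((covOp (S.erase j) v ^ (a - 1 - i)) x)‖ ^ 2) := by
  have h := pow_apply_rankOne_update' (covOp (S.erase j) v) (v j) x (v j) a
  rw [← covOp_eq_erase_add hj] at h
  rw [h]
  refine (norm_add_sum_sq_le _ _ _).trans (le_of_eq ?_)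
  congr 2
  refine Finset.sum_congr rfl fun i _ => ?_
  rw [norm_mul, mul_pow, inner_pow_eq_quad (isPositive_covOp S v), Complex.norm_real,
    Real.norm_eq_abs, sq_abs]

end Bounds

/-! ### Bounds for forms at deterministic vectors -/

section Isotropic

variable {L κ : ℝ} {Lk : ℕ → ℝ} {Ω : Type*} [MeasurableSpace Ω] {P : Measure Ω}
  [IsProbabilityMeasure P] {n N : ℕ} {f : Fin N → Ω → Vec n}

/-- Given the operator, the vector `u` and the form at `x` are fixed, so the marginal second moment
of `f j` factors out. -/
lemma IsSample.integral_inner_sq_mul_quad_le (h : IsSample L κ Lk P f) {S : Finset (Fin N)}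
    {j : Fin N} (hj : j ∉ S) (p : ℕ) {u : Op n → Vec n} (hu : Measurable u)
    (hu1 : ∀ T, ‖u T‖ ≤ 1) (x : Vec n) :
    Integrable (fun ω => ‖inner ℂ (f j ω) (u (randCov f S ω))‖ ^ 2 * quad (randCov f S ω) p x) P ∧
    ∫ ω, ‖inner ℂ (f j ω) (u (randCov f S ω))‖ ^ 2 * quad (randCov f S ω) p x ∂P ≤
      secondBound L Lk 0 / n * ∫ ω, quad (randCov f S ω) p x ∂P := by
  have hm := h.hasMoments j
  have hmu : HasMoments P (fun ω => u (randCov f S ω)) :=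
    (hasMoments_const (1 : ℝ)).mono (hu.comp (h.measurable_randCov S)).aestronglyMeasurable
      fun ω => by simpa using hu1 _
  have hmq := h.hasMoments_quad S p (hasMoments_const x)
  have hi := (((hm.inner hmu).norm.pow 2).mul hmq).integrable
  refine ⟨hi, ?_⟩
  rw [← integral_const_mul]
  have hF : Measurable (Function.uncurry fun (T : Op n) (v : Vec n) =>
      ‖inner ℂ v (u T)‖ ^ 2 * quad T p x) := by
    have m1 : Measurable fun z : Op n × Vec n => inner ℂ z.2 (u z.1) :=
      measurable_snd.inner (hu.comp measurable_fst)
    have m2 : Measurable fun z : Op n × Vec n => quad z.1 p x :=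
      (continuous_quad continuous_fst continuous_const p).measurable
    exact (m1.norm.pow_const 2).mul m2
  rw [integral_eq_integral_integral
    (F := fun (T : Op n) (v : Vec n) => ‖inner ℂ v (u T)‖ ^ 2 * quad T p x)
    (h.indepFun_randCov hj).symm (h.measurable_randCov S) (h.measurable j) hF.stronglyMeasurable hi]
  refine integral_mono (integrable_integral_right (h.indepFun_randCov hj).symm
    (h.measurable_randCov S) (h.measurable j) hF.stronglyMeasurable hi)
    (hmq.integrable.const_mul _) fun ω => ?_
  simp only
  rw [integral_mul_const]
  refine mul_le_mul_of_nonneg_right ?_ (quad_nonneg (isPositive_covOp _ _) _ _)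
  have h1 := h.integral_inner_sq_mul_le j 0 (u (randCov f S ω))
  simp only [pow_zero, mul_one] at h1
  refine h1.trans (mul_le_of_le_one_right ?_ (pow_le_one₀ (norm_nonneg _) (hu1 _)))
  exact div_nonneg (h.secondBound_nonneg 0) (Nat.cast_nonneg n)

lemma IsSample.integral_inner_four_le (h : IsSample L κ Lk P f) {S : Finset (Fin N)}
    {j : Fin N} (hj : j ∉ S) {u : Op n → Vec n} (hu : Measurable u)
    (hmu : HasMoments P (fun ω => u (randCov f S ω))) :
    ∫ ω, ‖inner ℂ (f j ω) (u (randCov f S ω))‖ ^ 4 ∂P ≤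
      L / (n : ℝ) ^ 2 * ∫ ω, ‖u (randCov f S ω)‖ ^ 4 ∂P := by
  have hm := h.hasMoments j
  have hi := ((hm.inner hmu).norm.pow 4).integrable
  rw [← integral_const_mul]
  have hF : Measurable (Function.uncurry fun (T : Op n) (v : Vec n) => ‖inner ℂ v (u T)‖ ^ 4) := by
    have m1 : Measurable fun z : Op n × Vec n => inner ℂ z.2 (u z.1) :=
      measurable_snd.inner (hu.comp measurable_fst)
    exact m1.norm.pow_const 4
  rw [integral_eq_integral_integral (F := fun (T : Op n) (v : Vec n) => ‖inner ℂ v (u T)‖ ^ 4)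
    (h.indepFun_randCov hj).symm (h.measurable_randCov S) (h.measurable j) hF.stronglyMeasurable hi]
  refine integral_mono (integrable_integral_right (h.indepFun_randCov hj).symm
    (h.measurable_randCov S) (h.measurable j) hF.stronglyMeasurable hi)
    ((hmu.norm.pow 4).integrable.const_mul _) fun ω => ?_
  exact h.four j _

/-- The form H at `f j` depends on everything, so it must be split off. With Y the squared inner
product of `f j` with the normalized vector, `quad_mul_sq_le` bounds the integrand by Y times the
form of order 2a, plus Y, plus Y H²ᵃ. Independence treats the first two. The last is at most n Y²/2
+ H⁴ᵃ/(2n), and E Y² = O(n⁻²) because the vector is normalized; moments of M_jᵗ x, not yet known to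
be bounded, are never needed. -/
lemma IsSample.integral_quad_sq_mul_le (h : IsSample L κ Lk P f) {S : Finset (Fin N)} {j : Fin N}
    (hj : j ∈ S) {a i t : ℕ} (hta : t < a) {x : Vec n} (hx : ‖x‖ ≤ 1) :
    ∫ ω, quad (randCov f S ω) i (f j ω) ^ 2 *
        ‖inner ℂ (f j ω) ((randCov f (S.erase j) ω ^ t) x)‖ ^ 2 ∂P ≤
      (secondBound L Lk 0 * ∫ ω, quad (randCov f (S.erase j) ω) (2 * a) x ∂P +
        (secondBound L Lk 0 + (L + formBound L κ Lk i (4 * a)) / 2)) / n := by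
  have hn : (0 : ℝ) < n := by exact_mod_cast h.pos
  have hj' := Finset.notMem_erase j S
  set S' := S.erase j with hS'
  set u : Op n → Vec n := fun T => normalize ((T ^ t) x) with hu
  have mu : Measurable u := measurable_normalize.comp
    ((continuous_pow_apply t).comp (continuous_id.prodMk continuous_const)).measurable
  have hu1 : ∀ T, ‖u T‖ ≤ 1 := fun T => norm_normalize_le _
  have hmu : HasMoments P (fun ω => u (randCov f S' ω)) :=
    (hasMoments_const (1 : ℝ)).mono (mu.comp (h.measurable_randCov S')).aestronglyMeasurable
      fun ω => by simpa using hu1 _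
  have hm := h.hasMoments j
  have hY := (hm.inner hmu).norm
  have hq := h.hasMoments_quad S i hm
  obtain ⟨i1, b1⟩ := h.integral_inner_sq_mul_quad_le hj' (2 * a) mu hu1 x
  have i3 : Integrable (fun ω => ‖inner ℂ (f j ω) (u (randCov f S' ω))‖ ^ 2) P :=
    (hY.pow 2).integrable
  have b3 : ∫ ω, ‖inner ℂ (f j ω) (u (randCov f S' ω))‖ ^ 2 ∂P ≤ secondBound L Lk 0 / n := by
    -- The form of order zero at a unit vector is 1, so the preceding lemma specialises to the plain
    -- second moment.
    obtain ⟨e, he⟩ : ∃ e : Vec n, ‖e‖ = 1 := by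
      refine ⟨EuclideanSpace.single ⟨0, h.pos⟩ 1, by simp⟩
    have := (h.integral_inner_sq_mul_quad_le hj' 0 mu hu1 e).2
    simpa [quad_zero, he] using this
  have i4 : Integrable (fun ω => ‖inner ℂ (f j ω) (u (randCov f S' ω))‖ ^ 4) P :=
    (hY.pow 4).integrable
  have i5 : Integrable (fun ω => quad (randCov f S ω) i (f j ω) ^ (4 * a)) P :=
    (hq.pow (4 * a)).integrable
  have b4 : ∫ ω, ‖inner ℂ (f j ω) (u (randCov f S' ω))‖ ^ 4 ∂P ≤ L / (n : ℝ) ^ 2 := by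
    refine (h.integral_inner_four_le hj' mu hmu).trans ?_
    refine mul_le_of_le_one_right (div_nonneg h.nonneg (sq_nonneg _)) ?_
    calc _ ≤ ∫ ω, (1 : ℝ) ∂P := integral_mono (hmu.norm.pow 4).integrable (integrable_const _)
          fun ω => pow_le_one₀ (norm_nonneg _) (hu1 _)
      _ = 1 := by simp
  have b5 := h.integral_quad_pow_le hj i (4 * a)
  calc _ ≤ ∫ ω, (‖inner ℂ (f j ω) (u (randCov f S' ω))‖ ^ 2 * quad (randCov f S' ω) (2 * a) x +
          ‖inner ℂ (f j ω) (u (randCov f S' ω))‖ ^ 2 +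
          (n / 2 * ‖inner ℂ (f j ω) (u (randCov f S' ω))‖ ^ 4 +
            1 / (2 * n) * quad (randCov f S ω) i (f j ω) ^ (4 * a))) ∂P := by
        refine integral_mono ((hq.pow 2).mul ((hm.inner (h.hasMoments_pow_apply S' t
          (hasMoments_const x))).norm.pow 2)).integrable
          ((i1.add i3).add ((i4.const_mul _).add (i5.const_mul _))) fun ω => ?_
        simp only
        rw [norm_inner_sq_eq, norm_pow_apply_sq (isPositive_covOp _ _)]
        set Y := ‖inner ℂ (f j ω) (normalize ((randCov f S' ω ^ t) x))‖ ^ 2 with hYdef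
        have hY0 : 0 ≤ Y := sq_nonneg _
        set H := quad (randCov f S ω) i (f j ω) with hH
        have hH0 : 0 ≤ H := quad_nonneg (isPositive_covOp _ _) _ _
        have k1 := quad_mul_sq_le (T := randCov f S' ω) (isPositive_covOp _ _) x hta hH0
        have k2 : (H ^ (2 * a) + 1) * ‖x‖ ^ 2 ≤ H ^ (2 * a) + 1 :=
          mul_le_of_le_one_right (by positivity) (pow_le_one₀ (norm_nonneg _) hx)
        have k3 : Y * H ^ (2 * a) ≤ n / 2 * Y ^ 2 + 1 / (2 * n) * H ^ (4 * a) := by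
          have e : H ^ (4 * a) = (H ^ (2 * a)) ^ 2 := by rw [← pow_mul]; ring_nf
          rw [e]
          have : 0 ≤ (n * Y - H ^ (2 * a)) ^ 2 / (2 * n) := by positivity
          have e3 : (n * Y - H ^ (2 * a)) ^ 2 / (2 * n) =
            n / 2 * Y ^ 2 + 1 / (2 * n) * (H ^ (2 * a)) ^ 2 - Y * H ^ (2 * a) := by
            field_simp
            ring
          linarith
        have e4 : ‖inner ℂ (f j ω) (normalize ((randCov f S' ω ^ t) x))‖ ^ 4 = Y ^ 2 := by
          rw [hYdef]
          ring
        rw [e4]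
        calc H ^ 2 * (Y * quad (randCov f S' ω) (2 * t) x)
            = Y * (quad (randCov f S' ω) (2 * t) x * H ^ 2) := by ring
          _ ≤ Y * (quad (randCov f S' ω) (2 * a) x + (H ^ (2 * a) + 1)) := by
              gcongr
              linarith
          _ ≤ _ := by linarith
    _ = ∫ ω, ‖inner ℂ (f j ω) (u (randCov f S' ω))‖ ^ 2 * quad (randCov f S' ω) (2 * a) x ∂P +
          ∫ ω, ‖inner ℂ (f j ω) (u (randCov f S' ω))‖ ^ 2 ∂P +
          (n / 2 * ∫ ω, ‖inner ℂ (f j ω) (u (randCov f S' ω))‖ ^ 4 ∂P +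
            1 / (2 * n) * ∫ ω, quad (randCov f S ω) i (f j ω) ^ (4 * a) ∂P) := by
        have i6 := i4.const_mul ((n : ℝ) / 2)
        have i7 := i5.const_mul (1 / (2 * (n : ℝ)))
        have i8 := i6.add i7
        have i9 := i1.add i3
        rw [← integral_const_mul, ← integral_const_mul, ← integral_add i6 i7, ← integral_add i1 i3]
        exact integral_add i9 i8
    _ ≤ secondBound L Lk 0 / n * ∫ ω, quad (randCov f S' ω) (2 * a) x ∂P +
          secondBound L Lk 0 / n +
          (n / 2 * (L / (n : ℝ) ^ 2) + 1 / (2 * n) * formBound L κ Lk i (4 * a)) := by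
        gcongr
    _ = _ := by
        field_simp
        ring

/-- The constant in front of the moment of order `2 a` in the recursion for `oddBound`. -/
def oddCoeff (L : ℝ) (Lk : ℕ → ℝ) (a : ℕ) : ℝ := (a + 1) ^ 2 * secondBound L Lk 0

/-- The additive constant in the recursion for `oddBound`. -/
def oddConst (L κ : ℝ) (Lk : ℕ → ℝ) (a : ℕ) : ℝ :=
  (a + 1) * ∑ i ∈ Finset.range a, (secondBound L Lk 0 + (L + formBound L κ Lk i (4 * a)) / 2)

/-- A bound for `E ⟨x, M²ᵃ⁺¹ x⟩` with `‖x‖ ≤ 1`. -/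
def oddBound (L κ : ℝ) (Lk : ℕ → ℝ) : ℕ → ℝ
  | 0 => κ * secondBound L Lk 0
  | a + 1 => 2 * κ * (oddCoeff L Lk (a + 1) * ((2 * κ * oddCoeff L Lk (a + 1) + 1) *
      oddBound L κ Lk a) + oddConst L κ Lk (a + 1))

lemma IsSample.oddCoeff_nonneg (h : IsSample L κ Lk P f) (a : ℕ) : 0 ≤ oddCoeff L Lk a :=
  mul_nonneg (sq_nonneg _) (h.secondBound_nonneg 0)

lemma IsSample.oddConst_nonneg (h : IsSample L κ Lk P f) (a : ℕ) : 0 ≤ oddConst L κ Lk a := by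
  refine mul_nonneg (by positivity) (Finset.sum_nonneg fun i _ => ?_)
  have h1 := h.secondBound_nonneg 0
  have h2 := h.formBound_nonneg i (4 * a)
  have h3 := h.nonneg
  positivity

lemma IsSample.oddBound_nonneg (h : IsSample L κ Lk P f) (a : ℕ) : 0 ≤ oddBound L κ Lk a := by
  have h1 := h.kappa_nonneg
  induction a with
  | zero => exact mul_nonneg h1 (h.secondBound_nonneg 0)
  | succ a ih =>
    have h2 := h.oddCoeff_nonneg (a + 1)
    have h3 := h.oddConst_nonneg (a + 1)
    rw [oddBound]
    positivity

/-- Expanding about the sum without `f j` leaves only the moment of order 2a of that sum and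
constants, all divided by n. -/
lemma IsSample.integral_inner_pow_sq_le (h : IsSample L κ Lk P f) {S : Finset (Fin N)} {j : Fin N}
    (hj : j ∈ S) (a : ℕ) {x : Vec n} (hx : ‖x‖ ≤ 1) :
    ∫ ω, ‖inner ℂ (f j ω) ((randCov f S ω ^ a) x)‖ ^ 2 ∂P ≤
      (oddCoeff L Lk a * ∫ ω, quad (randCov f (S.erase j) ω) (2 * a) x ∂P +
        oddConst L κ Lk a) / n := by
  have hn : (0 : ℝ) < n := by exact_mod_cast h.pos
  have hm := h.hasMoments j
  have hc := hasMoments_const (P := P) x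
  have i1 := ((hm.inner (h.hasMoments_pow_apply (S.erase j) a hc)).norm.pow 2).integrable
  have i2 : ∀ i, Integrable (fun ω => quad (randCov f S ω) i (f j ω) ^ 2 *
        ‖inner ℂ (f j ω) ((randCov f (S.erase j) ω ^ (a - 1 - i)) x)‖ ^ 2) P := fun i =>
    (((h.hasMoments_quad S i hm).pow 2).mul
      ((hm.inner (h.hasMoments_pow_apply (S.erase j) (a - 1 - i) hc)).norm.pow 2)).integrable
  have i3 := integrable_finsetSum (Finset.range a) fun i _ => i2 i
  set E := ∫ ω, quad (randCov f (S.erase j) ω) (2 * a) x ∂P with hE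
  have b1 : ∫ ω, ‖inner ℂ (f j ω) ((randCov f (S.erase j) ω ^ a) x)‖ ^ 2 ∂P ≤
      secondBound L Lk 0 * E / n := by
    have k := h.integral_inner_sq_mul_quad_le (Finset.notMem_erase j S) (2 * a)
      (u := fun T => normalize ((T ^ a) x)) (measurable_normalize.comp
      ((continuous_pow_apply a).comp (continuous_id.prodMk continuous_const)).measurable)
      (fun T => norm_normalize_le _) x
    refine (le_of_eq ?_).trans (k.2.trans (le_of_eq ?_))
    · refine integral_congr_ae (ae_of_all _ fun ω => ?_)
      simp only
      rw [norm_inner_sq_eq, norm_pow_apply_sq (isPositive_covOp _ _)]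
    · ring
  calc _ ≤ ∫ ω, ((a : ℝ) + 1) * (‖inner ℂ (f j ω) ((randCov f (S.erase j) ω ^ a) x)‖ ^ 2 +
        ∑ i ∈ Finset.range a, quad (randCov f S ω) i (f j ω) ^ 2 *
          ‖inner ℂ (f j ω) ((randCov f (S.erase j) ω ^ (a - 1 - i)) x)‖ ^ 2) ∂P :=
        integral_mono ((hm.inner (h.hasMoments_pow_apply S a hc)).norm.pow 2).integrable
          ((i1.add i3).const_mul _)
          fun ω => norm_inner_covOp_pow_sq_le hj (fun j => f j ω) x a
    _ = (a + 1) * (∫ ω, ‖inner ℂ (f j ω) ((randCov f (S.erase j) ω ^ a) x)‖ ^ 2 ∂P +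
        ∑ i ∈ Finset.range a, ∫ ω, quad (randCov f S ω) i (f j ω) ^ 2 *
          ‖inner ℂ (f j ω) ((randCov f (S.erase j) ω ^ (a - 1 - i)) x)‖ ^ 2 ∂P) := by
        rw [integral_const_mul, integral_add i1 i3, integral_finsetSum _ fun i _ => i2 i]
    _ ≤ (a + 1) * (secondBound L Lk 0 * E / n + ∑ i ∈ Finset.range a,
        (secondBound L Lk 0 * E +
          (secondBound L Lk 0 + (L + formBound L κ Lk i (4 * a)) / 2)) / n) := by
        gcongr with i hi
        rw [Finset.mem_range] at hi
        exact h.integral_quad_sq_mul_le hj (by omega) hx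
    _ = _ := by
        rw [← Finset.sum_div, Finset.sum_add_distrib, Finset.sum_const, Finset.card_range,
          oddCoeff, oddConst, nsmul_eq_mul]
        field_simp
        ring

/-- The moment of order 2a + 1 is a sum of O(n) terms, each bounded by C/n times a moment of order
2a of a smaller sum plus a constant. Interpolation replaces that even order by 2a + 1 with a small
factor and 2a - 1 with a large one, and the former is absorbed. -/
lemma IsSample.integral_quad_odd_le (h : IsSample L κ Lk P f) (a : ℕ) (S : Finset (Fin N))
    {x : Vec n} (hx : ‖x‖ ≤ 1) :
    ∫ ω, quad (randCov f S ω) (2 * a + 1) x ∂P ≤ oddBound L κ Lk a := by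
  have hn : (0 : ℝ) < n := by exact_mod_cast h.pos
  have hκ := h.kappa_nonneg
  have hc := hasMoments_const (P := P) x
  have hsum : ∀ a S, ∫ ω, quad (randCov f S ω) (2 * a + 1) x ∂P =
      ∑ j ∈ S, ∫ ω, ‖inner ℂ (f j ω) ((randCov f S ω ^ a) x)‖ ^ 2 ∂P := by
    intro a S
    simp only [randCov, quad_covOp_odd]
    exact integral_finsetSum _ fun j _ =>
      (((h.hasMoments j).inner (h.hasMoments_pow_apply S a hc)).norm.pow 2).integrable
  induction a generalizing S with
  | zero =>
    rw [hsum, oddBound]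
    refine h.sum_le S (h.secondBound_nonneg 0) fun j _ => ?_
    have h1 := h.integral_inner_sq_mul_le j 0 x
    simp only [pow_zero, mul_one] at h1
    refine h1.trans (mul_le_of_le_one_right ?_ (pow_le_one₀ (norm_nonneg _) hx))
    exact div_nonneg (h.secondBound_nonneg 0) hn.le
  | succ a ih =>
    set α := oddCoeff L Lk (a + 1) with hα
    set β := oddConst L κ Lk (a + 1) with hβ
    set B := oddBound L κ Lk a with hB
    set B' := oddBound L κ Lk (a + 1) with hB'
    have hα0 : 0 ≤ α := h.oddCoeff_nonneg _
    have hβ0 : 0 ≤ β := h.oddConst_nonneg _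
    have hB0 : 0 ≤ B := h.oddBound_nonneg _
    have hB0' : 0 ≤ B' := h.oddBound_nonneg _
    have hBeq : B' = 2 * κ * (α * ((2 * κ * α + 1) * B) + β) := rfl
    -- This makes κ α ε at most 1/2, so that half of `B'` remains for the other terms; `oddBound` is
    -- defined to match.
    set ε : ℝ := (2 * κ * α + 1)⁻¹ with hε
    have hε0 : 0 < ε := by positivity
    -- The absorption needs the moment of order 2a + 3 for `S` without one index. The inner
    -- induction supplies it with the same constant `B'`, hence without dependence on the size of
    -- `S`.
    induction S using Finset.strongInduction with
    | H S ihS =>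
      have heven : ∀ j ∈ S, ∫ ω, quad (randCov f (S.erase j) ω) (2 * (a + 1)) x ∂P ≤
          ε * B' + ε⁻¹ * B := by
        intro j hj
        have i1 := (h.hasMoments_quad (S.erase j) (2 * (a + 1) + 1) hc).integrable
        have i2 := (h.hasMoments_quad (S.erase j) (2 * a + 1) hc).integrable
        calc _ ≤ ∫ ω, (ε * quad (randCov f (S.erase j) ω) (2 * (a + 1) + 1) x +
              ε⁻¹ * quad (randCov f (S.erase j) ω) (2 * a + 1) x) ∂P :=
            integral_mono (h.hasMoments_quad (S.erase j) (2 * (a + 1)) hc).integrable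
              ((i1.const_mul _).add (i2.const_mul _))
              fun ω => mul_quad_succ_le (isPositive_covOp _ _) x (2 * a + 1) hε0
          _ = ε * ∫ ω, quad (randCov f (S.erase j) ω) (2 * (a + 1) + 1) x ∂P +
              ε⁻¹ * ∫ ω, quad (randCov f (S.erase j) ω) (2 * a + 1) x ∂P := by
            rw [integral_add (i1.const_mul _) (i2.const_mul _), integral_const_mul,
              integral_const_mul]
          _ ≤ _ := by
            gcongr
            · exact ihS _ (Finset.erase_ssubset hj)
            · exact ih _
      rw [hsum]
      have h1 := h.sum_le S (g := fun j =>
        ∫ ω, ‖inner ℂ (f j ω) ((randCov f S ω ^ (a + 1)) x)‖ ^ 2 ∂P)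
        (b := α * (ε * B' + ε⁻¹ * B) + β) (by positivity) (fun j hj => by
          refine (h.integral_inner_pow_sq_le hj (a + 1) hx).trans ?_
          gcongr
          exact heven j hj)
      refine h1.trans ?_
      have h2 : κ * α * ε ≤ 1 / 2 := by
        rw [hε, ← div_eq_mul_inv, div_le_iff₀ (by positivity)]
        linarith
      have h3 : ε⁻¹ = 2 * κ * α + 1 := inv_inv _
      have h4 : κ * α * ε * B' ≤ 1 / 2 * B' := by gcongr
      rw [h3]
      have h5 : κ * (α * ((2 * κ * α + 1) * B) + β) = B' / 2 := by
        rw [hBeq]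
        ring
      calc κ * (α * (ε * B' + (2 * κ * α + 1) * B) + β)
          = κ * α * ε * B' + κ * (α * ((2 * κ * α + 1) * B) + β) := by ring
        _ ≤ B' := by linarith

/-- A bound for `E ⟨x, Mᵖ x⟩` with `‖x‖ ≤ 1`. -/
def isoBound (L κ : ℝ) (Lk : ℕ → ℝ) (p : ℕ) : ℝ := 1 + oddBound L κ Lk (p / 2) +
  oddBound L κ Lk (p / 2 - 1)

lemma IsSample.integral_quad_le (h : IsSample L κ Lk P f) (p : ℕ) (S : Finset (Fin N))
    {x : Vec n} (hx : ‖x‖ ≤ 1) :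
    ∫ ω, quad (randCov f S ω) p x ∂P ≤ isoBound L κ Lk p := by
  have hc := hasMoments_const (P := P) x
  have h1 := h.oddBound_nonneg (p / 2)
  have h2 := h.oddBound_nonneg (p / 2 - 1)
  rw [isoBound]
  rcases Nat.even_or_odd' p with ⟨a, rfl | rfl⟩
  · cases a with
    | zero =>
      have : ‖x‖ ^ 2 ≤ 1 := pow_le_one₀ (norm_nonneg _) hx
      simp only [mul_zero, quad_zero, integral_const, probReal_univ, smul_eq_mul, one_mul]
      simp only [mul_zero] at h1 h2
      linarith
    | succ a =>
      have e1 : 2 * (a + 1) / 2 = a + 1 := by omega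
      rw [e1, add_tsub_cancel_right]
      have i1 := (h.hasMoments_quad S (2 * (a + 1) + 1) hc).integrable
      have i2 := (h.hasMoments_quad S (2 * a + 1) hc).integrable
      calc _ ≤ ∫ ω, (quad (randCov f S ω) (2 * (a + 1) + 1) x +
            quad (randCov f S ω) (2 * a + 1) x) ∂P :=
            integral_mono (h.hasMoments_quad S (2 * (a + 1)) hc).integrable
              (i1.add i2) fun ω => by
                have := mul_quad_succ_le (T := randCov f S ω) (isPositive_covOp _ _) x (2 * a + 1)
                  one_pos
                rw [one_mul, inv_one, one_mul] at this
                exact this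
        _ ≤ _ := by
            rw [integral_add i1 i2]
            have := h.integral_quad_odd_le (a + 1) S hx
            have := h.integral_quad_odd_le a S hx
            linarith
  · have e1 : (2 * a + 1) / 2 = a := by omega
    rw [e1] at h1 h2 ⊢
    have := h.integral_quad_odd_le a S hx
    linarith

/-- For z = ‖Mᵖ x‖ one has z^q ≤ 1 + z^{2(q+1)}, and by Jensen the even power is at most a single
form. -/
lemma IsSample.integral_norm_pow_apply_pow_le (h : IsSample L κ Lk P f) (p q : ℕ)
    (S : Finset (Fin N)) {x : Vec n} (hx : ‖x‖ ≤ 1) :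
    ∫ ω, ‖(randCov f S ω ^ p) x‖ ^ q ∂P ≤ 1 + isoBound L κ Lk (2 * p * (q + 1)) := by
  have hc := hasMoments_const (P := P) x
  have i1 := (h.hasMoments_quad S (2 * p * (q + 1)) hc).integrable
  calc _ ≤ ∫ ω, (1 + quad (randCov f S ω) (2 * p * (q + 1)) x) ∂P := by
        refine integral_mono ((h.hasMoments_pow_apply S p hc).norm.pow q).integrable
          ((integrable_const _).add i1) fun ω => ?_
        simp only
        set z := ‖(randCov f S ω ^ p) x‖ with hz
        have hz0 : 0 ≤ z := norm_nonneg _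
        have h1 : z ^ (2 * (q + 1)) ≤ quad (randCov f S ω) (2 * p * (q + 1)) x := by
          rw [pow_mul, hz, norm_pow_apply_sq (isPositive_covOp _ _)]
          refine (quad_pow_le (isPositive_covOp _ _) _ _ _).trans ?_
          exact mul_le_of_le_one_left (quad_nonneg (isPositive_covOp _ _) _ _)
            (pow_le_one₀ (norm_nonneg _) hx)
        rcases le_total z 1 with h2 | h2
        · have := pow_le_one₀ (n := q) hz0 h2
          have := quad_nonneg (T := randCov f S ω) (isPositive_covOp _ _) (2 * p * (q + 1)) x
          linarith
        · have := pow_le_pow_right₀ h2 (show q ≤ 2 * (q + 1) by omega)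
          linarith
    _ ≤ _ := by
        rw [integral_add (integrable_const _) i1]
        have := h.integral_quad_le (2 * p * (q + 1)) S hx
        simp only [integral_const, probReal_univ, smul_eq_mul, one_mul]
        linarith

end Isotropic

/-! ### Uniform upper limits -/

section UniformLimits

variable {γ : ℕ → Type*}

/-- The upper limit of `X m b` as `m → ∞`, uniformly in `b`, is at most zero. -/
def UZero (X : ∀ m, γ m → ℝ) : Prop := ∀ ε > 0, ∀ᶠ m in atTop, ∀ b, X m b ≤ ε

lemma UZero.mono {X Y : ∀ m, γ m → ℝ} (hY : UZero Y) (h : ∀ m b, X m b ≤ Y m b) : UZero X :=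
  fun ε hε => (hY ε hε).mono fun m hm b => (h m b).trans (hm b)

lemma UZero.add {X Y : ∀ m, γ m → ℝ} (hX : UZero X) (hY : UZero Y) :
    UZero (fun m b => X m b + Y m b) := fun ε hε => by
  filter_upwards [hX (ε / 2) (by positivity), hY (ε / 2) (by positivity)] with m h1 h2 b
  linarith [h1 b, h2 b]

lemma UZero.const_mul {X : ∀ m, γ m → ℝ} (hX : UZero X) {C : ℝ} (hC : 0 ≤ C) :
    UZero (fun m b => C * X m b) := fun ε hε => by
  filter_upwards [hX (ε / (C + 1)) (by positivity)] with m h1 b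
  calc C * X m b ≤ C * (ε / (C + 1)) := mul_le_mul_of_nonneg_left (h1 b) hC
    _ = C / (C + 1) * ε := by ring
    _ ≤ 1 * ε := by
      gcongr
      rw [div_le_one (by positivity)]
      linarith
    _ = ε := one_mul ε

lemma uZero_zero : UZero (fun m (_ : γ m) => 0) :=
  fun _ hε => Eventually.of_forall fun _ _ => hε.le

lemma UZero.sum {ι : Type*} {s : Finset ι} {X : ι → ∀ m, γ m → ℝ} (h : ∀ i ∈ s, UZero (X i)) :
    UZero (fun m b => ∑ i ∈ s, X i m b) := by
  classical
  induction s using Finset.induction_on with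
  | empty => simpa using uZero_zero
  | insert i s hi ih =>
    simp only [Finset.sum_insert hi]
    exact (h i (Finset.mem_insert_self i s)).add
      (ih fun j hj => h j (Finset.mem_insert_of_mem hj))

lemma uZero_of_tendsto {u : ℕ → ℝ} (hu : Tendsto u atTop (𝓝 0)) :
    UZero (fun m (_ : γ m) => u m) := fun _ hε =>
  (hu.eventually (gt_mem_nhds hε)).mono fun _ hm _ => hm.le

end UniformLimits

/-! ### Families with bounded moments and null families -/

section Families

variable {Ω : ℕ → Type*} [∀ m, MeasurableSpace (Ω m)] {P : ∀ m, Measure (Ω m)}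
  [∀ m, IsProbabilityMeasure (P m)] {β : ℕ → Type*}

/-- A family of random variables whose moments are bounded uniformly. -/
def UBdd (P : ∀ m, Measure (Ω m)) (X : ∀ m, β m → Ω m → ℝ) : Prop :=
  (∀ m b, HasMoments (P m) (X m b)) ∧ ∀ q : ℕ, ∃ C, ∀ m b, ∫ ω, |X m b ω| ^ q ∂(P m) ≤ C

/-- A family with uniformly bounded moments whose first absolute moments tend to zero. -/
def UNull (P : ∀ m, Measure (Ω m)) (X : ∀ m, β m → Ω m → ℝ) : Prop :=
  UBdd P X ∧ UZero (fun m b => ∫ ω, |X m b ω| ∂(P m))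

variable {X Y : ∀ m, β m → Ω m → ℝ}

lemma HasMoments.integrable_abs_pow {Ω : Type*} [MeasurableSpace Ω] {P : Measure Ω} {X : Ω → ℝ}
    (h : HasMoments P X) (q : ℕ) : Integrable (fun ω => |X ω| ^ q) P := by
  simpa only [Real.norm_eq_abs] using h.2 q

lemma UBdd.mono (hY : UBdd P Y) (hX : ∀ m b, HasMoments (P m) (X m b))
    (h : ∀ m b ω, |X m b ω| ≤ |Y m b ω|) : UBdd P X := by
  refine ⟨hX, fun q => ?_⟩
  obtain ⟨C, hC⟩ := hY.2 q
  refine ⟨C, fun m b => le_trans ?_ (hC m b)⟩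
  exact integral_mono ((hX m b).integrable_abs_pow q) ((hY.1 m b).integrable_abs_pow q)
    fun ω => pow_le_pow_left₀ (abs_nonneg _) (h m b ω) q

lemma uBdd_const (c : ℝ) : UBdd P (fun m (_ : β m) _ => c) :=
  ⟨fun _ _ => hasMoments_const c, fun q => ⟨|c| ^ q, fun m b => by simp⟩⟩

lemma UBdd.mul (hX : UBdd P X) (hY : UBdd P Y) : UBdd P (fun m b ω => X m b ω * Y m b ω) := by
  refine ⟨fun m b => (hX.1 m b).mul (hY.1 m b), fun q => ?_⟩
  obtain ⟨C, hC⟩ := hX.2 (2 * q)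
  obtain ⟨D, hD⟩ := hY.2 (2 * q)
  refine ⟨C + D, fun m b => ?_⟩
  have i1 := (hX.1 m b).integrable_abs_pow (2 * q)
  have i2 := (hY.1 m b).integrable_abs_pow (2 * q)
  calc _ ≤ ∫ ω, (|X m b ω| ^ (2 * q) + |Y m b ω| ^ (2 * q)) ∂(P m) :=
        integral_mono (((hX.1 m b).mul (hY.1 m b)).integrable_abs_pow q) (i1.add i2) fun ω => by
          simp only [abs_mul]
          exact pow_mul_le_add q
    _ ≤ _ := by
        rw [integral_add i1 i2]
        exact add_le_add (hC m b) (hD m b)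

lemma UBdd.add (hX : UBdd P X) (hY : UBdd P Y) : UBdd P (fun m b ω => X m b ω + Y m b ω) := by
  refine ⟨fun m b => (hX.1 m b).add (hY.1 m b), fun q => ?_⟩
  obtain ⟨C, hC⟩ := hX.2 q
  obtain ⟨D, hD⟩ := hY.2 q
  refine ⟨2 ^ (q - 1) * (C + D), fun m b => ?_⟩
  have i1 := (hX.1 m b).integrable_abs_pow q
  have i2 := (hY.1 m b).integrable_abs_pow q
  calc _ ≤ ∫ ω, 2 ^ (q - 1) * (|X m b ω| ^ q + |Y m b ω| ^ q) ∂(P m) :=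
        integral_mono (((hX.1 m b).add (hY.1 m b)).integrable_abs_pow q) ((i1.add i2).const_mul _)
          fun ω => (pow_le_pow_left₀ (abs_nonneg _) (abs_add_le _ _) q).trans
            (add_pow_le (abs_nonneg _) (abs_nonneg _) q)
    _ ≤ _ := by
        rw [integral_const_mul, integral_add i1 i2]
        gcongr
        · exact hC m b
        · exact hD m b

lemma UBdd.pow (hX : UBdd P X) (k : ℕ) : UBdd P (fun m b ω => X m b ω ^ k) := by
  induction k with
  | zero => simpa using uBdd_const (P := P) (β := β) 1
  | succ k ih => simpa only [pow_succ] using ih.mul hX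

/-- From |W| ≤ τ W² + τ⁻¹ the mean of |W X| is at most τ E |W² X| + τ⁻¹ E |X|. The first mean is
bounded, so τ is fixed to make that term at most ε/2 before the null family is used. -/
lemma UNull.mul_left (hX : UNull P X) {W : ∀ m, β m → Ω m → ℝ} (hW : UBdd P W) :
    UNull P (fun m b ω => W m b ω * X m b ω) := by
  refine ⟨hW.mul hX.1, fun ε hε => ?_⟩
  have hWX := (hW.pow 2).mul hX.1
  obtain ⟨C, hC⟩ := hWX.2 1
  set C' := max C 1 with hC'
  have hC0 : 0 < C' := lt_of_lt_of_le one_pos (le_max_right _ _)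
  set τ := ε / (2 * C') with hτ
  have hτ0 : 0 < τ := by positivity
  filter_upwards [hX.2 (τ * (ε / 2)) (by positivity)] with m hm b
  have i1 := (hWX.1 m b).integrable_abs_pow 1
  have i2 := (hX.1.1 m b).integrable_abs_pow 1
  simp only [pow_one] at i1 i2 hC
  calc ∫ ω, |W m b ω * X m b ω| ∂(P m)
      ≤ ∫ ω, (τ * |W m b ω ^ 2 * X m b ω| + τ⁻¹ * |X m b ω|) ∂(P m) := by
        have i3 := ((hW.mul hX.1).1 m b).integrable_abs_pow 1
        simp only [pow_one] at i3
        refine integral_mono i3 ((i1.const_mul _).add (i2.const_mul _)) fun ω => ?_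
        simp only
        rw [abs_mul, abs_mul, abs_pow]
        have k : |W m b ω| ≤ τ * |W m b ω| ^ 2 + τ⁻¹ := by
          have h1 : 0 ≤ τ⁻¹ * (τ * |W m b ω| - 1) ^ 2 + |W m b ω| := by positivity
          have h2 : τ⁻¹ * (τ * |W m b ω| - 1) ^ 2 = τ * |W m b ω| ^ 2 - 2 * |W m b ω| + τ⁻¹ := by
            field_simp
            ring
          linarith
        calc |W m b ω| * |X m b ω| ≤ (τ * |W m b ω| ^ 2 + τ⁻¹) * |X m b ω| := by gcongr
          _ = _ := by ring
    _ = τ * ∫ ω, |W m b ω ^ 2 * X m b ω| ∂(P m) + τ⁻¹ * ∫ ω, |X m b ω| ∂(P m) := by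
        rw [integral_add (i1.const_mul _) (i2.const_mul _), integral_const_mul, integral_const_mul]
    _ ≤ τ * C' + τ⁻¹ * (τ * (ε / 2)) := by
        gcongr
        · exact (hC m b).trans (le_max_left _ _)
        · exact hm b
    _ = ε := by
        rw [inv_mul_cancel_left₀ hτ0.ne', hτ]
        field_simp
        norm_num

end Families

/-! ### Errors of size o(1/n) when one sample vector is removed -/

section SampleFamilies

variable {n N : ℕ → ℕ} {Ω : ℕ → Type*} [∀ m, MeasurableSpace (Ω m)] {P : ∀ m, Measure (Ω m)}
  [∀ m, IsProbabilityMeasure (P m)] {f : ∀ m, Fin (N m) → Ω m → Vec (n m)}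
  {L κ : ℝ} {Lk : ℕ → ℝ} {β : ℕ → Type*}

lemma uBdd_norm (h : ∀ m, IsSample L κ Lk (P m) (f m)) (j : ∀ m, β m → Fin (N m)) :
    UBdd P (fun m b ω => ‖f m (j m b) ω‖) := by
  refine ⟨fun m b => ((h m).hasMoments _).norm, fun q => ⟨Lk q, fun m b => ?_⟩⟩
  simp only [abs_norm]
  exact (h m).moment _ q

lemma uBdd_norm_pow_apply (h : ∀ m, IsSample L κ Lk (P m) (f m)) (S : ∀ m, β m → Finset (Fin (N m)))
    (p : ℕ) {ξ : ∀ m, β m → Vec (n m)} (hξ : ∀ m b, ‖ξ m b‖ ≤ 1) :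
    UBdd P (fun m b ω => ‖(randCov (f m) (S m b) ω ^ p) (ξ m b)‖) := by
  refine ⟨fun m b => ((h m).hasMoments_pow_apply _ p (hasMoments_const _)).norm,
    fun q => ⟨1 + isoBound L κ Lk (2 * p * (q + 1)), fun m b => ?_⟩⟩
  simp only [abs_norm]
  exact (h m).integral_norm_pow_apply_pow_le p q _ (hξ m b)

variable {S : ∀ m, β m → Finset (Fin (N m))} {j : ∀ m, β m → Fin (N m)}

lemma uBdd_quad_self (h : ∀ m, IsSample L κ Lk (P m) (f m)) (hj : ∀ m b, j m b ∈ S m b) (i : ℕ) :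
    UBdd P (fun m b ω => quad (randCov (f m) (S m b) ω) i (f m (j m b) ω)) := by
  refine ⟨fun m b => (h m).hasMoments_quad _ i ((h m).hasMoments _),
    fun q => ⟨formBound L κ Lk i q, fun m b => ?_⟩⟩
  have e : ∀ ω, |quad (randCov (f m) (S m b) ω) i (f m (j m b) ω)| =
      quad (randCov (f m) (S m b) ω) i (f m (j m b) ω) := fun ω =>
    abs_of_nonneg (quad_nonneg (isPositive_covOp _ _) _ _)
  simp only [e]
  exact (h m).integral_quad_pow_le (hj m b) i q

/-- All terms in the expansion of the form at `f j` are nonnegative, so removing `f j` from the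
operator can only decrease it. -/
lemma uBdd_quad_erase (h : ∀ m, IsSample L κ Lk (P m) (f m)) (hj : ∀ m b, j m b ∈ S m b) (i : ℕ) :
    UBdd P (fun m b ω => quad (randCov (f m) ((S m b).erase (j m b)) ω) i (f m (j m b) ω)) := by
  refine (uBdd_quad_self h hj i).mono
    (fun m b => (h m).hasMoments_quad _ i ((h m).hasMoments _)) fun m b ω => ?_
  have p1 : (covOp ((S m b).erase (j m b)) fun j => f m j ω).IsPositive := isPositive_covOp _ _
  have p2 : (covOp (S m b) fun j => f m j ω).IsPositive := isPositive_covOp _ _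
  rw [abs_of_nonneg (quad_nonneg p1 _ _), abs_of_nonneg (quad_nonneg p2 _ _)]
  change quad (covOp ((S m b).erase (j m b)) fun j => f m j ω) i (f m (j m b) ω) ≤
    quad (covOp (S m b) fun j => f m j ω) i (f m (j m b) ω)
  rw [covOp_eq_erase_add (hj m b), quad_rankOne_update p1,
    ← covOp_eq_erase_add (hj m b)]
  exact le_add_of_nonneg_right (Finset.sum_nonneg fun l _ =>
    mul_nonneg (quad_nonneg p1 _ _) (quad_nonneg p2 _ _))

variable {ξ : ∀ m, β m → Vec (n m)}

/-- Young's inequality with weight τ n: the fourth power of the inner product has mean O(n⁻²), which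
leaves the small factor τ free. -/
lemma IsSample.natCast_mul_integral_le {Ω : Type*} [MeasurableSpace Ω] {P : Measure Ω}
    [IsProbabilityMeasure P] {n N : ℕ} {f : Fin N → Ω → Vec n} (h : IsSample L κ Lk P f)
    (S : Finset (Fin N)) (j : Fin N) (t : ℕ) {x : Vec n} (hx : ‖x‖ ≤ 1) {W : Ω → ℝ}
    (hW : HasMoments P W) {τ : ℝ} (hτ : 0 < τ) :
    n * ∫ ω, |‖inner ℂ (f j ω) ((randCov f (S.erase j) ω ^ t) x)‖ ^ 2 * W ω| ∂P ≤
      τ * (L * (1 + isoBound L κ Lk (2 * t * (4 + 1)))) + τ⁻¹ * ∫ ω, W ω ^ 2 ∂P := by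
  have hn : (0 : ℝ) < n := by exact_mod_cast h.pos
  have hmu := h.hasMoments_pow_apply (S.erase j) t (hasMoments_const (P := P) x)
  have hX := ((h.hasMoments j).inner hmu).norm
  have i1 := (hX.pow 4).integrable
  have i2 := (hW.pow 2).integrable
  have b1 := h.integral_inner_four_le (Finset.notMem_erase j S) (u := fun T => (T ^ t) x)
    ((continuous_pow_apply t).comp (continuous_id.prodMk continuous_const)).measurable hmu
  have b2 := h.integral_norm_pow_apply_pow_le t 4 (S.erase j) hx
  have b3 : ∫ ω, ‖inner ℂ (f j ω) ((randCov f (S.erase j) ω ^ t) x)‖ ^ 4 ∂P ≤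
      L / (n : ℝ) ^ 2 * (1 + isoBound L κ Lk (2 * t * (4 + 1))) :=
    b1.trans (mul_le_mul_of_nonneg_left b2 (div_nonneg h.nonneg (sq_nonneg _)))
  have i3 := (((hX.pow 2).mul hW).integrable_abs_pow 1)
  simp only [pow_one] at i3
  calc _ ≤ n * ∫ ω, (τ * n * ‖inner ℂ (f j ω) ((randCov f (S.erase j) ω ^ t) x)‖ ^ 4 +
          τ⁻¹ / n * W ω ^ 2) ∂P := by
        refine mul_le_mul_of_nonneg_left (integral_mono i3
          ((i1.const_mul _).add (i2.const_mul _)) fun ω => ?_) (Nat.cast_nonneg n)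
        simp only
        set A := ‖inner ℂ (f j ω) ((randCov f (S.erase j) ω ^ t) x)‖ ^ 2 with hA
        have hA0 : 0 ≤ A := sq_nonneg _
        have e4 : ‖inner ℂ (f j ω) ((randCov f (S.erase j) ω ^ t) x)‖ ^ 4 = A ^ 2 := by
          rw [hA]
          ring
        rw [e4, abs_mul, abs_of_nonneg hA0, ← sq_abs (W ω)]
        have h1 : 0 ≤ (τ * n * A - |W ω|) ^ 2 / (τ * n) + A * |W ω| := by positivity
        have h2 : (τ * n * A - |W ω|) ^ 2 / (τ * n) =
            τ * n * A ^ 2 + τ⁻¹ / n * |W ω| ^ 2 - 2 * (A * |W ω|) := by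
          field_simp
          ring
        linarith
    _ = n * (τ * n * ∫ ω, ‖inner ℂ (f j ω) ((randCov f (S.erase j) ω ^ t) x)‖ ^ 4 ∂P +
          τ⁻¹ / n * ∫ ω, W ω ^ 2 ∂P) := by
        rw [integral_add (i1.const_mul _) (i2.const_mul _), integral_const_mul, integral_const_mul]
    _ ≤ n * (τ * n * (L / (n : ℝ) ^ 2 * (1 + isoBound L κ Lk (2 * t * (4 + 1)))) +
          τ⁻¹ / n * ∫ ω, W ω ^ 2 ∂P) := by
        gcongr
    _ = _ := by
        field_simp

/-- `X` is, up to a factor `n⁻¹`, uniformly small in mean. -/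
def SNull (n : ℕ → ℕ) (P : ∀ m, Measure (Ω m)) (X : ∀ m, β m → Ω m → ℝ) : Prop :=
  (∀ m b, HasMoments (P m) (X m b)) ∧ UZero (fun m b => n m * ∫ ω, |X m b ω| ∂(P m))

lemma SNull.mono {X Y : ∀ m, β m → Ω m → ℝ} (hY : SNull n P Y)
    (hX : ∀ m b, HasMoments (P m) (X m b)) (h : ∀ m b ω, |X m b ω| ≤ |Y m b ω|) : SNull n P X := by
  refine ⟨hX, hY.2.mono fun m b => mul_le_mul_of_nonneg_left ?_ (Nat.cast_nonneg _)⟩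
  have i1 := (hX m b).integrable_abs_pow 1
  have i2 := (hY.1 m b).integrable_abs_pow 1
  simp only [pow_one] at i1 i2
  exact integral_mono i1 i2 fun ω => h m b ω

lemma SNull.add {X Y : ∀ m, β m → Ω m → ℝ} (hX : SNull n P X) (hY : SNull n P Y) :
    SNull n P (fun m b ω => X m b ω + Y m b ω) := by
  refine ⟨fun m b => (hX.1 m b).add (hY.1 m b), (hX.2.add hY.2).mono fun m b => ?_⟩
  rw [← mul_add]
  refine mul_le_mul_of_nonneg_left ?_ (Nat.cast_nonneg _)
  have i1 := (hX.1 m b).integrable_abs_pow 1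
  have i2 := (hY.1 m b).integrable_abs_pow 1
  have i3 := ((hX.1 m b).add (hY.1 m b)).integrable_abs_pow 1
  simp only [pow_one] at i1 i2 i3
  rw [← integral_add i1 i2]
  exact integral_mono i3 (i1.add i2) fun ω => abs_add_le _ _

lemma SNull.const_mul {X : ∀ m, β m → Ω m → ℝ} (hX : SNull n P X) (c : ℝ) :
    SNull n P (fun m b ω => c * X m b ω) := by
  refine ⟨fun m b => (hasMoments_const c).mul (hX.1 m b),
    (hX.2.const_mul (abs_nonneg c)).mono fun m b => le_of_eq ?_⟩
  simp only [abs_mul]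
  rw [integral_const_mul]
  ring

lemma sNull_zero : SNull n P (fun m (_ : β m) _ => 0) :=
  ⟨fun _ _ => hasMoments_const 0, by simpa using uZero_zero⟩

lemma SNull.sum {ι : Type*} {s : Finset ι} {X : ι → ∀ m, β m → Ω m → ℝ}
    (h : ∀ i ∈ s, SNull n P (X i)) : SNull n P (fun m b ω => ∑ i ∈ s, X i m b ω) := by
  classical
  induction s using Finset.induction_on with
  | empty => simpa using sNull_zero
  | insert i s hi ih =>
    simp only [Finset.sum_insert hi]
    exact (h i (Finset.mem_insert_self i s)).add
      (ih fun j hj => h j (Finset.mem_insert_of_mem hj))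

/-- Squares of a null family are null, since one factor serves as the bounded weight. Thus τ is
chosen first and then E W² is made small against it. -/
lemma sNull_inner_erase (h : ∀ m, IsSample L κ Lk (P m) (f m))
    (hξ : ∀ m b, ‖ξ m b‖ ≤ 1) (t : ℕ) {W : ∀ m, β m → Ω m → ℝ} (hW : UNull P W) :
    SNull n P (fun m b ω => ‖inner ℂ (f m (j m b) ω)
      ((randCov (f m) ((S m b).erase (j m b)) ω ^ t) (ξ m b))‖ ^ 2 * W m b ω) := by
  refine ⟨fun m b => ((((h m).hasMoments _).inner ((h m).hasMoments_pow_apply _ t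
    (hasMoments_const _))).norm.pow 2).mul (hW.1.1 m b), fun ε hε => ?_⟩
  set D := max (L * (1 + isoBound L κ Lk (2 * t * (4 + 1)))) 1 with hD
  have hD0 : 0 < D := lt_of_lt_of_le one_pos (le_max_right _ _)
  set τ := ε / (2 * D) with hτ
  have hτ0 : 0 < τ := by positivity
  have hW2 := (hW.mul_left hW.1).2
  filter_upwards [hW2 (τ * (ε / 2)) (by positivity)] with m hm b
  refine ((h m).natCast_mul_integral_le (S m b) (j m b) t (hξ m b) (hW.1.1 m b) hτ0).trans ?_
  have e : ∫ ω, W m b ω ^ 2 ∂(P m) = ∫ ω, |W m b ω * W m b ω| ∂(P m) := by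
    congr 1
    ext ω
    rw [abs_mul_self, sq]
  calc _ ≤ τ * D + τ⁻¹ * (τ * (ε / 2)) := by
        rw [e]
        gcongr
        · exact le_max_left _ _
        · exact hm b
    _ = ε := by
        rw [inv_mul_cancel_left₀ hτ0.ne', hτ]
        field_simp
        norm_num

lemma uNull_inner_erase (h : ∀ m, IsSample L κ Lk (P m) (f m)) (hn : Tendsto n atTop atTop)
    (hξ : ∀ m b, ‖ξ m b‖ ≤ 1) (t : ℕ) :
    UNull P (fun m b ω => ‖inner ℂ (f m (j m b) ω)
      ((randCov (f m) ((S m b).erase (j m b)) ω ^ t) (ξ m b))‖ ^ 2) := by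
  have hm : ∀ m b, HasMoments (P m) (fun ω => ‖inner ℂ (f m (j m b) ω)
      ((randCov (f m) ((S m b).erase (j m b)) ω ^ t) (ξ m b))‖ ^ 2) := fun m b =>
    (((h m).hasMoments _).inner ((h m).hasMoments_pow_apply _ t (hasMoments_const _))).norm.pow 2
  refine ⟨?_, ?_⟩
  · refine (((uBdd_norm h j).mul
      (uBdd_norm_pow_apply h (fun m b => (S m b).erase (j m b)) t hξ)).pow 2).mono hm
      fun m b ω => ?_
    rw [abs_pow, abs_pow, abs_norm]
    exact pow_le_pow_left₀ (norm_nonneg _) ((norm_inner_le_norm _ _).trans (le_abs_self _)) 2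
  · set D := L * (1 + isoBound L κ Lk (2 * t * (4 + 1))) + 1 with hD
    have hlim : Tendsto (fun m => D / (n m : ℝ)) atTop (𝓝 0) :=
      tendsto_const_nhds.div_atTop (tendsto_natCast_atTop_atTop.comp hn)
    refine (uZero_of_tendsto hlim).mono fun m b => ?_
    have hn : (0 : ℝ) < n m := by exact_mod_cast (h m).pos
    rw [le_div_iff₀ hn, mul_comm]
    -- With weight 1 and τ = 1 the bound is the constant `D`, so the mean itself is O(1/n).
    have := (h m).natCast_mul_integral_le (S m b) (j m b) t (hξ m b) (hasMoments_const (1 : ℝ)) one_pos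
    simpa [hD] using this

/-- Removing `f j` from the operator brings in squares of forms at `f j`; these have bounded moments
and are absorbed into the null weight. -/
lemma sNull_inner_self (h : ∀ m, IsSample L κ Lk (P m) (f m)) (hj : ∀ m b, j m b ∈ S m b)
    (hξ : ∀ m b, ‖ξ m b‖ ≤ 1) (t : ℕ) {W : ∀ m, β m → Ω m → ℝ} (hW : UNull P W) :
    SNull n P (fun m b ω => ‖inner ℂ (f m (j m b) ω)
      ((randCov (f m) (S m b) ω ^ t) (ξ m b))‖ ^ 2 * W m b ω) := by
  have key := ((sNull_inner_erase (S := S) (j := j) h hξ t hW).add (SNull.sum (s := Finset.range t) fun i _ =>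
    sNull_inner_erase (S := S) (j := j) h hξ (t - 1 - i)
      (hW.mul_left ((uBdd_quad_self h hj i).pow 2)))).const_mul ((t : ℝ) + 1)
  refine key.mono (fun m b => ((((h m).hasMoments _).inner ((h m).hasMoments_pow_apply _ t
    (hasMoments_const _))).norm.pow 2).mul (hW.1.1 m b)) fun m b ω => ?_
  have k1 := norm_inner_covOp_pow_sq_le (hj m b) (fun j => f m j ω) (ξ m b) t
  have e : ∀ A B C : ℝ, A * (B * C) = B * A * C := fun A B C => by ring
  simp only [e (‖_‖ ^ 2)]
  rw [← Finset.sum_mul, ← add_mul, ← mul_assoc, abs_mul, abs_mul]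
  refine mul_le_mul_of_nonneg_right ?_ (abs_nonneg _)
  rw [abs_of_nonneg (sq_nonneg _)]
  exact k1.trans (le_abs_self _)

/-- The difference is a sum of products of two inner products with `f j`. The square of one is a
null weight for the square of the other, which yields o(1/n) rather than O(1/n), small enough to sum
in the Efron-Stein inequality. -/
lemma sNull_quad_sub_sq (h : ∀ m, IsSample L κ Lk (P m) (f m)) (hn : Tendsto n atTop atTop)
    (hj : ∀ m b, j m b ∈ S m b) (hξ : ∀ m b, ‖ξ m b‖ ≤ 1) (p : ℕ) :
    SNull n P (fun m b ω => (quad (randCov (f m) (S m b) ω) p (ξ m b) -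
      quad (randCov (f m) ((S m b).erase (j m b)) ω) p (ξ m b)) ^ 2) := by
  have key := (SNull.sum (s := Finset.range p) fun i _ =>
    sNull_inner_self h hj hξ (p - 1 - i) (uNull_inner_erase (S := S) (j := j) h hn hξ i)).const_mul ((p : ℝ) + 1)
  refine key.mono (fun m b => (((h m).hasMoments_quad _ p (hasMoments_const _)).sub
    ((h m).hasMoments_quad _ p (hasMoments_const _))).pow 2) fun m b ω => ?_
  have p1 : (covOp ((S m b).erase (j m b)) fun j => f m j ω).IsPositive := isPositive_covOp _ _
  have k1 := pow_apply_rankOne_update (covOp ((S m b).erase (j m b)) fun j => f m j ω)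
    (f m (j m b) ω) (ξ m b) (ξ m b) p
  rw [← covOp_eq_erase_add (hj m b)] at k1
  have k2 : quad (randCov (f m) (S m b) ω) p (ξ m b) -
      quad (randCov (f m) ((S m b).erase (j m b)) ω) p (ξ m b) =
      RCLike.re (∑ i ∈ Finset.range p, inner ℂ (ξ m b)
        (((covOp ((S m b).erase (j m b)) fun j => f m j ω) ^ i) (f m (j m b) ω)) *
        inner ℂ (f m (j m b) ω) (((covOp (S m b) fun j => f m j ω) ^ (p - 1 - i)) (ξ m b))) := by
    rw [quad, quad, k1, map_add, add_sub_cancel_left]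
  have k3 := norm_add_sum_sq_le p (0 : ℂ) fun i => inner ℂ (ξ m b)
        (((covOp ((S m b).erase (j m b)) fun j => f m j ω) ^ i) (f m (j m b) ω)) *
        inner ℂ (f m (j m b) ω) (((covOp (S m b) fun j => f m j ω) ^ (p - 1 - i)) (ξ m b))
  rw [zero_add, norm_zero] at k3
  rw [k2, abs_pow]
  refine (pow_le_pow_left₀ (abs_nonneg _) (RCLike.abs_re_le_norm _) 2).trans (k3.trans ?_)
  refine le_trans (le_of_eq ?_) (le_abs_self _)
  rw [zero_pow two_ne_zero, zero_add]
  congr 1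
  refine Finset.sum_congr rfl fun i _ => ?_
  rw [norm_mul, mul_pow, ← inner_pow_apply p1, norm_inner_symm, mul_comm]

end SampleFamilies

lemma eq_smul_normalize {n : ℕ} (x : Vec n) : x = (‖x‖ : ℂ) • normalize x := by
  by_cases hx : x = 0
  · simp [hx]
  · have : (‖x‖ : ℂ) ≠ 0 := by simpa using hx
    rw [normalize, smul_smul, mul_inv_cancel₀ this, one_smul]

lemma inner_normalize_self {n : ℕ} (x : Vec n) : inner ℂ (normalize x) x = (‖x‖ : ℂ) := by
  by_cases hx : x = 0
  · simp [hx]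
  · have : (‖x‖ : ℂ) ≠ 0 := by simpa using hx
    rw [normalize, inner_smul_left, inner_self_eq_norm_sq_to_K, map_inv₀, Complex.conj_ofReal]
    simp only [Complex.coe_algebraMap]
    field_simp

lemma quad_eq_norm_sq_mul {n : ℕ} (T : Op n) (p : ℕ) (x : Vec n) :
    quad T p x = ‖x‖ ^ 2 * quad T p (normalize x) := by
  have h : inner ℂ x ((T ^ p) x) =
      ((‖x‖ ^ 2 : ℝ) : ℂ) * inner ℂ (normalize x) ((T ^ p) (normalize x)) := by
    conv_lhs => rw [eq_smul_normalize x]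
    rw [map_smul, inner_smul_left, inner_smul_right, Complex.conj_ofReal, ← mul_assoc]
    congr 1
    rw [sq, Complex.ofReal_mul]
  rw [quad, h, quad]
  exact Complex.re_ofReal_mul _ _

lemma HasMoments.ofReal {Ω : Type*} [MeasurableSpace Ω] {P : Measure Ω}
    [IsProbabilityMeasure P] {X : Ω → ℝ} (h : HasMoments P X) : HasMoments P (fun ω => (X ω : ℂ)) :=
  h.mono (Complex.continuous_ofReal.comp_aestronglyMeasurable h.1) fun ω => by simp

/-! ### Cross moments and their exact expansion -/

section Single

variable {L κ : ℝ} {Lk : ℕ → ℝ} {Ω : Type*} [MeasurableSpace Ω] {P : Measure Ω}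
  [IsProbabilityMeasure P] {n N : ℕ} {f : Fin N → Ω → Vec n}

/-- The expectation of `‖f j‖²ᵏ ⟨f j, Mᵖ x⟩ ⟨y, f j⟩`. -/
def crossMoment (P : Measure Ω) (f : Fin N → Ω → Vec n) (S : Finset (Fin N)) (p k : ℕ)
    (x y : Vec n) (j : Fin N) : ℂ :=
  ∫ ω, ((‖f j ω‖ ^ (2 * k) : ℝ) : ℂ) *
    (inner ℂ (f j ω) ((randCov f S ω ^ p) x) * inner ℂ y (f j ω)) ∂P

lemma IsSample.hasMoments_cross (h : IsSample L κ Lk P f) (j : Fin N) (k : ℕ) {X : Ω → Vec n}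
    (hX : HasMoments P X) (y : Vec n) : HasMoments P (fun ω =>
      ((‖f j ω‖ ^ (2 * k) : ℝ) : ℂ) * (inner ℂ (f j ω) (X ω) * inner ℂ y (f j ω))) :=
  ((h.hasMoments j).norm.pow (2 * k)).ofReal.mul
    (((h.hasMoments j).inner hX).mul ((hasMoments_const y).inner (h.hasMoments j)))

lemma IsSample.norm_integral_cross_le_of_norm_le_one (h : IsSample L κ Lk P f) (j : Fin N) (k : ℕ)
    {x y : Vec n} (hx : ‖x‖ ≤ 1) (hy : ‖y‖ ≤ 1) :
    ‖∫ ω, ((‖f j ω‖ ^ (2 * k) : ℝ) : ℂ) * (inner ℂ (f j ω) x * inner ℂ y (f j ω)) ∂P‖ ≤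
      secondBound L Lk (2 * k) / n := by
  have hn : (0 : ℝ) < n := by exact_mod_cast h.pos
  have hm := h.hasMoments j
  have hk := h.secondBound_nonneg (2 * k)
  have b : ∀ z : Vec n, ‖z‖ ≤ 1 → Integrable (fun ω => ‖inner ℂ (f j ω) z‖ ^ 2 * ‖f j ω‖ ^ (2 * k)) P ∧
      ∫ ω, ‖inner ℂ (f j ω) z‖ ^ 2 * ‖f j ω‖ ^ (2 * k) ∂P ≤ secondBound L Lk (2 * k) / n :=
    fun z hz => ⟨(((hm.inner (hasMoments_const z)).norm.pow 2).mul (hm.norm.pow _)).integrable,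
      (h.integral_inner_sq_mul_le j (2 * k) z).trans
      (mul_le_of_le_one_right (by positivity) (pow_le_one₀ (norm_nonneg _) hz))⟩
  obtain ⟨i1, b1⟩ := b x hx
  obtain ⟨i2, b2⟩ := b y hy
  calc _ ≤ ∫ ω, (1 / 2 * (‖inner ℂ (f j ω) x‖ ^ 2 * ‖f j ω‖ ^ (2 * k)) +
        1 / 2 * (‖inner ℂ (f j ω) y‖ ^ 2 * ‖f j ω‖ ^ (2 * k))) ∂P := by
        refine norm_integral_le_of_norm_le ((i1.const_mul _).add (i2.const_mul _))
          (ae_of_all _ fun ω => ?_)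
        rw [norm_mul, norm_mul, Complex.norm_real, norm_pow, norm_norm, norm_inner_symm y]
        have h0 : 0 ≤ ‖f j ω‖ ^ (2 * k) := by positivity
        nlinarith [mul_nonneg h0 (sq_nonneg (‖inner ℂ (f j ω) x‖ - ‖inner ℂ (f j ω) y‖))]
    _ ≤ _ := by
        rw [integral_add (i1.const_mul _) (i2.const_mul _), integral_const_mul, integral_const_mul]
        linarith

lemma IsSample.norm_integral_cross_le (h : IsSample L κ Lk P f) (j : Fin N) (k : ℕ)
    (x : Vec n) {y : Vec n} (hy : ‖y‖ ≤ 1) :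
    ‖∫ ω, ((‖f j ω‖ ^ (2 * k) : ℝ) : ℂ) * (inner ℂ (f j ω) x * inner ℂ y (f j ω)) ∂P‖ ≤
      secondBound L Lk (2 * k) / n * ‖x‖ := by
  have e : ∀ ω, ((‖f j ω‖ ^ (2 * k) : ℝ) : ℂ) * (inner ℂ (f j ω) x * inner ℂ y (f j ω)) =
      (‖x‖ : ℂ) * (((‖f j ω‖ ^ (2 * k) : ℝ) : ℂ) *
        (inner ℂ (f j ω) (normalize x) * inner ℂ y (f j ω))) := by
    intro ω
    conv_lhs => rw [eq_smul_normalize x]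
    rw [inner_smul_right]
    ring
  simp only [e]
  rw [integral_const_mul, norm_mul, Complex.norm_real, norm_norm, mul_comm]
  exact mul_le_mul_of_nonneg_right
    (h.norm_integral_cross_le_of_norm_le_one j k (norm_normalize_le x) hy) (norm_nonneg _)

/-- Given `f j`, the integrand is linear in the independent vector Mᵖ x, which may therefore be
replaced by its mean. -/
lemma IsSample.integral_cross_randCov (h : IsSample L κ Lk P f) {S : Finset (Fin N)} {j : Fin N}
    (hj : j ∉ S) (p k : ℕ) (x y : Vec n) :
    ∫ ω, ((‖f j ω‖ ^ (2 * k) : ℝ) : ℂ) *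
        (inner ℂ (f j ω) ((randCov f S ω ^ p) x) * inner ℂ y (f j ω)) ∂P =
      ∫ ω, ((‖f j ω‖ ^ (2 * k) : ℝ) : ℂ) *
        (inner ℂ (f j ω) (∫ ω', (randCov f S ω' ^ p) x ∂P) * inner ℂ y (f j ω)) ∂P := by
  have hX := h.hasMoments_pow_apply S p (hasMoments_const (P := P) x)
  have cF : Continuous (Function.uncurry fun (v : Vec n) (T : Op n) =>
      ((‖v‖ ^ (2 * k) : ℝ) : ℂ) * (inner ℂ v ((T ^ p) x) * inner ℂ y v)) := by
    have c1 : Continuous fun z : Vec n × Op n => (z.2 ^ p) x :=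
      (continuous_pow_apply p).comp (continuous_snd.prodMk continuous_const)
    simp only [Function.uncurry_def]
    fun_prop
  rw [integral_eq_integral_integral (F := fun (v : Vec n) (T : Op n) =>
      ((‖v‖ ^ (2 * k) : ℝ) : ℂ) * (inner ℂ v ((T ^ p) x) * inner ℂ y v))
    (h.indepFun_randCov hj) (h.measurable j) (h.measurable_randCov S) cF.measurable.stronglyMeasurable
    (h.hasMoments_cross j k hX y).integrable]
  congr 1
  ext ω
  rw [integral_const_mul, integral_mul_const, integral_inner hX.integrable]

/-- The recursion for d with explicit errors, exact for any numbers `c`. Replacing the form of order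
i at `f j` by c_i ‖f_j‖² is what raises `k` to `k + 1`; the integrals carry the errors of the two
replacements. -/
lemma IsSample.crossMoment_eq (h : IsSample L κ Lk P f) {S : Finset (Fin N)} {j : Fin N}
    (hj : j ∈ S) (p k : ℕ) (x y : Vec n) (c : ℕ → ℂ) :
    crossMoment P f S p k x y j = c p * crossMoment P f S 0 k x y j +
      ∫ ω, ((‖f j ω‖ ^ (2 * k) : ℝ) : ℂ) * (inner ℂ (f j ω)
        (∫ ω', (randCov f (S.erase j) ω' ^ p) x ∂P - c p • x) * inner ℂ y (f j ω)) ∂P +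
      ∑ i ∈ Finset.range p, (c i * crossMoment P f S (p - 1 - i) (k + 1) x y j +
        ∫ ω, (((‖f j ω‖ ^ (2 * k) : ℝ) : ℂ) *
          ((quad (randCov f (S.erase j) ω) i (f j ω) : ℂ) - c i * ((‖f j ω‖ ^ 2 : ℝ) : ℂ))) *
          (inner ℂ (f j ω) ((randCov f S ω ^ (p - 1 - i)) x) * inner ℂ y (f j ω)) ∂P) := by
  have hm := h.hasMoments j
  have hc := hasMoments_const (P := P) x
  have hX := h.hasMoments_pow_apply (S.erase j) p hc
  have hY := fun q => h.hasMoments_pow_apply S q hc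
  have m1 := h.hasMoments_cross j k hX y
  have hi : ∀ i, HasMoments P (fun ω => (((‖f j ω‖ ^ (2 * k) : ℝ) : ℂ) *
          ((quad (randCov f (S.erase j) ω) i (f j ω) : ℂ) - c i * ((‖f j ω‖ ^ 2 : ℝ) : ℂ))) *
          (inner ℂ (f j ω) ((randCov f S ω ^ (p - 1 - i)) x) * inner ℂ y (f j ω))) := fun i =>
    ((hm.norm.pow (2 * k)).ofReal.mul ((h.hasMoments_quad _ i hm).ofReal.sub
      ((hasMoments_const (c i)).mul (hm.norm.pow 2).ofReal))).mul
      ((hm.inner (hY _)).mul ((hasMoments_const y).inner hm))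
  have hi2 : ∀ i, HasMoments P (fun ω => c i * (((‖f j ω‖ ^ (2 * (k + 1)) : ℝ) : ℂ) *
      (inner ℂ (f j ω) ((randCov f S ω ^ (p - 1 - i)) x) * inner ℂ y (f j ω)))) := fun i =>
    (hasMoments_const (c i)).mul (h.hasMoments_cross j (k + 1) (hY _) y)
  have e : ∀ ω, ((‖f j ω‖ ^ (2 * k) : ℝ) : ℂ) *
      (inner ℂ (f j ω) ((randCov f S ω ^ p) x) * inner ℂ y (f j ω)) =
      ((‖f j ω‖ ^ (2 * k) : ℝ) : ℂ) *
      (inner ℂ (f j ω) ((randCov f (S.erase j) ω ^ p) x) * inner ℂ y (f j ω)) +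
      ∑ i ∈ Finset.range p, (c i * (((‖f j ω‖ ^ (2 * (k + 1)) : ℝ) : ℂ) *
        (inner ℂ (f j ω) ((randCov f S ω ^ (p - 1 - i)) x) * inner ℂ y (f j ω))) +
        (((‖f j ω‖ ^ (2 * k) : ℝ) : ℂ) *
          ((quad (randCov f (S.erase j) ω) i (f j ω) : ℂ) - c i * ((‖f j ω‖ ^ 2 : ℝ) : ℂ))) *
          (inner ℂ (f j ω) ((randCov f S ω ^ (p - 1 - i)) x) * inner ℂ y (f j ω))) := by
    intro ω
    have k1 := pow_apply_rankOne_update (randCov f (S.erase j) ω) (f j ω) x (f j ω) p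
    have k2 : randCov f (S.erase j) ω + selfTensor (f j ω) = randCov f S ω :=
      (covOp_eq_erase_add hj _).symm
    rw [k2] at k1
    rw [k1, add_mul, mul_add, Finset.sum_mul, Finset.mul_sum]
    congr 1
    refine Finset.sum_congr rfl fun i _ => ?_
    rw [inner_pow_eq_quad (isPositive_covOp _ _), mul_add 2, mul_one, pow_add, Complex.ofReal_mul]
    ring
  have e0 : ∫ ω, ((‖f j ω‖ ^ (2 * k) : ℝ) : ℂ) * (inner ℂ (f j ω)
        (∫ ω', (randCov f (S.erase j) ω' ^ p) x ∂P) * inner ℂ y (f j ω)) ∂P =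
      c p * crossMoment P f S 0 k x y j +
      ∫ ω, ((‖f j ω‖ ^ (2 * k) : ℝ) : ℂ) * (inner ℂ (f j ω)
        (∫ ω', (randCov f (S.erase j) ω' ^ p) x ∂P - c p • x) * inner ℂ y (f j ω)) ∂P := by
    rw [crossMoment, ← integral_const_mul, ← integral_add]
    · congr 1
      ext ω
      rw [inner_sub_right, inner_smul_right, pow_zero, one_apply_eq_self]
      ring
    · exact ((h.hasMoments_cross j k (hY 0) y).integrable).const_mul _
    · exact (h.hasMoments_cross j k (hasMoments_const _) y).integrable
  rw [← e0, ← h.integral_cross_randCov (Finset.notMem_erase j S)]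
  rw [crossMoment]
  simp only [e]
  have hs := fun i => ((hi2 i).add (hi i)).integrable
  rw [integral_add m1.integrable (integrable_finsetSum _ fun i _ => hs i),
    integral_finsetSum _ fun i _ => hs i]
  congr 1
  refine Finset.sum_congr rfl fun i _ => ?_
  rw [crossMoment, ← integral_const_mul]
  exact integral_add (hi2 i).integrable (hi i).integrable

lemma IsSample.inner_integral_pow_succ (h : IsSample L κ Lk P f) (S : Finset (Fin N)) (p : ℕ)
    (x y : Vec n) : inner ℂ y (∫ ω, (randCov f S ω ^ (p + 1)) x ∂P) =
      ∑ j ∈ S, crossMoment P f S p 0 x y j := by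
  have hc := hasMoments_const (P := P) x
  rw [← integral_inner (h.hasMoments_pow_apply S (p + 1) hc).integrable]
  simp only [randCov, inner_covOp_pow_succ]
  rw [integral_finsetSum]
  · refine Finset.sum_congr rfl fun j _ => ?_
    simp [crossMoment]
  · intro j _
    exact (((h.hasMoments j).inner (h.hasMoments_pow_apply S p hc)).mul
      ((hasMoments_const y).inner (h.hasMoments j))).integrable

lemma abs_quad_le (T : Op n) (p : ℕ) {x : Vec n} (hx : ‖x‖ ≤ 1) :
    |quad T p x| ≤ 1 * (1 + ‖T‖) ^ p := by
  calc |quad T p x| ≤ ‖inner ℂ x ((T ^ p) x)‖ := RCLike.abs_re_le_norm _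
    _ ≤ ‖x‖ * ‖(T ^ p) x‖ := norm_inner_le_norm _ _
    _ ≤ 1 * (‖T‖ ^ p * 1) := by
      gcongr
      exact (norm_pow_apply_le T p x).trans (by gcongr)
    _ ≤ 1 * (1 + ‖T‖) ^ p := by
      rw [mul_one]
      gcongr
      linarith

end Single

/-! ### Subsamples with few omitted indices -/

/-- A set of indices omitting at most `r` indices, with two vectors in the unit ball. -/
structure Config (n N r : ℕ) where
  S : Finset (Fin N)
  x : Vec n
  y : Vec n
  card_compl : Sᶜ.card ≤ r
  norm_x : ‖x‖ ≤ 1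
  norm_y : ‖y‖ ≤ 1

/-- A configuration with a distinguished index. -/
structure PointedConfig (n N r : ℕ) extends Config n N r where
  j : Fin N
  mem : j ∈ S

/-- Remove the distinguished index. -/
def PointedConfig.erase {n N r : ℕ} (b : PointedConfig n N r) : Config n N (r + 1) where
  S := b.S.erase b.j
  x := b.x
  y := b.y
  card_compl := by
    rw [Finset.compl_erase]
    exact (Finset.card_insert_le _ _).trans (Nat.add_le_add_right b.card_compl 1)
  norm_x := b.norm_x
  norm_y := b.norm_y

lemma UZero.comp {γ γ' : ℕ → Type*} {X : ∀ m, γ m → ℝ} (hX : UZero X) (g : ∀ m, γ' m → γ m) :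
    UZero (fun m b => X m (g m b)) := fun ε hε => (hX ε hε).mono fun m hm b => hm (g m b)

lemma UZero.of_sq {γ : ℕ → Type*} {X : ∀ m, γ m → ℝ} (hX : UZero (fun m b => X m b ^ 2)) :
    UZero X := fun ε hε => (hX (ε ^ 2) (by positivity)).mono fun _ hm b =>
  (le_abs_self _).trans (abs_le_of_sq_le_sq (hm b) hε.le)

/-! ### Induction on the power -/

section Main

variable {n N : ℕ → ℕ} {Ω : ℕ → Type*} [∀ m, MeasurableSpace (Ω m)] {P : ∀ m, Measure (Ω m)}
  [∀ m, IsProbabilityMeasure (P m)] {f : ∀ m, Fin (N m) → Ω m → Vec (n m)}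
  {L κ : ℝ} {Lk : ℕ → ℝ} {r : ℕ}

/-- There are at most κ n indices, so summands that are o(1/n) uniformly in the index add up to
o(1). -/
lemma uZero_sum (h : ∀ m, IsSample L κ Lk (P m) (f m))
    {X : ∀ m, Config (n m) (N m) r → Fin (N m) → ℝ}
    (hX : UZero (fun m (b : PointedConfig (n m) (N m) r) => n m * X m b.toConfig b.j)) :
    UZero (fun m (b : Config (n m) (N m) r) => ∑ j ∈ b.S, X m b j) := by
  intro ε hε
  have hδ : 0 < ε / (|κ| + 1) := by positivity
  filter_upwards [hX _ hδ] with m hm b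
  have hn : (0 : ℝ) < n m := by exact_mod_cast (h m).pos
  calc _ ≤ κ * (ε / (|κ| + 1)) := (h m).sum_le b.S hδ.le fun j hj => by
          rw [le_div_iff₀ hn, mul_comm]
          exact hm ⟨b, j, hj⟩
    _ ≤ (|κ| + 1) * (ε / (|κ| + 1)) := by
        gcongr
        linarith [le_abs_self κ]
    _ = ε := mul_div_cancel₀ _ (by positivity)

/-- `E Mᵖ` is close to the multiple `c` of the identity. -/
def UMean (P : ∀ m, Measure (Ω m)) (f : ∀ m, Fin (N m) → Ω m → Vec (n m)) (r p : ℕ) (c : ℂ) :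
    Prop :=
  UZero (fun m (b : Config (n m) (N m) r) =>
    ‖∫ ω, (randCov (f m) b.S ω ^ p) b.x ∂(P m) - c • b.x‖)

/-- The quadratic forms of `Mᵖ` concentrate about those of the multiple `c` of the identity. -/
def VConc (P : ∀ m, Measure (Ω m)) (f : ∀ m, Fin (N m) → Ω m → Vec (n m)) (r p : ℕ) (c : ℂ) :
    Prop :=
  UZero (fun m (b : Config (n m) (N m) r) =>
    ∫ ω, ‖(quad (randCov (f m) b.S ω) p b.x : ℂ) - c * ((‖b.x‖ ^ 2 : ℝ) : ℂ)‖ ∂(P m))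

/-- The sums of the cross moments are close to the multiple `d` of the inner product. -/
def DLim (P : ∀ m, Measure (Ω m)) (f : ∀ m, Fin (N m) → Ω m → Vec (n m)) (r p k : ℕ) (d : ℂ) :
    Prop :=
  UZero (fun m (b : Config (n m) (N m) r) =>
    ‖∑ j ∈ b.S, crossMoment (P m) (f m) b.S p k b.x b.y j - d * inner ℂ b.y b.x‖)

/-- The mean of the form is controlled by the hypothesis. Its variance tends to zero by Efron-Stein
and the o(1/n) bound for the removal of one vector. -/
lemma UMean.vConc (h : ∀ m, IsSample L κ Lk (P m) (f m)) (hn : Tendsto n atTop atTop) {p : ℕ}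
    {c : ℂ} (hM : UMean P f r p c) : VConc P f r p c := by
  have hq : ∀ m (b : Config (n m) (N m) r),
      HasMoments (P m) (fun ω => quad (randCov (f m) b.S ω) p b.x) := fun m b =>
    (h m).hasMoments_quad b.S p (hasMoments_const b.x)
  have hvar : UZero (fun m (b : Config (n m) (N m) r) =>
      ∫ ω, |quad (randCov (f m) b.S ω) p b.x -
        ∫ ω', quad (randCov (f m) b.S ω') p b.x ∂(P m)| ∂(P m)) := by
    have h1 := (sNull_quad_sub_sq (β := fun m => PointedConfig (n m) (N m) r)
      (S := fun m b => b.S) (j := fun m b => b.j) (ξ := fun m b => b.x) h hn (fun m b => b.mem)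
      (fun m b => b.norm_x) p).2
    have h2 := uZero_sum h (X := fun m b j => ∫ ω, |(quad (randCov (f m) b.S ω) p b.x -
      quad (randCov (f m) (b.S.erase j) ω) p b.x) ^ 2| ∂(P m)) h1
    refine UZero.of_sq (h2.mono fun m b => ?_)
    have hsub := (hq m b).sub (hasMoments_const (∫ ω', quad (randCov (f m) b.S ω') p b.x ∂(P m)))
    have h4 := sq_integral_le hsub.norm
    simp only [Real.norm_eq_abs, sq_abs] at h4
    rw [integral_sub_const_sq (hq m b).integrable ((hq m b).pow 2).integrable] at h4
    refine h4.trans ?_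
    simp only [abs_sq]
    have h3 := (h m).efron_stein b.S (φ := fun T => quad T p b.x)
      (continuous_quad continuous_id continuous_const p)
      (fun T => abs_quad_le T p b.norm_x)
    refine le_trans (le_of_eq ?_) h3
    ring
  refine (hvar.add hM).mono fun m b => ?_
  have hmean : ((∫ ω, quad (randCov (f m) b.S ω) p b.x ∂(P m) : ℝ) : ℂ) =
      inner ℂ b.x (∫ ω, (randCov (f m) b.S ω ^ p) b.x ∂(P m)) := by
    rw [← integral_inner ((h m).hasMoments_pow_apply b.S p (hasMoments_const b.x)).integrable,
      ← integral_complex_ofReal]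
    exact integral_congr_ae (ae_of_all _ fun ω => (inner_pow_eq_quad (isPositive_covOp _ _) p b.x).symm)
  have hdist : ‖((∫ ω, quad (randCov (f m) b.S ω) p b.x ∂(P m) : ℝ) : ℂ) -
      c * ((‖b.x‖ ^ 2 : ℝ) : ℂ)‖ ≤ ‖∫ ω, (randCov (f m) b.S ω ^ p) b.x ∂(P m) - c • b.x‖ := by
    have e : ((‖b.x‖ ^ 2 : ℝ) : ℂ) = inner ℂ b.x b.x := by
      rw [inner_self_eq_norm_sq_to_K]
      simp
    rw [hmean, e, ← inner_smul_right, ← inner_sub_right]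
    exact (norm_inner_le_norm _ _).trans (mul_le_of_le_one_left (norm_nonneg _) b.norm_x)
  have i1 : Integrable (fun ω => |quad (randCov (f m) b.S ω) p b.x -
      ∫ ω', quad (randCov (f m) b.S ω') p b.x ∂(P m)|) (P m) :=
    ((hq m b).sub (hasMoments_const _)).norm.integrable
  calc _ ≤ ∫ ω, (|quad (randCov (f m) b.S ω) p b.x -
        ∫ ω', quad (randCov (f m) b.S ω') p b.x ∂(P m)| +
        ‖∫ ω, (randCov (f m) b.S ω ^ p) b.x ∂(P m) - c • b.x‖) ∂(P m) := by
        refine integral_mono ((hq m b).ofReal.sub (hasMoments_const _)).norm.integrable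
          (i1.add (integrable_const _)) fun ω => ?_
        refine (norm_sub_le_norm_sub_add_norm_sub _
          ((∫ ω, quad (randCov (f m) b.S ω) p b.x ∂(P m) : ℝ) : ℂ) _).trans (add_le_add ?_ hdist)
        rw [← Complex.ofReal_sub, Complex.norm_real, Real.norm_eq_abs]
    _ = _ := by
        rw [integral_add i1 (integrable_const _)]
        simp

/-- Given `f j` = v, independence leaves the form at a fixed vector, and homogeneity of degree two
reduces v to its normalization. Concentration uniform over the unit ball thus gives a bound δ E
‖f_j‖². -/
lemma VConc.uNull (h : ∀ m, IsSample L κ Lk (P m) (f m)) {i : ℕ} {c : ℂ}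
    (hV : VConc P f (r + 1) i c) :
    UNull P (fun m (b : PointedConfig (n m) (N m) r) ω =>
      ‖(quad (randCov (f m) (b.S.erase b.j) ω) i (f m b.j ω) : ℂ) -
        c * ((‖f m b.j ω‖ ^ 2 : ℝ) : ℂ)‖) := by
  have hm : ∀ m (b : PointedConfig (n m) (N m) r), HasMoments (P m) (fun ω =>
      ‖(quad (randCov (f m) (b.S.erase b.j) ω) i (f m b.j ω) : ℂ) -
        c * ((‖f m b.j ω‖ ^ 2 : ℝ) : ℂ)‖) := fun m b =>
    (((h m).hasMoments_quad _ i ((h m).hasMoments b.j)).ofReal.sub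
      ((hasMoments_const c).mul (((h m).hasMoments b.j).norm.pow 2).ofReal)).norm
  refine ⟨?_, fun ε hε => ?_⟩
  · refine ((uBdd_quad_erase (β := fun m => PointedConfig (n m) (N m) r) (S := fun m b => b.S)
      (j := fun m b => b.j) h (fun m b => b.mem) i).add
      ((uBdd_const ‖c‖).mul ((uBdd_norm h fun m b => b.j).pow 2))).mono hm fun m b ω => ?_
    have hp := quad_nonneg (isPositive_covOp (b.S.erase b.j) fun j => f m j ω) i (f m b.j ω)
    rw [abs_norm]
    refine (norm_sub_le _ _).trans (le_trans (le_of_eq ?_) (le_abs_self _))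
    rw [norm_mul, Complex.norm_real, Complex.norm_real, Real.norm_of_nonneg hp,
      Real.norm_of_nonneg (sq_nonneg _)]
  · set δ := ε / (Lk 2 + 1) with hδ
    have hL2 : 0 ≤ Lk 2 := (h 0).moment_nonneg 2
    have hδ0 : 0 < δ := by positivity
    filter_upwards [hV δ hδ0] with m hV b
    have cF : Continuous (Function.uncurry fun (v : Vec (n m)) (T : Op (n m)) =>
        ‖(quad T i v : ℂ) - c * ((‖v‖ ^ 2 : ℝ) : ℂ)‖) := by
      have c1 : Continuous fun z : Vec (n m) × Op (n m) => quad z.2 i z.1 :=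
        continuous_quad continuous_snd continuous_fst i
      simp only [Function.uncurry_def]
      fun_prop
    have i2 := ((h m).hasMoments b.j).norm.pow 2
    simp only [abs_norm]
    calc _ ≤ ∫ ω, δ * ‖f m b.j ω‖ ^ 2 ∂(P m) := by
          refine integral_le_of_forall_integral_le
            (F := fun v T => ‖(quad T i v : ℂ) - c * ((‖v‖ ^ 2 : ℝ) : ℂ)‖)
            (H := fun v => δ * ‖v‖ ^ 2)
            ((h m).indepFun_randCov (Finset.notMem_erase b.j b.S)) ((h m).measurable b.j)
            ((h m).measurable_randCov _) cF.measurable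
            (hm m b).integrable ((hasMoments_const δ).mul i2).integrable fun v => ?_
          have e : ∀ T : Op (n m), ‖(quad T i v : ℂ) - c * ((‖v‖ ^ 2 : ℝ) : ℂ)‖ =
              ‖v‖ ^ 2 * ‖(quad T i (normalize v) : ℂ) -
                c * ((‖normalize v‖ ^ 2 : ℝ) : ℂ)‖ := by
            intro T
            have e1 : ‖v‖ ^ 2 = ‖v‖ ^ 2 * ‖normalize v‖ ^ 2 := by
              have := quad_eq_norm_sq_mul T 0 v
              rwa [quad_zero, quad_zero] at this
            have e2 : (quad T i v : ℂ) - c * ((‖v‖ ^ 2 : ℝ) : ℂ) = ((‖v‖ ^ 2 : ℝ) : ℂ) *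
                ((quad T i (normalize v) : ℂ) - c * ((‖normalize v‖ ^ 2 : ℝ) : ℂ)) := by
              rw [mul_sub, mul_left_comm, ← Complex.ofReal_mul, ← Complex.ofReal_mul, ← e1,
                ← quad_eq_norm_sq_mul]
            rw [e2, norm_mul, Complex.norm_real, Real.norm_of_nonneg (sq_nonneg _)]
          simp only [e]
          rw [integral_const_mul, mul_comm]
          refine mul_le_mul_of_nonneg_right ?_ (sq_nonneg _)
          exact hV ⟨b.S.erase b.j, normalize v, 0, b.erase.card_compl, norm_normalize_le v, by simp⟩
      _ ≤ δ * Lk 2 := by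
          rw [integral_const_mul]
          exact mul_le_mul_of_nonneg_left ((h m).moment _ 2) hδ0.le
      _ ≤ δ * (Lk 2 + 1) := by
          gcongr
          linarith
      _ = ε := div_mul_cancel₀ _ (by positivity)

lemma UMean.sum_remainder (h : ∀ m, IsSample L κ Lk (P m) (f m)) {p : ℕ} {c : ℂ}
    (hM : UMean P f (r + 1) p c) (k : ℕ) :
    UZero (fun m (b : Config (n m) (N m) r) => ∑ j ∈ b.S,
      ‖∫ ω, ((‖f m j ω‖ ^ (2 * k) : ℝ) : ℂ) * (inner ℂ (f m j ω)
        (∫ ω', (randCov (f m) (b.S.erase j) ω' ^ p) b.x ∂(P m) - c • b.x) *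
          inner ℂ b.y (f m j ω)) ∂(P m)‖) := by
  refine uZero_sum h (((hM.comp fun m (b : PointedConfig (n m) (N m) r) => b.erase).const_mul
    ((h 0).secondBound_nonneg (2 * k))).mono fun m b => ?_)
  have hn : (0 : ℝ) < n m := by exact_mod_cast (h m).pos
  refine (mul_le_mul_of_nonneg_left
    ((h m).norm_integral_cross_le b.j k _ b.norm_y) hn.le).trans (le_of_eq ?_)
  rw [← mul_assoc, mul_div_cancel₀ _ hn.ne']
  rfl

/-- The product of the two inner products is at most half the sum of their squares, and the
concentration error times ‖f_j‖²ᵏ is a null weight for either square. -/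
lemma VConc.sum_remainder (h : ∀ m, IsSample L κ Lk (P m) (f m)) {i : ℕ} {c : ℂ}
    (hV : VConc P f (r + 1) i c) (q k : ℕ) :
    UZero (fun m (b : Config (n m) (N m) r) => ∑ j ∈ b.S,
      ‖∫ ω, (((‖f m j ω‖ ^ (2 * k) : ℝ) : ℂ) *
        ((quad (randCov (f m) (b.S.erase j) ω) i (f m j ω) : ℂ) -
          c * ((‖f m j ω‖ ^ 2 : ℝ) : ℂ))) *
        (inner ℂ (f m j ω) ((randCov (f m) b.S ω ^ q) b.x) * inner ℂ b.y (f m j ω)) ∂(P m)‖) := by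
  have hW := (hV.uNull h).mul_left
    ((uBdd_norm (β := fun m => PointedConfig (n m) (N m) r) h fun m b => b.j).pow (2 * k))
  have s1 := sNull_inner_self (S := fun m b => b.S) (j := fun m b => b.j) (ξ := fun m b => b.x)
    h (fun m b => b.mem) (fun m b => b.norm_x) q hW
  have s2 := sNull_inner_self (S := fun m b => b.S) (j := fun m b => b.j) (ξ := fun m b => b.y)
    h (fun m b => b.mem) (fun m b => b.norm_y) 0 hW
  have s3 := (s1.add s2).const_mul (1 / 2)
  refine uZero_sum h (s3.2.mono fun m b => ?_)
  refine mul_le_mul_of_nonneg_left ?_ (Nat.cast_nonneg _)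
  refine norm_integral_le_of_norm_le (s3.1 m b).norm.integrable (ae_of_all _ fun ω => ?_)
  refine le_trans ?_ (le_abs_self _)
  dsimp only
  rw [norm_mul, norm_mul, norm_mul, Complex.norm_real, norm_pow, norm_norm, pow_zero,
    one_apply_eq_self, norm_inner_symm b.y, ← add_mul]
  have h0 : 0 ≤ ‖f m b.j ω‖ ^ (2 * k) *
      ‖(quad (randCov (f m) (b.S.erase b.j) ω) i (f m b.j ω) : ℂ) -
        c * ((‖f m b.j ω‖ ^ 2 : ℝ) : ℂ)‖ := by positivity
  nlinarith [mul_nonneg h0 (sq_nonneg (‖inner ℂ (f m b.j ω) ((randCov (f m) b.S ω ^ q) b.x)‖ -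
    ‖inner ℂ (f m b.j ω) b.y‖))]

/-- The exact expansion is summed over j. Both kinds of replacement error concern the sample without
j, whence `r + 1` in the first two hypotheses. -/
lemma dLim_step (h : ∀ m, IsSample L κ Lk (P m) (f m)) {p k : ℕ} {a : ℂ} {c d : ℕ → ℂ}
    (hM : UMean P f (r + 1) p (c p)) (hV : ∀ i < p, VConc P f (r + 1) i (c i))
    (h0 : DLim P f r 0 k a) (hD : ∀ i < p, DLim P f r (p - 1 - i) (k + 1) (d i)) :
    DLim P f r p k (a * c p + ∑ i ∈ Finset.range p, c i * d i) := by
  refine (((h0.const_mul (norm_nonneg (c p))).add (hM.sum_remainder h k)).add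
    (UZero.sum (s := Finset.range p) fun i hi =>
      ((hD i (Finset.mem_range.1 hi)).const_mul (norm_nonneg (c i))).add
        ((hV i (Finset.mem_range.1 hi)).sum_remainder h (p - 1 - i) k))).mono fun m b => ?_
  have e : ∑ j ∈ b.S, crossMoment (P m) (f m) b.S p k b.x b.y j = _ :=
    Finset.sum_congr rfl fun j hj => (h m).crossMoment_eq hj p k b.x b.y c
  rw [e, Finset.sum_add_distrib, Finset.sum_add_distrib, ← Finset.mul_sum, Finset.sum_comm]
  simp only [Finset.sum_add_distrib (s := b.S), ← Finset.mul_sum (s := b.S)]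
  rw [add_mul, Finset.sum_mul]
  have e2 : ∀ A B D G : ℂ, ∀ E F : ℕ → ℂ,
      c p * A + B + ∑ i ∈ Finset.range p, (c i * E i + F i) -
        (a * c p * G + ∑ i ∈ Finset.range p, c i * d i * G) =
      c p * (A - a * G) + B + ∑ i ∈ Finset.range p, (c i * (E i - d i * G) + F i) := by
    intro A B D G E F
    have : ∑ i ∈ Finset.range p, (c i * (E i - d i * G) + F i) =
        ∑ i ∈ Finset.range p, (c i * E i + F i) - ∑ i ∈ Finset.range p, c i * d i * G := by
      rw [← Finset.sum_sub_distrib]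
      exact Finset.sum_congr rfl fun i _ => by ring
    rw [this]
    ring
  rw [e2 _ _ 0]
  refine (norm_add_le _ _).trans (add_le_add ((norm_add_le _ _).trans (add_le_add ?_ ?_)) ?_)
  · rw [norm_mul]
  · exact norm_sum_le _ _
  · refine (norm_sum_le _ _).trans (Finset.sum_le_sum fun i _ => ?_)
    refine (norm_add_le _ _).trans (add_le_add ?_ (norm_sum_le _ _))
    rw [norm_mul]

lemma uMean_zero : UMean P f r 0 1 := by
  refine uZero_zero.mono fun m b => ?_
  simp

/-- For `y` the normalized error vector, the inner product with the error is its norm; this is where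
uniformity in `y` is used. -/
lemma DLim.uMean_succ (h : ∀ m, IsSample L κ Lk (P m) (f m)) {p : ℕ} {d : ℂ}
    (hD : DLim P f r p 0 d) : UMean P f r (p + 1) d := by
  refine (hD.comp fun m (b : Config (n m) (N m) r) => (⟨b.S, b.x,
    normalize (∫ ω, (randCov (f m) b.S ω ^ (p + 1)) b.x ∂(P m) - d • b.x), b.card_compl, b.norm_x,
    norm_normalize_le _⟩ : Config (n m) (N m) r)).mono fun m b => le_of_eq ?_
  dsimp only
  rw [← (h m).inner_integral_pow_succ, ← inner_smul_right, ← inner_sub_right,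
    inner_normalize_self, Complex.norm_real, norm_norm]

/-- The assumption concerns the sum over all indices; each of the at most `r` omitted ones
contributes O(1/n). -/
lemma dLim_zero (h : ∀ m, IsSample L κ Lk (P m) (f m)) (hn : Tendsto n atTop atTop) {k : ℕ} {a : ℂ}
    {u : ℕ → ℝ} (hu : Tendsto u atTop (𝓝 0))
    (ha : ∀ m, ‖(∑ j, ∫ ω, ((‖f m j ω‖ ^ (2 * k) : ℝ) : ℂ) • selfTensor (f m j ω) ∂(P m)) -
      a • (1 : Op (n m))‖ ≤ u m) : DLim P f r 0 k a := by
  have hlim : Tendsto (fun m => u m + r * secondBound L Lk (2 * k) / (n m : ℝ)) atTop (𝓝 0) := by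
    simpa using hu.add (tendsto_const_nhds.div_atTop (tendsto_natCast_atTop_atTop.comp hn))
  refine (uZero_of_tendsto hlim).mono fun m b => ?_
  have hn : (0 : ℝ) < n m := by exact_mod_cast (h m).pos
  have e1 : ∀ j, inner ℂ b.y
      ((∫ ω, ((‖f m j ω‖ ^ (2 * k) : ℝ) : ℂ) • selfTensor (f m j ω) ∂(P m)) b.x) =
      crossMoment (P m) (f m) b.S 0 k b.x b.y j := by
    intro j
    have i1 : HasMoments (P m) (fun ω =>
        ((‖f m j ω‖ ^ (2 * k) : ℝ) : ℂ) • selfTensor (f m j ω)) := by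
      have hm := ((h m).hasMoments j).norm
      have hmeas := (h m).measurable j
      refine ((hm.pow (2 * k)).mul (hm.pow 2)).mono ?_ fun ω => ?_
      · have c1 : Continuous fun v : Vec (n m) => ((‖v‖ ^ (2 * k) : ℝ) : ℂ) • selfTensor v :=
          (by fun_prop : Continuous fun v : Vec (n m) => ((‖v‖ ^ (2 * k) : ℝ) : ℂ)).smul
            continuous_selfTensor
        exact (c1.measurable.comp hmeas).aestronglyMeasurable
      · have := norm_covOp_le {j} fun j => f m j ω
        simp only [covOp, Finset.sum_singleton] at this
        rw [norm_smul, norm_mul, Complex.norm_real, Real.norm_of_nonneg (sq_nonneg ‖f m j ω‖)]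
        exact mul_le_mul_of_nonneg_left this (norm_nonneg _)
    rw [ContinuousLinearMap.integral_apply i1.integrable, ← integral_inner
      (i1.integrable.apply_continuousLinearMap _), crossMoment]
    congr 1
    ext ω
    rw [smul_apply, inner_smul_right, selfTensor_apply, inner_smul_right, pow_zero,
      one_apply_eq_self]
  have e2 : ∑ j, crossMoment (P m) (f m) b.S 0 k b.x b.y j - a * inner ℂ b.y b.x =
      inner ℂ b.y (((∑ j, ∫ ω, ((‖f m j ω‖ ^ (2 * k) : ℝ) : ℂ) • selfTensor (f m j ω) ∂(P m)) -
      a • (1 : Op (n m))) b.x) := by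
    rw [sub_apply, inner_sub_right, sum_apply, inner_sum, smul_apply, one_apply_eq_self,
      inner_smul_right]
    simp only [e1]
  have e3 : ∑ j ∈ b.S, crossMoment (P m) (f m) b.S 0 k b.x b.y j - a * inner ℂ b.y b.x =
      (∑ j, crossMoment (P m) (f m) b.S 0 k b.x b.y j - a * inner ℂ b.y b.x) -
        ∑ j ∈ b.Sᶜ, crossMoment (P m) (f m) b.S 0 k b.x b.y j := by
    rw [← Finset.sum_add_sum_compl b.S]
    ring
  have hb := (h m).secondBound_nonneg (2 * k)
  rw [e3]
  refine (norm_sub_le _ _).trans (add_le_add ?_ ?_)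
  · rw [e2]
    refine (norm_inner_le_norm _ _).trans ((mul_le_of_le_one_left (norm_nonneg _) b.norm_y).trans ?_)
    exact ((ContinuousLinearMap.le_opNorm _ _).trans
      (mul_le_of_le_one_right (norm_nonneg _) b.norm_x)).trans (ha m)
  · have hbd : ∀ j ∈ b.Sᶜ, ‖crossMoment (P m) (f m) b.S 0 k b.x b.y j‖ ≤
        secondBound L Lk (2 * k) / n m := fun j _ => by
      simpa only [crossMoment, pow_zero, one_apply_eq_self] using
        (h m).norm_integral_cross_le_of_norm_le_one j k b.norm_x b.norm_y
    refine (norm_sum_le_of_le _ hbd).trans ?_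
    rw [Finset.sum_const, nsmul_eq_mul, mul_div_assoc]
    have : ((b.Sᶜ.card : ℕ) : ℝ) ≤ r := by exact_mod_cast b.card_compl
    gcongr

/-- The mean of order p + 1 comes from the cross moments of order p with `k = 0`. These need the
mean of order p, concentration for lower orders, and lower cross moments with `k + 1`. Since each
removal raises `r`, all `r` and `k` are treated at once. -/
lemma uMean_and_dLim (h : ∀ m, IsSample L κ Lk (P m) (f m)) (hn : Tendsto n atTop atTop)
    {a c : ℕ → ℂ} {d : ℕ → ℕ → ℂ} (hc0 : c 0 = 1) (hc : ∀ p, c (p + 1) = d p 0)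
    (hd : ∀ p k, d p k =
      a (k + 1) * c p + ∑ i ∈ Finset.range p, c i * d (p - 1 - i) (k + 1))
    (hbase : ∀ r k, DLim P f r 0 k (a (k + 1))) (p : ℕ) :
    (∀ r, UMean P f r p (c p)) ∧ ∀ r k, DLim P f r p k (d p k) := by
  induction p using Nat.strong_induction_on with
  | _ p ih =>
    have hM : ∀ r, UMean P f r p (c p) := by
      intro r
      cases p with
      | zero => rw [hc0]; exact uMean_zero
      | succ q => rw [hc]; exact ((ih q q.lt_succ_self).2 r 0).uMean_succ h
    refine ⟨hM, fun r k => ?_⟩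
    rw [hd]
    exact dLim_step h (hM (r + 1)) (fun i hi => ((ih i hi).1 (r + 1)).vConc h hn) (hbase r k)
      fun i hi => (ih (p - 1 - i) (by omega)).2 r (k + 1)

end Main

/-! ### From the hypotheses to samples, and from vectors to traces -/

section Conclusion

/-- The moment of order zero is 1 while `Lk 0` is not constrained, hence the maximum with 1. -/
lemma isSample_of_bounds {L κ : ℝ} {Lk : ℕ → ℝ} {Ω : Type*} [MeasurableSpace Ω] {P : Measure Ω}
    [IsProbabilityMeasure P] {n N : ℕ} {f : Fin N → Ω → Vec n} (hmeas : ∀ j, Measurable (f j))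
    (hindep : iIndepFun f P) (hL : 0 ≤ L)
    (hfour : ∀ j, ∀ x : Vec n, ‖x‖ = 1 → ∫ ω, ‖inner ℂ x (f j ω)‖ ^ 4 ∂P ≤ L / (n : ℝ) ^ 2)
    (hmom : ∀ j k, 1 ≤ k →
      Integrable (fun ω => ‖f j ω‖ ^ k) P ∧ ∫ ω, ‖f j ω‖ ^ k ∂P ≤ Lk k)
    (hn : 0 < n) (hN : (N : ℝ) ≤ κ * n) : IsSample L κ (fun k => max (Lk k) 1) P f where
  measurable := hmeas
  indep := hindep
  nonneg := hL
  four j x := by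
    by_cases hx : x = 0
    · simp [hx]
    have h1 : ‖normalize x‖ = 1 := by
      have : ‖x‖ ≠ 0 := by simpa using hx
      simp [normalize, norm_smul, this]
    have e : ∀ ω, ‖inner ℂ (f j ω) x‖ ^ 4 = ‖x‖ ^ 4 * ‖inner ℂ (normalize x) (f j ω)‖ ^ 4 := by
      intro ω
      conv_lhs => rw [eq_smul_normalize x]
      rw [inner_smul_right, norm_mul, Complex.norm_real, norm_norm, mul_pow, norm_inner_symm]
    simp only [e]
    rw [integral_const_mul, mul_comm]
    exact mul_le_mul_of_nonneg_right (hfour j _ h1) (by positivity)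
  integrable j k := by
    rcases Nat.eq_zero_or_pos k with rfl | hk
    · simp
    · exact (hmom j k hk).1
  moment_nonneg k := zero_le_one.trans (le_max_right _ _)
  moment j k := by
    rcases Nat.eq_zero_or_pos k with rfl | hk
    · simp
    · exact (hmom j k hk).2.trans (le_max_left _ _)
  pos := hn
  card_le := hN

variable {L κ : ℝ} {Lk : ℕ → ℝ}

lemma normTrace_eq_sum {n : ℕ} (T : Op n) :
    normTrace T = (n : ℂ)⁻¹ * ∑ k, inner ℂ (EuclideanSpace.basisFun (Fin n) ℂ k)
      (T (EuclideanSpace.basisFun (Fin n) ℂ k)) := by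
  rw [normTrace, trace_eq_sum_basis]

lemma IsSample.integrable_inner_pow_apply {Ω : Type*} [MeasurableSpace Ω] {P : Measure Ω}
    [IsProbabilityMeasure P] {n N : ℕ} {f : Fin N → Ω → Vec n} (h : IsSample L κ Lk P f)
    (S : Finset (Fin N)) (p : ℕ) (x : Vec n) :
    Integrable (fun ω => inner ℂ x ((randCov f S ω ^ p) x)) P :=
  ((hasMoments_const x).inner (h.hasMoments_pow_apply S p (hasMoments_const x))).integrable

lemma IsSample.integrable_normTrace {Ω : Type*} [MeasurableSpace Ω] {P : Measure Ω}
    [IsProbabilityMeasure P] {n N : ℕ} {f : Fin N → Ω → Vec n} (h : IsSample L κ Lk P f)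
    (S : Finset (Fin N)) (p : ℕ) : Integrable (fun ω => normTrace (randCov f S ω ^ p)) P := by
  simp only [normTrace_eq_sum]
  exact (integrable_finsetSum _ fun k _ => h.integrable_inner_pow_apply S p _).const_mul _

/-- The normalized trace is the average of the diagonal entries in an orthonormal basis, each within
ε of `c` in mean. -/
lemma IsSample.norm_integral_normTrace_sub_le {Ω : Type*} [MeasurableSpace Ω] {P : Measure Ω}
    [IsProbabilityMeasure P] {n N : ℕ} {f : Fin N → Ω → Vec n} (h : IsSample L κ Lk P f)
    (S : Finset (Fin N)) (p : ℕ) {c : ℂ} {ε : ℝ}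
    (hε : ∀ x : Vec n, ‖x‖ ≤ 1 → ‖∫ ω, (randCov f S ω ^ p) x ∂P - c • x‖ ≤ ε) :
    ‖∫ ω, normTrace (randCov f S ω ^ p) ∂P - c‖ ≤ ε := by
  have hn : (n : ℂ) ≠ 0 := by exact_mod_cast h.pos.ne'
  have hn' : (n : ℝ) ≠ 0 := by exact_mod_cast h.pos.ne'
  set e := EuclideanSpace.basisFun (Fin n) ℂ with he
  have h1 : ∀ k, ‖e k‖ = 1 := fun k => e.norm_eq_one k
  have key : ∫ ω, normTrace (randCov f S ω ^ p) ∂P - c =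
      (n : ℂ)⁻¹ * ∑ k, inner ℂ (e k) (∫ ω, (randCov f S ω ^ p) (e k) ∂P - c • e k) := by
    simp only [normTrace_eq_sum]
    rw [integral_const_mul, integral_finsetSum _ fun k _ => h.integrable_inner_pow_apply S p _]
    simp only [inner_sub_right, inner_smul_right, inner_self_eq_norm_sq_to_K, h1]
    rw [Finset.sum_sub_distrib, mul_sub]
    congr 1
    · congr 1
      refine Finset.sum_congr rfl fun k _ => ?_
      exact integral_inner (h.hasMoments_pow_apply S p (hasMoments_const (e k))).integrable _
    · simp [hn]
  rw [key, norm_mul, norm_inv, Complex.norm_natCast, inv_mul_le_iff₀ (by exact_mod_cast h.pos)]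
  refine (norm_sum_le_of_le _ fun k _ => (norm_inner_le_norm _ _).trans
    ((mul_le_of_le_one_left (norm_nonneg _) (h1 k).le).trans (hε _ (h1 k).le))).trans ?_
  simp

lemma UMean.tendsto_normTrace {n N : ℕ → ℕ} {Ω : ℕ → Type*} [∀ m, MeasurableSpace (Ω m)]
    {P : ∀ m, Measure (Ω m)} [∀ m, IsProbabilityMeasure (P m)]
    {f : ∀ m, Fin (N m) → Ω m → Vec (n m)} (h : ∀ m, IsSample L κ Lk (P m) (f m)) {p : ℕ} {c : ℂ}
    (hM : UMean P f 0 p c) :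
    Tendsto (fun m => ∫ ω, normTrace (randCov (f m) Finset.univ ω ^ p) ∂(P m)) atTop (𝓝 c) := by
  refine Metric.tendsto_nhds.2 fun ε hε => (hM (ε / 2) (half_pos hε)).mono fun m hm => ?_
  rw [dist_eq_norm]
  refine lt_of_le_of_lt ((h m).norm_integral_normTrace_sub_le Finset.univ p fun x hx => ?_)
    (half_lt_self hε)
  exact hm ⟨Finset.univ, x, x, by simp, hx, hx⟩

end Conclusion

end SampleCov

end

theorem theorem1p1
    -- for each `m`, a probability space and `N m` random vectors on `ℂ^(n m)`
    {Ω : ℕ → Type*} [∀ m, MeasurableSpace (Ω m)]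
    (P : ∀ m, Measure (Ω m)) [∀ m, IsProbabilityMeasure (P m)]
    (n N : ℕ → ℕ)
    (f : ∀ m, Fin (N m) → Ω m → EuclideanSpace ℂ (Fin (n m)))
    (hf_meas : ∀ m j, Measurable (f m j))
    (hf_indep : ∀ m, iIndepFun (f m) (P m))
    -- bounded marginal fourth moments
    (L : ℝ) (hL : 0 < L)
    (hf_four : ∀ m j, ∀ x : EuclideanSpace ℂ (Fin (n m)), ‖x‖ = 1 →
      ∫ ω, ‖inner ℂ x (f m j ω)‖ ^ 4 ∂(P m) ≤ L / (n m : ℝ) ^ 2)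
    -- bounded moments of the norms
    (Lk : ℕ → ℝ) (hLk : ∀ k, 1 ≤ k → 0 < Lk k)
    (hf_mom : ∀ m j k, 1 ≤ k →
      Integrable (fun ω => ‖f m j ω‖ ^ k) (P m) ∧ ∫ ω, ‖f m j ω‖ ^ k ∂(P m) ≤ Lk k)
    -- `n, N → ∞` with `n / N → lam`
    (hn : Tendsto n atTop atTop) (hN : Tendsto N atTop atTop)
    (lam : ℝ) (hlam : 0 < lam)
    (hratio : Tendsto (fun m => (n m : ℝ) / (N m : ℝ)) atTop (𝓝 lam))
    -- the constants `a k`, `C k`, `ε₀` do not depend on `m`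
    (a : ℕ → ℂ) (C : ℕ → ℝ) (hC : ∀ k, 1 ≤ k → 0 < C k) (ε₀ : ℝ) (hε₀ : 0 < ε₀)
    (ha : ∀ m k, 1 ≤ k →
      ‖(∑ j, ∫ ω, ((‖f m j ω‖ ^ (2 * (k - 1)) : ℝ) : ℂ) • SampleCov.selfTensor (f m j ω) ∂(P m))
          - a k • (1 : EuclideanSpace ℂ (Fin (n m)) →L[ℂ] EuclideanSpace ℂ (Fin (n m)))‖
        ≤ C k * (n m : ℝ) ^ (-ε₀))
    (p : ℕ) :
    (∀ m, Integrable
      (fun ω => SampleCov.normTrace ((∑ j, SampleCov.selfTensor (f m j ω)) ^ p)) (P m)) ∧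
    Tendsto
      (fun m => ∫ ω, SampleCov.normTrace ((∑ j, SampleCov.selfTensor (f m j ω)) ^ p) ∂(P m))
      atTop (𝓝 (∑ π ∈ SampleCov.NC p, ∏ B ∈ π.parts, a B.card)) := by
  refine ⟨fun m => ?_, ?_⟩
  -- In dimension zero the normalized trace vanishes since `0⁻¹ = 0`. Otherwise κ = N/n suffices, as
  -- integrability requires no uniformity in `m`.
  · rcases Nat.eq_zero_or_pos (n m) with h0 | h0
    · simp [SampleCov.normTrace, h0]
    · have h0' : (n m : ℝ) ≠ 0 := by exact_mod_cast h0.ne'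
      exact (SampleCov.isSample_of_bounds (hf_meas m) (hf_indep m) hL.le (hf_four m) (hf_mom m) h0
        (div_mul_cancel₀ (N m : ℝ) h0').ge).integrable_normTrace Finset.univ p
  -- The constant 2/λ comes from n/N > λ/2. This and positivity of n hold only from some `m₀` on, so
  -- the sequences are shifted by `m₀`.
  · have hev : ∀ᶠ m in atTop, 0 < n m ∧ (N m : ℝ) ≤ 2 / lam * n m := by
      filter_upwards [hn.eventually_gt_atTop 0, hN.eventually_gt_atTop 0,
        hratio.eventually (lt_mem_nhds (half_lt_self hlam))] with m h1 h2 h3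
      refine ⟨h1, ?_⟩
      have h2' : (0 : ℝ) < N m := by exact_mod_cast h2
      rw [lt_div_iff₀ h2'] at h3
      rw [div_mul_eq_mul_div, le_div_iff₀ hlam]
      linarith
    obtain ⟨m₀, hm₀⟩ := eventually_atTop.1 hev
    have hsample := fun m => SampleCov.isSample_of_bounds (hf_meas (m + m₀)) (hf_indep (m + m₀))
      hL.le (hf_four (m + m₀)) (hf_mom (m + m₀)) (hm₀ _ (Nat.le_add_left m₀ m)).1
      (hm₀ _ (Nat.le_add_left m₀ m)).2
    have hn' : Tendsto (fun m => n (m + m₀)) atTop atTop := (tendsto_add_atTop_iff_nat m₀).2 hn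
    obtain ⟨c, d, hNC, hc0, hc, hd⟩ := SampleCov.exists_ncRecursion a
    rw [hNC]
    refine (tendsto_add_atTop_iff_nat m₀).1 ?_
    refine SampleCov.UMean.tendsto_normTrace hsample
      ((SampleCov.uMean_and_dLim hsample hn' hc0 hc hd (fun r k => ?_) p).1 0)
    have hu : Tendsto (fun m => C (k + 1) * (n (m + m₀) : ℝ) ^ (-ε₀)) atTop (𝓝 0) := by
      simpa using ((tendsto_rpow_neg_atTop hε₀).comp
        (tendsto_natCast_atTop_atTop.comp hn')).const_mul (C (k + 1))
    -- The hypothesis at index `k + 1` has the exponent `2 * (k + 1 - 1)`, which reduces to `2 * k`.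
    exact SampleCov.dLim_zero hsample hn' hu fun m => ha (m + m₀) (k + 1) (Nat.le_add_left 1 k)
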